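/- **Setting.** Let $n=2k$ be even. For a subspace $A\le\mathbb F_2^n$ let $A^\perp$ be its orthogonal complement for the dot product, and let $\mathcal I_{d,A}$ be the set of multilinear polynomials over $\mathbb F_2$ in $n$ variables, of degree at most $d$, that vanish on $A$. Given $m$ and $\epsilon$, the *noisy system* $\mathcal R_{d,A,m,\epsilon}$ is the law of $(p_1,\dots,p_m)$ obtained as follows: a uniformly random set of $\lfloor\epsilon m\rfloor$ positions is chosen; for $i$ outside this set, $p_i$ is uniform in $\mathcal I_{d,A}$; for $i$ in this set, $p_i$ is uniform in $\mathcal I_{d,A'_i}$ for a fresh uniformly random subspace $A'_i$ of dimension $\dim A$; all choices are independent. Fix $\epsilon\in[0,1/2)$, a real $\beta\ge 3/(1-2\epsilon)^2$ and an integer $d\ge 4$, and put $m=\lceil\beta n\rceil$. A *random instance* $(A,s)$ consists of a uniformly random $A\le\mathbb F_2^n$ of dimension $n/2$ and $s=(s_A,s_{A^\perp})$, where $s_A=(p_1,\dots,p_m)$ and $s_{A^\perp}=(q_1,\dots,q_m)$ are drawn, independently given $A$, from $\mathcal R_{d,A,m,\epsilon}$ and $\mathcal R_{d,A^\perp,m,\epsilon}$;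 polynomials are described by their lists of coefficients. *Polynomial size* refers to families of quantum circuits, one for each $n$, over the gate set NOT, Hadamard, $T$, CNOT, Toffoli, whose numbers of gates and of ancillas (initialised to $|0\rangle$) are bounded by a polynomial in $n$. **The mini-scheme $\mathcal E$.** The bank draws a random instance $(A,s)$ and issues the serial number $s$ with the money state $|A\rangle=|A|^{-1/2}\sum_{x\in A}|x\rangle$. On serial number $s$, the verifier puts $Z=\{v:\sum_i p_i(v)\le\epsilon m\}$ and $Z^\perp=\{v:\sum_i q_i(v)\le\epsilon m\}$ (the sums count, in $\mathbb Z$, the polynomials that are nonzero at $v$) and accepts a state $\psi$ with probability $\|V_Z\psi\|^2$, where $V_Z=H^{\otimes n}\,\mathbb P_{Z^\perp}\,H^{\otimes n}\,\mathbb P_Z$ and $\mathbb P_S$ is the projection onto the span of the basis states in $S$. A *counterfeiter* is a polynomial-size family $C$ that maps a banknote $|s\rangle|A\rangle$ to two, possibly entangled, $n$-qubit registers; $\mathrm{succ}_C(n)$ is the probability, over the banknote, $C$ and the verification, that the verifier with the serial number $s$ accepts both registers. $\mathcal E$ is *secure* if every banknote that the bank can issue is accepted with probability at least $2/3$, and there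 is a negligible function $\delta$ (that is, $\delta(n)=o(1/p(n))$ for every polynomial $p$) such that each counterfeiter $C$ satisfies $\mathrm{succ}_C(n)\le\delta(n)$ for all sufficiently large $n$. **The conjecture.** A *generator finder* is a polynomial-size family $F$ that receives only $s$ and outputs, by measurement, a list of $n$ vectors of $\mathbb F_2^n$; $\mathrm{succ}_F(n)$ is the probability, over the random instance and the measurement, that these vectors span $A$. The conjecture for $(\epsilon,\beta,d)$ says that no generator finder has success probability $\Omega(2^{-n/2})$: there are no $F$ and $c>0$ with $\mathrm{succ}_F(n)\ge c\,2^{-n/2}$ for infinitely many (even) $n$. **Theorem.** For all $\epsilon,\beta,d$ as above: 1. If the conjecture holds for $(\epsilon,\beta,d)$, then $\mathcal E$ with these parameters is secure. 2. For every counterfeiter $C$ against $\mathcal E$ and every polynomial $p$ with coefficients in $\mathbb N$ there are a generator finder $F$ and a constant $c>0$ such that, for all sufficiently large even $n$: if $p(n)\,\mathrm{succ}_C(n)\ge 1$, then $\mathrm{succ}_F(n)\ge c\,2^{-n/2}$. -/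

import Mathlib

open Filter

noncomputable section

namespace HiddenSubspace

/-! ### Quantum circuits -/

/-- A bit string on the wires `W`, identified with a vector over the field with two elements. -/
abbrev Bits (W : Type) : Type := W → ZMod 2

/-- A (pure, possibly unnormalised) state of the qubits `W`: amplitudes in the computational
basis. -/
abbrev QState (W : Type) : Type := Bits W → ℂ

/-- The squared norm of a state. -/
def normSq {W : Type} [Fintype W] [DecidableEq W] (ψ : QState W) : ℝ := ∑ x, ‖ψ x‖ ^ 2

/-- The sign `(-1) ^ b` of a bit. -/
def sgn (b : ZMod 2) : ℂ := (-1) ^ b.val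

/-- The gates of a universal gate set: NOT, Hadamard, the phase gate `T = diag(1, exp(iπ/4))`,
controlled NOT and doubly controlled NOT (the target, which is named last, is not a control). -/
inductive Gate (W : Type) : Type where
  | not (t : W) : Gate W
  | hadamard (t : W) : Gate W
  | phase (t : W) : Gate W
  | cnot (c t : W) (h : c ≠ t) : Gate W
  | toffoli (c₁ c₂ t : W) (h₁ : c₁ ≠ t) (h₂ : c₂ ≠ t) : Gate W

/-- The unitary action of a gate. -/
def Gate.apply {W : Type} [DecidableEq W] : Gate W → QState W → QState W
  | .not t, ψ => fun x => ψ (Function.update x t (x t + 1))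
  | .hadamard t, ψ => fun x =>
      (1 / (Real.sqrt 2 : ℂ)) *
        (ψ (Function.update x t 0) + sgn (x t) * ψ (Function.update x t 1))
  | .phase t, ψ => fun x =>
      (if x t = 1 then Complex.exp (Complex.I * (Real.pi / 4 : ℂ)) else 1) * ψ x
  | .cnot c t _, ψ => fun x => ψ (Function.update x t (x t + x c))
  | .toffoli c₁ c₂ t _ _, ψ => fun x => ψ (Function.update x t (x t + x c₁ * x c₂))

/-- A quantum circuit: the list of its gates, in the order in which they are applied. -/
abbrev Circuit (W : Type) : Type := List (Gate W)

/-- The action of a circuit on a state. -/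
def Circuit.run {W : Type} [DecidableEq W] (C : Circuit W) (ψ : QState W) : QState W :=
  C.foldl (fun φ g => g.apply φ) ψ

/-- `f n` is bounded by a polynomial in `n`. -/
def IsPolyBounded (f : ℕ → ℕ) : Prop := ∃ p : Polynomial ℕ, ∀ n, f n ≤ p.eval n

/-- `δ = o(1 / p)` for every polynomial `p`. -/
def IsNegligible (δ : ℕ → ℝ) : Prop :=
  Asymptotics.SuperpolynomialDecay atTop (fun n : ℕ => (n : ℝ)) δ

/-- The expectation of a real function under a probability distribution on a finite type. -/
def expect {α : Type} [Fintype α] (μ : PMF α) (f : α → ℝ) : ℝ := ∑ a, (μ a).toReal * f a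

/-! ### Mini-schemes -/

/-- A public-key quantum money mini-scheme whose money states are pure. For the security parameter
`0ⁿ` the bank draws a classical outcome `o` from `bank n` and issues the banknote that consists of
the serial number `serial n o` and the money state `money n o`. On the serial number `s`,
verification is a measurement with two outcomes; `ver n s` is the operator of its accepting branch,
so that `ψ` is accepted with probability `‖ver n s ψ‖²`. -/
structure MiniScheme where
  SerialWire : ℕ → Type
  [fintypeSerialWire : ∀ n, Fintype (SerialWire n)]
  [decEqSerialWire : ∀ n, DecidableEq (SerialWire n)]
  qubits : ℕ → ℕ
  Outcome : ℕ → Type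
  [fintypeOutcome : ∀ n, Fintype (Outcome n)]
  bank : ∀ n, PMF (Outcome n)
  serial : ∀ n, Outcome n → Bits (SerialWire n)
  money : ∀ n, Outcome n → QState (Fin (qubits n))
  ver : ∀ n, Bits (SerialWire n) → QState (Fin (qubits n)) →ₗ[ℂ] QState (Fin (qubits n))
  normSq_money : ∀ n o, normSq (money n o) = 1
  normSq_ver_le : ∀ n s ψ, normSq (ver n s ψ) ≤ normSq ψ

attribute [instance] MiniScheme.fintypeSerialWire MiniScheme.decEqSerialWire
  MiniScheme.fintypeOutcome

/-- Every banknote that the bank can issue is accepted with probability at least `1 - ε`. -/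
def MiniScheme.HasCompletenessError (M : MiniScheme) (ε : ℝ) : Prop :=
  ∀ n, ∀ o ∈ (M.bank n).support, 1 - ε ≤ normSq (M.ver n (M.serial n o) (M.money n o))

/-- The wires of a counterfeiting circuit: the serial number (`S`), the register that holds the
given money state, a second register of the same size, and `a` ancillas. The two middle registers
are also the output registers. -/
abbrev CopyWire (S : Type) (q a : ℕ) : Type := S ⊕ Fin q ⊕ Fin q ⊕ Fin a

/-- The input state `|s⟩ |ψ⟩ |0⟩ |0⟩` of a counterfeiting circuit. -/
def copyInput {S : Type} [Fintype S] {q a : ℕ} (s : Bits S) (ψ : QState (Fin q)) :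
    QState (CopyWire S q a) := fun x =>
  if (∀ i, x (.inl i) = s i) ∧ (∀ j, x (.inr (.inr (.inl j))) = 0) ∧
      (∀ l, x (.inr (.inr (.inr l))) = 0)
  then ψ (fun j => x (.inr (.inl j))) else 0

/-- `V` applied to the first output register. -/
def onFirst {S : Type} {q a : ℕ} (V : QState (Fin q) →ₗ[ℂ] QState (Fin q))
    (φ : QState (CopyWire S q a)) : QState (CopyWire S q a) := fun x =>
  V (fun y => φ (Sum.elim (fun i => x (.inl i)) (Sum.elim y (fun l => x (.inr (.inr l))))))
    (fun j => x (.inr (.inl j)))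

/-- `V` applied to the second output register. -/
def onSecond {S : Type} {q a : ℕ} (V : QState (Fin q) →ₗ[ℂ] QState (Fin q))
    (φ : QState (CopyWire S q a)) : QState (CopyWire S q a) := fun x =>
  V (fun y => φ (Sum.elim (fun i => x (.inl i)) (Sum.elim (fun j => x (.inr (.inl j)))
      (Sum.elim y (fun l => x (.inr (.inr (.inr l))))))))
    (fun j => x (.inr (.inr (.inl j))))

/-- A counterfeiter: a family of quantum circuits of polynomial size (counting gates and
ancillas). -/
structure Counterfeiter (M : MiniScheme) where
  ancillas : ℕ → ℕ
  circuit : ∀ n, Circuit (CopyWire (M.SerialWire n) (M.qubits n) (ancillas n))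
  polySize : IsPolyBounded (fun n => ancillas n + (circuit n).length)

/-- The probability that the double verifier accepts: a banknote is drawn, the counterfeiter is run
on it, and both output registers are verified with the serial number of the original banknote. -/
def Counterfeiter.success {M : MiniScheme} (C : Counterfeiter M) (n : ℕ) : ℝ :=
  expect (M.bank n) fun o =>
    normSq (onFirst (M.ver n (M.serial n o)) (onSecond (M.ver n (M.serial n o))
      (Circuit.run (C.circuit n) (copyInput (M.serial n o) (M.money n o)))))

/-- Every counterfeiter of polynomial size succeeds with probability at most `δ n`, for all
sufficiently large `n`. -/
def MiniScheme.HasSoundnessError (M : MiniScheme) (δ : ℕ → ℝ) : Prop :=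
  ∀ C : Counterfeiter M, ∀ᶠ n in atTop, C.success n ≤ δ n

/-- Completeness error at most `1/3` and negligible soundness error. -/
def MiniScheme.Secure (M : MiniScheme) : Prop :=
  M.HasCompletenessError (1 / 3) ∧ ∃ δ : ℕ → ℝ, IsNegligible δ ∧ M.HasSoundnessError δ

/-! ### Polynomials that hide a subspace -/

/-- `𝔽₂ⁿ`. -/
abbrev Vec (n : ℕ) : Type := Bits (Fin n)

/-- The subspaces of `𝔽₂ⁿ`. -/
abbrev Subspc (n : ℕ) : Type := Submodule (ZMod 2) (Vec n)

instance instFintypeSubspc (n : ℕ) : Fintype (Subspc n) := Fintype.ofFinite _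

/-- The orthogonal complement for the dot product. -/
def perp {n : ℕ} (A : Subspc n) : Subspc n where
  carrier := {y | ∀ x ∈ A, x ⬝ᵥ y = 0}
  add_mem' := by
    intro y z hy hz x hx
    rw [dotProduct_add, hy x hx, hz x hx, add_zero]
  zero_mem' := by
    intro x _
    exact dotProduct_zero x
  smul_mem' := by
    intro c y hy x hx
    rw [dotProduct_smul, hy x hx, smul_zero]

/-- The multilinear monomials of degree at most `d` in `n` variables. -/
abbrev Monom (n d : ℕ) : Type := {S : Finset (Fin n) // S.card ≤ d}

/-- The multilinear polynomials of degree at most `d` in `n` variables over the field with two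
elements, as lists of coefficients. -/
abbrev MLPoly (n d : ℕ) : Type := Monom n d → ZMod 2

/-- The value of a polynomial at a point. -/
def MLPoly.eval {n d : ℕ} (p : MLPoly n d) (v : Vec n) : ZMod 2 :=
  ∑ S : Monom n d, p S * ∏ i ∈ S.1, v i

open Classical in
/-- The polynomials of degree at most `d` that vanish on `A`. -/
def vanishing {n : ℕ} (d : ℕ) (A : Subspc n) : Finset (MLPoly n d) :=
  Finset.univ.filter fun p => ∀ v ∈ A, p.eval v = 0

theorem vanishing_nonempty {n : ℕ} (d : ℕ) (A : Subspc n) : (vanishing d A).Nonempty :=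
  ⟨fun _ => 0, by
    simp only [vanishing, Finset.mem_filter, Finset.mem_univ, true_and]
    intro v _
    simp [MLPoly.eval]⟩

/-- A uniformly random polynomial that vanishes on `A`. -/
def randomVanishing {n : ℕ} (d : ℕ) (A : Subspc n) : PMF (MLPoly n d) :=
  PMF.uniformOfFinset (vanishing d A) (vanishing_nonempty d A)

/-- The subspaces of dimension `r`. -/
def subspacesOfDim (n r : ℕ) : Finset (Subspc n) :=
  Finset.univ.filter fun A => Module.finrank (ZMod 2) A = r

theorem subspacesOfDim_nonempty {n r : ℕ} (h : r ≤ n) : (subspacesOfDim n r).Nonempty := by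
  have hli : LinearIndependent (ZMod 2)
      ((fun i : Fin n => (Pi.single i 1 : Vec n)) ∘ Fin.castLE h) :=
    (Pi.linearIndependent_single_one (Fin n) (ZMod 2)).comp _ (Fin.castLE_injective h)
  refine ⟨Submodule.span (ZMod 2) (Set.range
    ((fun i : Fin n => (Pi.single i 1 : Vec n)) ∘ Fin.castLE h)), ?_⟩
  simp only [subspacesOfDim, Finset.mem_filter, Finset.mem_univ, true_and]
  simpa using finrank_span_eq_card hli

/-- A uniformly random subspace of dimension `r`. -/
def randomSubspace {n r : ℕ} (h : r ≤ n) : PMF (Subspc n) :=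
  PMF.uniformOfFinset (subspacesOfDim n r) (subspacesOfDim_nonempty h)

/-- A decoy for `A`: a uniformly random polynomial that vanishes on a uniformly random subspace of
the same dimension as `A`. -/
def randomDecoy {n : ℕ} (d : ℕ) (A : Subspc n) : PMF (MLPoly n d) :=
  (randomSubspace (Submodule.finrank_le A |>.trans_eq (by simp) :
    Module.finrank (ZMod 2) A ≤ n)).bind fun B => randomVanishing d B

/-- The law of a tuple of independent random variables with laws `μ i`. -/
def productPMF {ι α : Type} [Fintype ι] [DecidableEq ι] [Fintype α] (μ : ι → PMF α) :
    PMF (ι → α) :=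
  PMF.ofFintype (fun f => ∏ i, μ i (f i)) (by
    classical
    rw [← Fintype.prod_sum]
    refine Finset.prod_eq_one fun i _ => ?_
    rw [← tsum_fintype (L := .unconditional α)]
    exact (μ i).tsum_coe)

theorem decoySets_nonempty (m r : ℕ) :
    (Finset.powersetCard (min r m) (Finset.univ : Finset (Fin m))).Nonempty :=
  Finset.powersetCard_nonempty.2 (by simp)

/-- The noisy system of `m` polynomials for `A` at noise rate `ε`. A uniformly random set of
`⌊ε m⌋` positions is filled with decoys, all other positions with random polynomials that vanish on
`A`; all these polynomials are independent. (The minimum with `m` is inactive for `ε ≤ 1`.) -/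
def noisySystem {n : ℕ} (d : ℕ) (A : Subspc n) (m : ℕ) (ε : ℝ) : PMF (Fin m → MLPoly n d) :=
  (PMF.uniformOfFinset (Finset.powersetCard (min ⌊ε * m⌋₊ m) (Finset.univ : Finset (Fin m)))
    (decoySets_nonempty m _)).bind fun D =>
      productPMF fun i => if i ∈ D then randomDecoy d A else randomVanishing d A

/-- The set of points at which at most a fraction `ε` of the polynomials are nonzero. -/
def acceptedPoints {n d m : ℕ} (ε : ℝ) (p : Fin m → MLPoly n d) : Set (Vec n) :=
  {v | ((∑ i, ((p i).eval v).val : ℕ) : ℝ) ≤ ε * m}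

/-! ### The explicit hidden-subspace mini-scheme

The number of qubits is `n = 2 k`, the security parameter is indexed by `k`, and the dimension of
the hidden subspace is `n / 2 = k`. -/

/-- The number `⌈β n⌉` of polynomials in each of the two systems. -/
def numPolys (β : ℝ) (k : ℕ) : ℕ := ⌈β * ((2 * k : ℕ) : ℝ)⌉₊

/-- The system of polynomials published for one subspace. -/
abbrev PolySystem (β : ℝ) (d k : ℕ) : Type := Fin (numPolys β k) → MLPoly (2 * k) d

/-- One wire for each coefficient of each polynomial of the two systems. -/
abbrev SystemWire (β : ℝ) (d k : ℕ) : Type :=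
  (Fin (numPolys β k) × Monom (2 * k) d) ⊕ (Fin (numPolys β k) × Monom (2 * k) d)

instance instDecidableEqSystemWire (β : ℝ) (d k : ℕ) : DecidableEq (SystemWire β d k) :=
  inferInstanceAs (DecidableEq (_ ⊕ _))

instance instFintypeSystemWire (β : ℝ) (d k : ℕ) : Fintype (SystemWire β d k) :=
  inferInstanceAs (Fintype (_ ⊕ _))

/-- The serial number that describes the two systems: all coefficients. -/
def encodeSystems {β : ℝ} {d k : ℕ} (p q : PolySystem β d k) : Bits (SystemWire β d k) :=
  Sum.elim (fun c => p c.1 c.2) (fun c => q c.1 c.2)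

/-- The first system described by a serial number. -/
def decodeFst {β : ℝ} {d k : ℕ} (s : Bits (SystemWire β d k)) : PolySystem β d k :=
  fun i S => s (.inl (i, S))

/-- The second system described by a serial number. -/
def decodeSnd {β : ℝ} {d k : ℕ} (s : Bits (SystemWire β d k)) : PolySystem β d k :=
  fun i S => s (.inr (i, S))

/-- The hidden subspace together with the two systems of polynomials. -/
abbrev Instance (β : ℝ) (d k : ℕ) : Type :=
  Subspc (2 * k) × PolySystem β d k × PolySystem β d k

/-- A uniformly random subspace `A` of dimension `n / 2`, and, independently given `A`, noisy
systems for `A` and for its orthogonal complement. -/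
def randomInstance (ε β : ℝ) (d k : ℕ) : PMF (Instance β d k) :=
  (randomSubspace (n := 2 * k) (r := k) (by omega)).bind fun A =>
    (noisySystem d A (numPolys β k) ε).bind fun p =>
      (noisySystem d (perp A) (numPolys β k) ε).map fun q => (A, p, q)

/-- The uniform superposition `|A⟩` over the elements of `A`. -/
def subspaceState {n : ℕ} (A : Subspc n) : QState (Fin n) :=
  (A : Set (Vec n)).indicator fun _ => 1 / (Real.sqrt (Nat.card A) : ℂ)

/-- The projection onto the span of the basis states in `Z`. -/
def basisProj {n : ℕ} (Z : Set (Vec n)) : QState (Fin n) →ₗ[ℂ] QState (Fin n) where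
  toFun ψ := Z.indicator ψ
  map_add' ψ φ := Set.indicator_add' Z ψ φ
  map_smul' c ψ := Set.indicator_const_smul Z c ψ

/-- The Hadamard transform on all `n` qubits. -/
def hadamardAll (n : ℕ) : QState (Fin n) →ₗ[ℂ] QState (Fin n) where
  toFun ψ := fun x => (1 / (Real.sqrt (2 ^ n) : ℂ)) * ∑ y, sgn (x ⬝ᵥ y) * ψ y
  map_add' ψ φ := by
    funext x
    simp [mul_add, Finset.sum_add_distrib]
  map_smul' c ψ := by
    funext x
    simp only [Pi.smul_apply, smul_eq_mul, RingHom.id_apply, Finset.mul_sum]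
    exact Finset.sum_congr rfl fun y _ => by ring

/-- The verification operator `H P_W H P_Z`. -/
def verOp {n : ℕ} (Z W : Set (Vec n)) : QState (Fin n) →ₗ[ℂ] QState (Fin n) :=
  hadamardAll n ∘ₗ basisProj W ∘ₗ hadamardAll n ∘ₗ basisProj Z

theorem sgn_add (a b : ZMod 2) : sgn (a + b) = sgn a * sgn b := by
  have h : ∀ a : ZMod 2, a = 0 ∨ a = 1 := by decide
  have h2 : (1 + 1 : ZMod 2) = 0 := by decide
  rcases h a with rfl | rfl <;> rcases h b with rfl | rfl <;> simp [sgn, h2, ZMod.val_one]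

theorem conj_sgn (a : ZMod 2) : (starRingEnd ℂ) (sgn a) = sgn a := by
  simp [sgn]

theorem sum_sgn {n : ℕ} (z : Vec n) :
    ∑ x : Vec n, sgn (x ⬝ᵥ z) = if z = 0 then (2 : ℂ) ^ n else 0 := by
  split_ifs with hz
  · subst hz
    simp [sgn]
  · obtain ⟨i, hi⟩ := Function.ne_iff.1 hz
    have hi1 : z i = 1 := by
      have : ∀ a : ZMod 2, a ≠ 0 → a = 1 := by decide
      exact this _ hi
    have key : ∑ x : Vec n, sgn (x ⬝ᵥ z) = ∑ x : Vec n, -sgn (x ⬝ᵥ z) := by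
      refine Fintype.sum_equiv (Equiv.addRight (Pi.single i 1)) _ _ fun x => ?_
      have : sgn (1 : ZMod 2) = -1 := by simp [sgn, ZMod.val_one]
      simp [add_dotProduct, sgn_add, hi1, this]
    rw [Finset.sum_neg_distrib] at key
    exact self_eq_neg.1 key

theorem normSq_hadamardAll {n : ℕ} (ψ : QState (Fin n)) :
    normSq (hadamardAll n ψ) = normSq ψ := by
  have hz : ∀ z : ℂ, ((‖z‖ ^ 2 : ℝ) : ℂ) = z * (starRingEnd ℂ) z := fun z => by
    rw [Complex.mul_conj, Complex.normSq_eq_norm_sq]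
  have hs : (1 / (Real.sqrt (2 ^ n) : ℂ)) * (1 / (Real.sqrt (2 ^ n) : ℂ)) * 2 ^ n = 1 := by
    have h2 : ((Real.sqrt (2 ^ n) : ℝ) : ℂ) * ((Real.sqrt (2 ^ n) : ℝ) : ℂ) = 2 ^ n := by
      rw [← Complex.ofReal_mul, Real.mul_self_sqrt (by positivity)]
      norm_num
    have h0 : (2 : ℂ) ^ n ≠ 0 := pow_ne_zero _ two_ne_zero
    rw [div_mul_div_comm, h2]
    field_simp
  have hyz : ∀ y z : Vec n, y + z = 0 ↔ z = y := by
    intro y z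
    rw [add_eq_zero_iff_eq_neg, eq_comm]
    constructor
    · rintro h
      rw [← neg_neg z]
      funext i
      simpa using (congrFun h i)
    · rintro rfl
      funext i
      simp
  apply Complex.ofReal_injective
  simp only [normSq, Complex.ofReal_sum, hz, hadamardAll, LinearMap.coe_mk, AddHom.coe_mk]
  calc ∑ x : Vec n, (1 / (Real.sqrt (2 ^ n) : ℂ) * ∑ y, sgn (x ⬝ᵥ y) * ψ y) *
        (starRingEnd ℂ) (1 / (Real.sqrt (2 ^ n) : ℂ) * ∑ y, sgn (x ⬝ᵥ y) * ψ y)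
      = ∑ x : Vec n, ∑ y : Vec n, ∑ z : Vec n,
          (1 / (Real.sqrt (2 ^ n) : ℂ)) * (1 / (Real.sqrt (2 ^ n) : ℂ)) *
            (ψ y * (starRingEnd ℂ) (ψ z)) * sgn (x ⬝ᵥ (y + z)) := by
        refine Finset.sum_congr rfl fun x _ => ?_
        simp only [map_mul, map_sum, conj_sgn, map_div₀, map_one, Complex.conj_ofReal]
        rw [mul_mul_mul_comm, Finset.sum_mul_sum, Finset.mul_sum]
        refine Finset.sum_congr rfl fun y _ => ?_
        rw [Finset.mul_sum]
        refine Finset.sum_congr rfl fun z _ => ?_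
        rw [dotProduct_add, sgn_add]
        ring
    _ = ∑ y : Vec n, ψ y * (starRingEnd ℂ) (ψ y) := by
        rw [Finset.sum_comm]
        refine Finset.sum_congr rfl fun y _ => ?_
        rw [Finset.sum_comm]
        simp only [← Finset.mul_sum, sum_sgn, hyz, mul_ite, mul_zero,
          Finset.sum_ite_eq', Finset.mem_univ, if_true]
        rw [mul_right_comm, hs, one_mul]

theorem normSq_basisProj_le {n : ℕ} (Z : Set (Vec n)) (ψ : QState (Fin n)) :
    normSq (basisProj Z ψ) ≤ normSq ψ := by
  refine Finset.sum_le_sum fun x _ => ?_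
  by_cases hx : x ∈ Z <;> simp [basisProj, hx]

theorem normSq_verOp_le {n : ℕ} (Z W : Set (Vec n)) (ψ : QState (Fin n)) :
    normSq (verOp Z W ψ) ≤ normSq ψ := by
  simp only [verOp, LinearMap.comp_apply, normSq_hadamardAll]
  refine (normSq_basisProj_le _ _).trans ?_
  rw [normSq_hadamardAll]
  exact normSq_basisProj_le _ _

theorem normSq_subspaceState {n : ℕ} (A : Subspc n) : normSq (subspaceState A) = 1 := by
  classical
  have hA : (0 : ℝ) < Nat.card A := by exact_mod_cast Nat.card_pos
  have h : ∀ x : Vec n, ‖subspaceState A x‖ ^ 2 =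
      if x ∈ A then (1 / (Nat.card A : ℝ)) else 0 := by
    intro x
    by_cases hx : x ∈ A
    · simp [subspaceState, hx]
    · simp [subspaceState, hx]
  have hc : (Finset.univ.filter fun x : Vec n => x ∈ A).card = Nat.card A := by
    rw [Nat.card_eq_fintype_card, Fintype.card_subtype]
  simp only [normSq, h]
  rw [← Finset.sum_filter, Finset.sum_const, hc, nsmul_eq_mul]
  field_simp

/-- The explicit hidden-subspace mini-scheme with noise rate `ε`, `⌈β n⌉` polynomials in each of
the two systems, and degree `d`. -/
def explicitScheme (ε β : ℝ) (d : ℕ) : MiniScheme where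
  SerialWire k := SystemWire β d k
  qubits k := 2 * k
  Outcome k := Instance β d k
  bank k := randomInstance ε β d k
  serial _ o := encodeSystems o.2.1 o.2.2
  money _ o := subspaceState o.1
  ver _ s := verOp (acceptedPoints ε (decodeFst s)) (acceptedPoints ε (decodeSnd s))
  normSq_money _ o := normSq_subspaceState o.1
  normSq_ver_le _ _ ψ := normSq_verOp_le _ _ ψ

/-! ### Finding generators -/

/-- The wires of a circuit that looks for generators: the two systems of polynomials, an output
register for `n = 2 k` vectors of `𝔽₂ⁿ`, and `a` ancillas. -/
abbrev FinderWire (β : ℝ) (d k a : ℕ) : Type :=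
  SystemWire β d k ⊕ (Fin (2 * k) × Fin (2 * k)) ⊕ Fin a

/-- The input state `|s⟩ |0⟩ |0⟩`. -/
def finderInput {β : ℝ} {d k a : ℕ} (s : Bits (SystemWire β d k)) :
    QState (FinderWire β d k a) := fun x =>
  if (∀ i, x (.inl i) = s i) ∧ (∀ j, x (.inr (.inl j)) = 0) ∧ (∀ l, x (.inr (.inr l)) = 0)
  then 1 else 0

/-- The list of vectors in the output register. -/
def outputVectors {β : ℝ} {d k a : ℕ} (x : Bits (FinderWire β d k a)) :
    Fin (2 * k) → Vec (2 * k) :=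
  fun i j => x (.inr (.inl (i, j)))

/-- A polynomial-time quantum algorithm that looks for generators of the hidden subspace: a family
of quantum circuits of polynomial size (counting gates and ancillas). -/
structure GeneratorFinder (β : ℝ) (d : ℕ) where
  ancillas : ℕ → ℕ
  circuit : ∀ k, Circuit (FinderWire β d k (ancillas k))
  polySize : IsPolyBounded (fun k => ancillas k + (circuit k).length)

/-- The probability, over the random instance and the measurement of the output register, that the
output vectors generate the hidden subspace. -/
def GeneratorFinder.success {β : ℝ} {d : ℕ} (F : GeneratorFinder β d) (ε : ℝ) (k : ℕ) : ℝ :=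
  expect (randomInstance ε β d k) fun o =>
    ∑ x, {x | Submodule.span (ZMod 2) (Set.range (outputVectors x)) = o.1}.indicator
      (fun x => ‖Circuit.run (F.circuit k) (finderInput (encodeSystems o.2.1 o.2.2)) x‖ ^ 2) x

/-- No polynomial-time quantum algorithm that is given noisy systems for `A` and for its orthogonal
complement finds generators of `A` with success probability `Ω(2 ^ (-n / 2))`, where `n = 2 k`;
that is, none reaches `c * 2 ^ (-n / 2)` for infinitely many `n` and a constant `c > 0`. -/
def GeneratorConjecture (ε β : ℝ) (d : ℕ) : Prop :=
  ¬ ∃ F : GeneratorFinder β d, ∃ c : ℝ, 0 < c ∧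
    ∃ᶠ k in atTop, c * (2 : ℝ) ^ (-((2 * k : ℕ) : ℝ) / 2) ≤ F.success ε k

end HiddenSubspace

end

noncomputable section

set_option linter.unusedSectionVars false

namespace HiddenSubspace

/-! ### Linear action of circuits -/

section Basics

variable {V W : Type} [DecidableEq V] [DecidableEq W]

/-! Write n = 2k and P = p(k). Call an instance exact if its two sets of accepted points are A and
the orthogonal complement of A. The verification operator is then the rank-one projection onto the
money state |A⟩ (`verOp_eq`). All but a fraction 6/4^k of the instances are exact
(`expect_not_instance_exact_le`). At a point outside A a genuine polynomial takes a fair random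
value and a decoy almost does, so a Chernoff bound with (1-2ε)²m ≥ 3n survives the union over 2^n
points.

On exact instances, membership in either set is a threshold condition on polynomial values, so a
polynomial-size circuit reading s can test coherently for |A⟩ and reflect about it. The finder
starts from the uniform superposition, which passes the test for |A⟩ with probability |A|/2^n =
2^(-k), and amplifies this with 4P rounds to at least 8P/2^k. It then feeds |A⟩ to the counterfeiter
n times, each time keeping one copy as an output register. If the counterfeiter succeeds on the
instance with probability at least 1/(4P), its version amplified with 4kP rounds fails with
probability at most 1/(4k), so all n stages succeed with probability at least 1/2. Measuring the n
copies gives independent uniform elements of A, which span A except with probability 2^(-k)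
(`le_sum_span`). Together this is at least 2P/2^k (`finder_success_le`). If the average success of
the counterfeiter is at least 1/P, such instances have weight at least 1/(2P), and the product is
2^(-k) = 2^(-n/2). The gain P in the first stage pays exactly for the rarity of good instances.

Amplification (`amplify_parts`, `amplify_spec`) repeats a test. After a failure the preparation is
undone, a reflection about the start state is made, and the preparation is redone. Each round
multiplies the amplitude of the branch without any success by -(1-2q), so the failure probability is
(1-q)(1-2q)^(2T). It never increases with T, so q need not be known. Flags replace measurements, and
the flags are projected on only in the analysis. Success leaves the tested registers in the range of
a rank-one projection, hence unentangled with the garbage, and this lets the stages be chained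
(`Ready`).

For security, a single negligible function must serve all counterfeiters. If for a fixed exponent j
circuits of size k^j succeeded with probability above k^(-j) for infinitely many k, they could be
glued into one nonuniform counterfeiter, which the reduction turns into a forbidden finder. Hence
the largest unbreakable exponent tends to infinity, and k to minus that exponent is the bound. -/

theorem zmod_two_cases (a : ZMod 2) : a = 0 ∨ a = 1 := by
  revert a; decide

theorem zmod_two_ne_zero {a : ZMod 2} : a ≠ 0 ↔ a = 1 := by
  revert a; decide

theorem zmod_two_add_self (a : ZMod 2) : a + a = 0 := by
  revert a; decide

theorem Gate.apply_add (g : Gate W) (ψ φ : QState W) :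
    g.apply (ψ + φ) = g.apply ψ + g.apply φ := by
  funext x
  cases g <;> simp only [Gate.apply, Pi.add_apply] <;> ring

theorem Gate.apply_smul (g : Gate W) (c : ℂ) (ψ : QState W) :
    g.apply (c • ψ) = c • g.apply ψ := by
  funext x
  cases g <;> simp only [Gate.apply, Pi.smul_apply, smul_eq_mul] <;> ring

/-- The action of a gate as a linear map. -/
def Gate.lin (g : Gate W) : QState W →ₗ[ℂ] QState W where
  toFun := g.apply
  map_add' := g.apply_add
  map_smul' := g.apply_smul

theorem Circuit.run_nil (ψ : QState W) : Circuit.run [] ψ = ψ := rfl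

theorem Circuit.run_cons (g : Gate W) (C : Circuit W) (ψ : QState W) :
    Circuit.run (g :: C) ψ = Circuit.run C (g.apply ψ) := rfl

theorem Circuit.run_append (C D : Circuit W) (ψ : QState W) :
    Circuit.run (C ++ D) ψ = Circuit.run D (Circuit.run C ψ) := by
  simp [Circuit.run, List.foldl_append]

/-- The action of a circuit as a linear map. -/
def Circuit.lin : Circuit W → (QState W →ₗ[ℂ] QState W)
  | [] => LinearMap.id
  | g :: C => Circuit.lin C ∘ₗ g.lin

theorem Circuit.lin_apply (C : Circuit W) (ψ : QState W) : Circuit.lin C ψ = Circuit.run C ψ := by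
  induction C generalizing ψ with
  | nil => rfl
  | cons g C ih => exact ih _

/-- The inverse of a gate. -/
def Gate.inv : Gate W → Circuit W
  | .phase t => List.replicate 7 (.phase t)
  | g => [g]

theorem Gate.length_inv {W : Type} (g : Gate W) : g.inv.length ≤ 7 := by
  cases g <;> simp [Gate.inv]

theorem exp_pi_four_pow : Complex.exp (Complex.I * (Real.pi / 4 : ℂ)) ^ 4 = -1 := by
  rw [← Complex.exp_nat_mul, ← Complex.exp_pi_mul_I]
  congr 1
  push_cast
  ring

theorem sgn_zero : sgn 0 = 1 := by simp [sgn]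

theorem sgn_one : sgn 1 = -1 := by simp [sgn, ZMod.val_one]

theorem sqrt_two_half : (1 / (Real.sqrt 2 : ℂ)) * (1 / (Real.sqrt 2 : ℂ)) = 1 / 2 := by
  rw [div_mul_div_comm, ← Complex.ofReal_mul, Real.mul_self_sqrt (by norm_num)]
  norm_num

theorem Gate.apply_involutive (g : Gate W) (hg : ∀ t, g ≠ .phase t) (ψ : QState W) :
    g.apply (g.apply ψ) = ψ := by
  funext x
  cases g with
  | not t =>
    simp only [Gate.apply, Function.update_self, Function.update_idem, add_assoc,
      zmod_two_add_self, add_zero, Function.update_eq_self]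
  | hadamard t =>
    simp only [Gate.apply, Function.update_self, Function.update_idem, sgn_zero, sgn_one]
    have h := sqrt_two_half
    rcases zmod_two_cases (x t) with h0 | h0
    · have hx : Function.update x t 0 = x := by rw [← h0, Function.update_eq_self]
      rw [h0, sgn_zero, hx]
      linear_combination (2 * ψ x) * h
    · have hx : Function.update x t 1 = x := by rw [← h0, Function.update_eq_self]
      rw [h0, sgn_one, hx]
      linear_combination (2 * ψ x) * h
  | phase t => exact absurd rfl (hg t)
  | cnot c t h =>
    simp only [Gate.apply, Function.update_self, Function.update_idem, add_assoc,
      Function.update_of_ne h, zmod_two_add_self, add_zero, Function.update_eq_self]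
  | toffoli c₁ c₂ t h₁ h₂ =>
    simp only [Gate.apply, Function.update_self, Function.update_idem, add_assoc,
      Function.update_of_ne h₁, Function.update_of_ne h₂, zmod_two_add_self, add_zero,
      Function.update_eq_self]

theorem run_replicate_phase (m : ℕ) (t : W) (ψ : QState W) (x : Bits W) :
    Circuit.run (List.replicate m (.phase t)) ψ x =
      (if x t = 1 then Complex.exp (Complex.I * (Real.pi / 4 : ℂ)) else 1) ^ m * ψ x := by
  induction m generalizing ψ with
  | zero => simp [Circuit.run]
  | succ m ih =>
    rw [List.replicate_succ, Circuit.run_cons, ih]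
    simp only [Gate.apply]
    ring

theorem Gate.apply_run_inv (g : Gate W) (ψ : QState W) :
    g.apply (Circuit.run g.inv ψ) = ψ := by
  cases g with
  | phase t =>
    funext x
    simp only [Gate.apply, Gate.inv, run_replicate_phase]
    split_ifs
    -- The gate and its seven copies make an eighth power of the phase, and the fourth power is
    -- already -1.
    · rw [← mul_assoc, ← pow_succ', show 7 + 1 = 4 * 2 by norm_num, pow_mul, exp_pi_four_pow]
      norm_num
    · simp
  | _ => exact Gate.apply_involutive _ (by simp) ψ

/-- The inverse of a circuit. -/
def Circuit.inv : Circuit W → Circuit W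
  | [] => []
  | g :: C => Circuit.inv C ++ g.inv

theorem Circuit.length_inv {W : Type} (C : Circuit W) : (Circuit.inv C).length ≤ 7 * C.length := by
  induction C with
  | nil => simp [Circuit.inv]
  | cons g C ih =>
    have := g.length_inv
    simp only [Circuit.inv, List.length_append, List.length_cons]
    omega

theorem Circuit.run_run_inv (C : Circuit W) (ψ : QState W) :
    Circuit.run C (Circuit.run (Circuit.inv C) ψ) = ψ := by
  induction C generalizing ψ with
  | nil => rfl
  | cons g C ih =>
    rw [Circuit.inv, Circuit.run_append, Circuit.run_cons, Gate.apply_run_inv, ih]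

/-! ### The Hermitian product -/

variable [Fintype V] [Fintype W]

/-- The Hermitian product of two states. -/
def herm (ψ φ : QState W) : ℂ := ∑ x, (starRingEnd ℂ) (ψ x) * φ x

theorem normSq_eq_herm (ψ : QState W) : ((normSq ψ : ℝ) : ℂ) = herm ψ ψ := by
  simp only [normSq, herm, Complex.ofReal_sum]
  refine Finset.sum_congr rfl fun x _ => ?_
  rw [mul_comm, Complex.mul_conj, Complex.normSq_eq_norm_sq]

theorem normSq_nonneg (ψ : QState W) : 0 ≤ normSq ψ :=
  Finset.sum_nonneg fun _ _ => by positivity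

theorem normSq_smul (c : ℂ) (ψ : QState W) : normSq (c • ψ) = ‖c‖ ^ 2 * normSq ψ := by
  simp only [normSq, Pi.smul_apply, smul_eq_mul, norm_mul, mul_pow, Finset.mul_sum]

theorem herm_sub_right (ψ φ χ : QState W) : herm ψ (φ - χ) = herm ψ φ - herm ψ χ := by
  simp [herm, mul_sub, Finset.sum_sub_distrib]

theorem herm_sub_left (ψ φ χ : QState W) : herm (ψ - φ) χ = herm ψ χ - herm φ χ := by
  simp [herm, sub_mul, Finset.sum_sub_distrib]

/-- Flipping the bit t permutes the strings, so each term may be replaced by the average over its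
pair. A Hadamard gate preserves the Hermitian product pair by pair, not term by term. -/
theorem sum_bits_split (t : W) (F : Bits W → ℂ) :
    ∑ x, F x = ∑ x, (1 / 2) * (F (Function.update x t 0) + F (Function.update x t 1)) := by
  have h : ∑ x, F x = ∑ x, F (Function.update x t (x t + 1)) :=
    (Equiv.sum_comp (Function.Involutive.toPerm
      (fun x : Bits W => Function.update x t (x t + 1))
        (fun x => by simp [add_assoc, zmod_two_add_self])) F).symm
  have h2 : ∑ x, F x = (1 / 2) * (∑ x, F x + ∑ x, F x) := by ring
  conv_rhs at h2 => rw [congrArg (HAdd.hAdd (∑ x, F x)) h]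
  rw [h2, ← Finset.sum_add_distrib, Finset.mul_sum]
  refine Finset.sum_congr rfl fun x _ => ?_
  rcases zmod_two_cases (x t) with h0 | h0
  · have hx : Function.update x t 0 = x := by rw [← h0, Function.update_eq_self]
    rw [h0, hx, zero_add]
  · have hx : Function.update x t 1 = x := by rw [← h0, Function.update_eq_self]
    rw [h0, hx, zmod_two_add_self]
    ring

theorem Gate.herm_apply (g : Gate W) (ψ φ : QState W) :
    herm (g.apply ψ) (g.apply φ) = herm ψ φ := by
  cases g with
  | phase t =>
    refine Finset.sum_congr rfl fun x _ => ?_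
    simp only [Gate.apply, map_mul]
    split_ifs
    · have h1 : (starRingEnd ℂ) (Complex.exp (Complex.I * (Real.pi / 4 : ℂ))) *
          Complex.exp (Complex.I * (Real.pi / 4 : ℂ)) = 1 := by
        rw [← Complex.exp_conj, ← Complex.exp_add]
        simp [map_ofNat]
      linear_combination ((starRingEnd ℂ) (ψ x) * φ x) * h1
    · simp
  | hadamard t =>
    unfold herm
    rw [sum_bits_split t, sum_bits_split t (fun x => (starRingEnd ℂ) (ψ x) * φ x)]
    refine Finset.sum_congr rfl fun x _ => ?_
    simp only [Gate.apply, Function.update_self, Function.update_idem, sgn_zero, sgn_one,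
      map_mul, map_add, map_div₀, map_one, Complex.conj_ofReal, map_neg]
    linear_combination ((starRingEnd ℂ) (ψ (Function.update x t 0)) * φ (Function.update x t 0) +
      (starRingEnd ℂ) (ψ (Function.update x t 1)) * φ (Function.update x t 1)) * sqrt_two_half
  | not t =>
    exact Fintype.sum_equiv (Function.Involutive.toPerm
      (fun x : Bits W => Function.update x t (x t + 1))
        (fun x => by simp [add_assoc, zmod_two_add_self])) _ _ fun x => rfl
  | cnot c t h =>
    exact Fintype.sum_equiv (Function.Involutive.toPerm
      (fun x : Bits W => Function.update x t (x t + x c))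
        (fun x => by simp [add_assoc, zmod_two_add_self, h])) _ _ fun x => rfl
  | toffoli c₁ c₂ t h₁ h₂ =>
    exact Fintype.sum_equiv (Function.Involutive.toPerm
      (fun x : Bits W => Function.update x t (x t + x c₁ * x c₂))
        (fun x => by simp [add_assoc, zmod_two_add_self, h₁, h₂])) _ _ fun x => rfl

theorem Circuit.herm_run (C : Circuit W) (ψ φ : QState W) :
    herm (Circuit.run C ψ) (Circuit.run C φ) = herm ψ φ := by
  induction C generalizing ψ φ with
  | nil => rfl
  | cons g C ih => rw [Circuit.run_cons, Circuit.run_cons, ih, Gate.herm_apply]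

theorem normSq_of_herm {T : QState V → QState W} (hT : ∀ ψ φ, herm (T ψ) (T φ) = herm ψ φ)
    (ψ : QState V) : normSq (T ψ) = normSq ψ := by
  apply Complex.ofReal_injective
  rw [normSq_eq_herm, normSq_eq_herm, hT]

end Basics

/-! ### Operators on some of the wires -/

section Lift

variable {U V W : Type}

/-- The state of the wires `e` when all the other wires have the values `x`. -/
def slice (e : V → W) (x : Bits W) : QState W →ₗ[ℂ] QState V where
  toFun ψ := fun y => ψ (Function.extend e y x)
  map_add' _ _ := rfl
  map_smul' _ _ := rfl

theorem slice_apply (e : V → W) (x : Bits W) (ψ : QState W) (y : Bits V) :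
    slice e x ψ y = ψ (Function.extend e y x) := rfl

/-- The operator `T` applied to the wires `e`. -/
def lift (e : V → W) (T : QState V →ₗ[ℂ] QState V) : QState W →ₗ[ℂ] QState W where
  toFun ψ := fun x => T (slice e x ψ) (x ∘ e)
  map_add' ψ φ := by
    funext x
    simp
  map_smul' c ψ := by
    funext x
    simp

theorem lift_apply (e : V → W) (T : QState V →ₗ[ℂ] QState V) (ψ : QState W) (x : Bits W) :
    lift e T ψ x = T (slice e x ψ) (x ∘ e) := rfl

variable {e : V → W}

theorem extend_comp_self (he : Function.Injective e) (y : Bits V) (x : Bits W) :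
    Function.extend e y x ∘ e = y := by
  funext v
  simp [he.extend_apply]

theorem extend_self (he : Function.Injective e) (x : Bits W) :
    Function.extend e (x ∘ e) x = x := by
  funext w
  by_cases h : ∃ v, e v = w
  · obtain ⟨v, rfl⟩ := h
    simp [he.extend_apply]
  · rw [Function.extend_apply' _ _ _ h]

theorem extend_extend (he : Function.Injective e) (y z : Bits V) (x : Bits W) :
    Function.extend e y (Function.extend e z x) = Function.extend e y x := by
  funext w
  by_cases h : ∃ v, e v = w
  · obtain ⟨v, rfl⟩ := h
    simp [he.extend_apply]
  · rw [Function.extend_apply' _ _ _ h, Function.extend_apply' _ _ _ h,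
      Function.extend_apply' _ _ _ h]

theorem extend_congr (he : Function.Injective e) (y : Bits V) {x x' : Bits W}
    (h : ∀ w, (¬ ∃ v, e v = w) → x w = x' w) : Function.extend e y x = Function.extend e y x' := by
  funext w
  by_cases hw : ∃ v, e v = w
  · obtain ⟨v, rfl⟩ := hw
    simp [he.extend_apply]
  · rw [Function.extend_apply' _ _ _ hw, Function.extend_apply' _ _ _ hw, h w hw]

/-- Overwriting the same wires twice is overwriting them once, so the slice seen by the operator
does not depend on the values it replaces. Most facts about `lift` reduce to facts about the
operator itself in this way. -/
theorem slice_lift (he : Function.Injective e) (T : QState V →ₗ[ℂ] QState V) (x : Bits W)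
    (ψ : QState W) : slice e x (lift e T ψ) = T (slice e x ψ) := by
  funext y
  have h : slice e (Function.extend e y x) ψ = slice e x ψ := by
    funext z
    rw [slice_apply, slice_apply, extend_extend he]
  rw [slice_apply, lift_apply, extend_comp_self he, h]

theorem lift_comp (he : Function.Injective e) (T T' : QState V →ₗ[ℂ] QState V) (ψ : QState W) :
    lift e (T ∘ₗ T') ψ = lift e T (lift e T' ψ) := by
  funext x
  rw [lift_apply, lift_apply, slice_lift he]
  rfl

theorem lift_id (he : Function.Injective e) (ψ : QState W) :
    lift e LinearMap.id ψ = ψ := by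
  funext x
  rw [lift_apply, LinearMap.id_apply, slice_apply, extend_self he]

theorem extend_comp_extend {d : U → V} (hd : Function.Injective d) (he : Function.Injective e)
    (y : Bits U) (x : Bits W) :
    Function.extend e (Function.extend d y (x ∘ e)) x = Function.extend (e ∘ d) y x := by
  funext w
  by_cases h : ∃ v, e v = w
  · obtain ⟨v, rfl⟩ := h
    rw [he.extend_apply]
    by_cases h' : ∃ u, d u = v
    · obtain ⟨u, rfl⟩ := h'
      rw [hd.extend_apply]
      exact ((he.comp hd).extend_apply y x u).symm
    · rw [Function.extend_apply' _ _ _ h', Function.extend_apply']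
      · rfl
      · rintro ⟨u, hu⟩
        exact h' ⟨u, he hu⟩
  · rw [Function.extend_apply' _ _ _ h, Function.extend_apply']
    rintro ⟨u, hu⟩
    exact h ⟨d u, hu⟩

theorem lift_lift {d : U → V} (hd : Function.Injective d) (he : Function.Injective e)
    (T : QState U →ₗ[ℂ] QState U) (ψ : QState W) :
    lift e (lift d T) ψ = lift (e ∘ d) T ψ := by
  funext x
  have h : slice d (x ∘ e) (slice e x ψ) = slice (e ∘ d) x ψ := by
    funext y
    rw [slice_apply, slice_apply, slice_apply, extend_comp_extend hd he]
  rw [lift_apply, lift_apply, lift_apply, h]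
  rfl

theorem extend_extend_comm {d : U → W} (hde : ∀ u v, d u ≠ e v) (hd : Function.Injective d)
    (he : Function.Injective e) (y : Bits V) (z : Bits U) (x : Bits W) :
    Function.extend e y (Function.extend d z x) = Function.extend d z (Function.extend e y x) := by
  funext w
  by_cases h : ∃ v, e v = w
  · obtain ⟨v, rfl⟩ := h
    rw [he.extend_apply, Function.extend_apply', he.extend_apply]
    rintro ⟨u, hu⟩
    exact hde u v hu
  · rw [Function.extend_apply' _ _ _ h]
    by_cases h' : ∃ u, d u = w
    · obtain ⟨u, rfl⟩ := h'
      rw [hd.extend_apply, hd.extend_apply]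
    · rw [Function.extend_apply' _ _ _ h', Function.extend_apply' _ _ _ h',
        Function.extend_apply' _ _ _ h]

theorem extend_comp_of_disjoint {d : U → W} (hde : ∀ u v, d u ≠ e v)
    (y : Bits V) (x : Bits W) : Function.extend e y x ∘ d = x ∘ d := by
  funext u
  exact Function.extend_apply' _ _ _ fun ⟨v, hv⟩ => hde u v hv.symm

theorem apply_eq_sum [Fintype V] [DecidableEq V] (T : QState V →ₗ[ℂ] QState V) (ψ : QState V)
    (y : Bits V) : T ψ y = ∑ z, ψ z * T (Pi.single z 1) y := by
  conv_lhs => rw [pi_eq_sum_univ' ψ, map_sum]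
  simp only [map_smul, Finset.sum_apply, Pi.smul_apply, smul_eq_mul]

/-- Expanding both operators in matrix entries gives the same double sum on either side, because
writes to disjoint sets of wires commute. -/
theorem lift_comm [Fintype U] [DecidableEq U] [Fintype V] [DecidableEq V] {d : U → W}
    (hde : ∀ u v, d u ≠ e v) (hd : Function.Injective d)
    (he : Function.Injective e) (T : QState V →ₗ[ℂ] QState V) (R : QState U →ₗ[ℂ] QState U)
    (ψ : QState W) : lift e T (lift d R ψ) = lift d R (lift e T ψ) := by
  funext x
  simp only [lift_apply]
  rw [apply_eq_sum T, apply_eq_sum R]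
  simp only [slice_apply, lift_apply]
  simp_rw [apply_eq_sum T (slice e _ ψ), apply_eq_sum R (slice d _ ψ), slice_apply]
  simp only [extend_comp_of_disjoint hde, extend_comp_of_disjoint fun v u => (hde u v).symm,
    Finset.sum_mul]
  rw [Finset.sum_comm]
  refine Finset.sum_congr rfl fun z _ => Finset.sum_congr rfl fun y _ => ?_
  rw [extend_extend_comm hde hd he]
  ring

theorem extend_update [DecidableEq V] [DecidableEq W] (he : Function.Injective e) (x : Bits W)
    (t : V) (b : ZMod 2) :
    Function.extend e (Function.update (x ∘ e) t b) x = Function.update x (e t) b := by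
  funext w
  by_cases h : ∃ v, e v = w
  · obtain ⟨v, rfl⟩ := h
    rw [he.extend_apply]
    by_cases hv : v = t
    · subst hv; simp
    · rw [Function.update_of_ne hv, Function.update_of_ne (he.ne hv)]; rfl
  · rw [Function.extend_apply' _ _ _ h, Function.update_of_ne]
    rintro rfl
    exact h ⟨t, rfl⟩

/-- A gate moved to other wires. -/
def Gate.map (e : V → W) (he : Function.Injective e) : Gate V → Gate W
  | .not t => .not (e t)
  | .hadamard t => .hadamard (e t)
  | .phase t => .phase (e t)
  | .cnot c t h => .cnot (e c) (e t) (he.ne h)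
  | .toffoli c₁ c₂ t h₁ h₂ => .toffoli (e c₁) (e c₂) (e t) (he.ne h₁) (he.ne h₂)

theorem Gate.apply_map [DecidableEq V] [DecidableEq W] (he : Function.Injective e) (g : Gate V)
    (ψ : QState W) : (g.map e he).apply ψ = lift e g.lin ψ := by
  funext x
  cases g <;>
    simp [Gate.map, Gate.apply, lift_apply, Gate.lin, slice_apply, extend_update he, extend_self he]

/-- A circuit moved to other wires. -/
def Circuit.map (e : V → W) (he : Function.Injective e) (C : Circuit V) : Circuit W :=
  List.map (Gate.map e he) C

theorem Circuit.run_map [DecidableEq V] [DecidableEq W] (he : Function.Injective e)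
    (C : Circuit V) (ψ : QState W) : Circuit.run (Circuit.map e he C) ψ = lift e (Circuit.lin C) ψ := by
  induction C generalizing ψ with
  | nil => exact (lift_id he ψ).symm
  | cons g C ih =>
    change Circuit.run (Circuit.map e he C) ((g.map e he).apply ψ) = _
    rw [ih, Gate.apply_map, Circuit.lin, lift_comp he]

theorem Circuit.length_map (he : Function.Injective e) (C : Circuit V) :
    (Circuit.map e he C).length = C.length := by
  simp [Circuit.map]

variable [Fintype V] [DecidableEq V] [Fintype W] [DecidableEq W]

/-- Exchanging the values on the wires `e` with the separate string y is an involution on pairs (x,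
y). A slice ignores the values of x on `e`, hence every amplitude is counted 2^|V| times. -/
theorem sum_extend {M : Type} [AddCommMonoid M] (he : Function.Injective e) (F : Bits W → M) :
    ∑ x : Bits W, ∑ y : Bits V, F (Function.extend e y x) = 2 ^ Fintype.card V • ∑ x, F x := by
  rw [← Fintype.sum_prod_type' (f := fun x y => F (Function.extend e y x))]
  have : ∑ q : Bits W × Bits V, F (Function.extend e q.2 q.1) = ∑ q : Bits W × Bits V, F q.1 := by
    refine Fintype.sum_equiv (Function.Involutive.toPerm
      (fun q : Bits W × Bits V => (Function.extend e q.2 q.1, q.1 ∘ e)) ?_) _ _ fun q => rfl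
    rintro ⟨x, y⟩
    simp only [Prod.mk.injEq]
    exact ⟨by rw [extend_extend he, extend_self he], extend_comp_self he _ _⟩
  rw [this, Fintype.sum_prod_type]
  simp [Finset.smul_sum, ZMod.card]

theorem herm_slice (he : Function.Injective e) (ψ φ : QState W) :
    ∑ x : Bits W, herm (slice e x ψ) (slice e x φ) = 2 ^ Fintype.card V * herm ψ φ := by
  simp only [herm, slice_apply]
  rw [sum_extend he (fun x => (starRingEnd ℂ) (ψ x) * φ x), nsmul_eq_mul]
  simp

theorem normSq_slice (he : Function.Injective e) (ψ : QState W) :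
    ∑ x : Bits W, normSq (slice e x ψ) = 2 ^ Fintype.card V * normSq ψ := by
  simp only [normSq, slice_apply]
  rw [sum_extend he (fun x => ‖ψ x‖ ^ 2), nsmul_eq_mul]
  simp

theorem herm_lift_left (he : Function.Injective e) {T R : QState V →ₗ[ℂ] QState V}
    (h : ∀ ψ φ, herm (T ψ) φ = herm ψ (R φ)) (ψ φ : QState W) :
    herm (lift e T ψ) φ = herm ψ (lift e R φ) := by
  have h0 : (2 : ℂ) ^ Fintype.card V ≠ 0 := pow_ne_zero _ two_ne_zero
  apply mul_left_cancel₀ h0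
  rw [← herm_slice he, ← herm_slice he]
  simp only [slice_lift he, h]

/-- The multiplicity with which slices count amplitudes is the same on both sides. This turns a
success probability known on the wires of a stage into a factor for the global state. -/
theorem normSq_lift_of_slices (he : Function.Injective e) {ψ φ : QState W} (κ : ℝ)
    (h : ∀ x, normSq (slice e x φ) = κ * normSq (slice e x ψ)) :
    normSq φ = κ * normSq ψ := by
  have h0 : (2 : ℝ) ^ Fintype.card V ≠ 0 := pow_ne_zero _ two_ne_zero
  apply mul_left_cancel₀ h0
  rw [← normSq_slice he]
  simp only [h]
  rw [← Finset.mul_sum, normSq_slice he]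
  ring

theorem normSq_lift_le (he : Function.Injective e) {T : QState V →ₗ[ℂ] QState V}
    (h : ∀ ψ, normSq (T ψ) ≤ normSq ψ) (ψ : QState W) : normSq (lift e T ψ) ≤ normSq ψ := by
  have h0 : (0 : ℝ) < 2 ^ Fintype.card V := pow_pos two_pos _
  apply le_of_mul_le_mul_left _ h0
  rw [← normSq_slice he, ← normSq_slice he]
  refine Finset.sum_le_sum fun x _ => ?_
  rw [slice_lift he]
  exact h _

end Lift

/-! ### Straight-line programs and reversible computation -/

section StraightLine

variable {I J : Type}

/-- `SLP L` says that each function in the list `L` is the constant one, an input, or the sum or the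
product of two functions that come later in the list. -/
inductive SLP : List (Bits I → ZMod 2) → Prop
  | nil : SLP []
  | one {L} : SLP L → SLP ((fun _ => 1) :: L)
  | var {L} (i : I) : SLP L → SLP ((fun x => x i) :: L)
  | add {L} (f g : Bits I → ZMod 2) : SLP L → f ∈ L → g ∈ L → SLP ((fun x => f x + g x) :: L)
  | mul {L} (f g : Bits I → ZMod 2) : SLP L → f ∈ L → g ∈ L → SLP ((fun x => f x * g x) :: L)

theorem SLP.append {L L' : List (Bits I → ZMod 2)} (h : SLP L) (h' : SLP L') : SLP (L ++ L') := by
  induction h with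
  | nil => exact h'
  | one _ ih => exact ih.one
  | var i _ ih => exact ih.var i
  | add f g _ hf hg ih =>
    exact ih.add f g (List.mem_append_left _ hf) (List.mem_append_left _ hg)
  | mul f g _ hf hg ih =>
    exact ih.mul f g (List.mem_append_left _ hf) (List.mem_append_left _ hg)

theorem SLP.comp {L : List (Bits I → ZMod 2)} (h : SLP L) (r : I → J) :
    SLP (L.map fun f x => f (x ∘ r)) := by
  induction h with
  | nil => exact .nil
  | one _ ih => exact ih.one
  | var i _ ih => exact ih.var (r i)
  | add f g _ hf hg ih =>
    exact ih.add (fun x => f (x ∘ r)) (fun x => g (x ∘ r))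
      (List.mem_map_of_mem hf) (List.mem_map_of_mem hg)
  | mul f g _ hf hg ih =>
    exact ih.mul (fun x => f (x ∘ r)) (fun x => g (x ∘ r))
      (List.mem_map_of_mem hf) (List.mem_map_of_mem hg)

/-- The function `f` is computed by a straight-line program of length at most `c`. -/
def Computable (c : ℕ) (f : Bits I → ZMod 2) : Prop :=
  ∃ L, SLP L ∧ L.length ≤ c ∧ f ∈ L

theorem Computable.mono {c c' : ℕ} {f : Bits I → ZMod 2} (h : Computable c f) (hc : c ≤ c') :
    Computable c' f := by
  obtain ⟨L, hL, hl, hf⟩ := h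
  exact ⟨L, hL, hl.trans hc, hf⟩

theorem Computable.comp {c : ℕ} {f : Bits I → ZMod 2} (h : Computable c f) (r : I → J) :
    Computable c (fun x => f (x ∘ r)) := by
  obtain ⟨L, hL, hl, hf⟩ := h
  exact ⟨_, hL.comp r, by simpa using hl, List.mem_map_of_mem (f := fun f x => f (x ∘ r)) hf⟩

theorem Computable.one : Computable 1 (fun _ : Bits I => 1) :=
  ⟨_, SLP.nil.one, le_rfl, by simp⟩

theorem Computable.var (i : I) : Computable 1 (fun x : Bits I => x i) :=
  ⟨_, SLP.nil.var i, le_rfl, by simp⟩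

theorem Computable.add {c c' : ℕ} {f g : Bits I → ZMod 2} (hf : Computable c f)
    (hg : Computable c' g) : Computable (c + c' + 1) (fun x => f x + g x) := by
  obtain ⟨L, hL, hl, hf⟩ := hf
  obtain ⟨L', hL', hl', hg⟩ := hg
  exact ⟨_, (hL.append hL').add f g (List.mem_append_left _ hf) (List.mem_append_right _ hg),
    by simp; omega, by simp⟩

theorem Computable.mul {c c' : ℕ} {f g : Bits I → ZMod 2} (hf : Computable c f)
    (hg : Computable c' g) : Computable (c + c' + 1) (fun x => f x * g x) := by
  obtain ⟨L, hL, hl, hf⟩ := hf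
  obtain ⟨L', hL', hl', hg⟩ := hg
  exact ⟨_, (hL.append hL').mul f g (List.mem_append_left _ hf) (List.mem_append_right _ hg),
    by simp; omega, by simp⟩

theorem Computable.not {c : ℕ} {f : Bits I → ZMod 2} (hf : Computable c f) :
    Computable (c + 2) (fun x => f x + 1) :=
  (hf.add .one).mono (by omega)

/-- The test whether all the inputs in a list are zero. -/
theorem Computable.allZero (l : List I) :
    Computable (4 * l.length + 1) (fun x : Bits I => (l.map fun i => x i + 1).prod) := by
  induction l with
  | nil => simpa using Computable.one.mono (by omega)
  | cons i l ih =>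
    simp only [List.map_cons, List.prod_cons]
    exact ((Computable.var i).not.mul ih).mono (by simp; omega)

end StraightLine

/-! ### Reversible circuits for straight-line programs. -/

section Reversible

variable {W : Type} [DecidableEq W]

/-- The gates that permute the basis states. -/
def Gate.IsClassical : Gate W → Prop
  | .hadamard _ => False
  | .phase _ => False
  | _ => True

/-- The action of a classical gate on the basis states. -/
def Gate.move : Gate W → Bits W → Bits W
  | .not t, x => Function.update x t (x t + 1)
  | .hadamard _, x => x
  | .phase _, x => x
  | .cnot c t _, x => Function.update x t (x t + x c)
  | .toffoli c₁ c₂ t _ _, x => Function.update x t (x t + x c₁ * x c₂)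

theorem Gate.move_move (g : Gate W) (x : Bits W) : g.move (g.move x) = x := by
  cases g with
  | not t => simp [Gate.move, add_assoc, zmod_two_add_self]
  | hadamard t => rfl
  | phase t => rfl
  | cnot c t h => simp [Gate.move, add_assoc, zmod_two_add_self, h]
  | toffoli c₁ c₂ t h₁ h₂ => simp [Gate.move, add_assoc, zmod_two_add_self, h₁, h₂]

theorem Gate.apply_eq_move {g : Gate W} (hg : g.IsClassical) (ψ : QState W) (x : Bits W) :
    g.apply ψ x = ψ (g.move x) := by
  cases g <;> first | rfl | exact hg.elim

/-- The action of a list of classical gates on the basis states. -/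
def moveList (G : Circuit W) (x : Bits W) : Bits W := G.foldl (fun y g => g.move y) x

theorem moveList_append (G G' : Circuit W) (x : Bits W) :
    moveList (G ++ G') x = moveList G' (moveList G x) := by
  simp [moveList, List.foldl_append]

theorem moveList_reverse (G : Circuit W) (x : Bits W) :
    moveList G.reverse (moveList G x) = x := by
  induction G generalizing x with
  | nil => rfl
  | cons g G ih =>
    rw [List.reverse_cons, moveList_append]
    change g.move (moveList G.reverse (moveList G (g.move x))) = x
    rw [ih, Gate.move_move]

theorem run_eq_moveList (G : Circuit W) (hG : ∀ g ∈ G, g.IsClassical) (ψ : QState W) (x : Bits W) :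
    Circuit.run G ψ x = ψ (moveList G.reverse x) := by
  induction G generalizing ψ with
  | nil => rfl
  | cons g G ih =>
    rw [Circuit.run_cons, ih (fun g' h => hG g' (List.mem_cons_of_mem _ h)),
      Gate.apply_eq_move (hG g List.mem_cons_self), List.reverse_cons, moveList_append]
    rfl

/-- A straight-line program is carried out by a reversible circuit that writes each intermediate
result to a wire of its own. -/
theorem SLP.exists_circuit {I : Type} {L : List (Bits I → ZMod 2)} (hL : SLP L) (inp : I → W)
    (as : List W) (hnd : as.Nodup) (hlen : as.length = L.length) (hdisj : ∀ i, inp i ∉ as) :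
    ∃ G : Circuit W, (∀ g ∈ G, g.IsClassical) ∧ G.length ≤ 2 * L.length ∧
      ∀ x : Bits W, (∀ a ∈ as, x a = 0) →
        (∀ w, w ∉ as → moveList G x w = x w) ∧
        ∀ q ∈ L.zip as, moveList G x q.2 = q.1 (x ∘ inp) := by
  -- The part of the induction common to all four rules: the circuit for the tail is followed by at
  -- most two gates that write the new value to the fresh wire `a`.
  have step : ∀ (f : Bits I → ZMod 2) (L : List (Bits I → ZMod 2)) (a : W) (as : List W),
      (a :: as).Nodup → (∀ i, inp i ∉ a :: as) →
      (∃ G : Circuit W, (∀ g ∈ G, g.IsClassical) ∧ G.length ≤ 2 * L.length ∧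
      ∀ x : Bits W, (∀ b ∈ as, x b = 0) →
        (∀ w, w ∉ as → moveList G x w = x w) ∧
        ∀ q ∈ L.zip as, moveList G x q.2 = q.1 (x ∘ inp)) →
      (∃ G' : Circuit W, (∀ g ∈ G', g.IsClassical) ∧ G'.length ≤ 2 ∧
        ∀ y : Bits W, ∀ z : Bits I, y a = 0 → (∀ i, y (inp i) = z i) →
        (∀ q ∈ L.zip as, y q.2 = q.1 z) → moveList G' y = Function.update y a (f z)) →
      ∃ G : Circuit W, (∀ g ∈ G, g.IsClassical) ∧ G.length ≤ 2 * (f :: L).length ∧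
      ∀ x : Bits W, (∀ b ∈ a :: as, x b = 0) →
        (∀ w, w ∉ a :: as → moveList G x w = x w) ∧
        ∀ q ∈ (f :: L).zip (a :: as), moveList G x q.2 = q.1 (x ∘ inp) := by
    rintro f L a as hnd hdisj ⟨G, hG, hGl, hGx⟩ ⟨G', hG', hGl', hGx'⟩
    refine ⟨G ++ G', ?_, ?_, ?_⟩
    · intro g hg
      rcases List.mem_append.1 hg with h | h
      exacts [hG g h, hG' g h]
    · simp only [List.length_append, List.length_cons]
      omega
    · intro x hx
      obtain ⟨h1, h2⟩ := hGx x fun b hb => hx b (List.mem_cons_of_mem _ hb)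
      have ha : a ∉ as := (List.nodup_cons.1 hnd).1
      have hy := hGx' (moveList G x) (x ∘ inp)
        (by rw [h1 a ha]; exact hx a List.mem_cons_self)
        (fun i => h1 _ fun h => hdisj i (List.mem_cons_of_mem _ h)) h2
      rw [moveList_append, hy]
      refine ⟨fun w hw => ?_, ?_⟩
      · rw [Function.update_of_ne (List.ne_of_not_mem_cons hw)]
        exact h1 w (List.not_mem_of_not_mem_cons hw)
      · intro q hq
        rw [List.zip_cons_cons, List.mem_cons] at hq
        rcases hq with rfl | hq
        · simp
        · rw [Function.update_of_ne]
          · exact h2 q hq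
          · rintro rfl
            exact ha (List.of_mem_zip hq).2
  -- Every function of the tail is available on some wire and can serve as a control.
  have wire : ∀ (L : List (Bits I → ZMod 2)) (as : List W) (f : Bits I → ZMod 2),
      as.length = L.length → f ∈ L → ∃ b, (f, b) ∈ L.zip as := by
    intro L as f hlen hf
    obtain ⟨n, hn, rfl⟩ := List.getElem_of_mem hf
    refine ⟨as[n], ?_⟩
    rw [List.mem_iff_getElem]
    exact ⟨n, by simp [hlen, hn], by simp⟩
  induction hL generalizing as with
  | nil => exact ⟨[], by simp, by simp, fun x _ => ⟨fun _ _ => rfl, by simp⟩⟩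
  | @one L hL ih =>
    obtain _ | ⟨a, as⟩ := as
    · simp at hlen
    refine step _ _ _ _ hnd hdisj (ih as (List.nodup_cons.1 hnd).2 (by simpa using hlen)
      fun i h => hdisj i (List.mem_cons_of_mem _ h)) ⟨[.not a], by simp [Gate.IsClassical],
        by simp, fun y z hy _ _ => ?_⟩
    simp [moveList, Gate.move, hy]
  | @var L i hL ih =>
    obtain _ | ⟨a, as⟩ := as
    · simp at hlen
    have hi : inp i ≠ a := fun h => hdisj i (by simp [h])
    refine step _ _ _ _ hnd hdisj (ih as (List.nodup_cons.1 hnd).2 (by simpa using hlen)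
      fun i h => hdisj i (List.mem_cons_of_mem _ h)) ⟨[.cnot (inp i) a hi],
        by simp [Gate.IsClassical], by simp, fun y z hy hz _ => ?_⟩
    simp [moveList, Gate.move, hy, hz]
  | @add L f g hL hf hg ih =>
    obtain _ | ⟨a, as⟩ := as
    · simp at hlen
    have hlen' : as.length = L.length := by simpa using hlen
    obtain ⟨b, hb⟩ := wire L as f hlen' hf
    obtain ⟨c, hc⟩ := wire L as g hlen' hg
    have ha : a ∉ as := (List.nodup_cons.1 hnd).1
    have hba : b ≠ a := fun h => ha (h ▸ (List.of_mem_zip hb).2)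
    have hca : c ≠ a := fun h => ha (h ▸ (List.of_mem_zip hc).2)
    refine step _ _ _ _ hnd hdisj (ih as (List.nodup_cons.1 hnd).2 hlen'
      fun i h => hdisj i (List.mem_cons_of_mem _ h)) ⟨[.cnot b a hba, .cnot c a hca],
        by simp [Gate.IsClassical], by simp, fun y z hy _ hz => ?_⟩
    simp [moveList, Gate.move, hy, hz _ hb, hz _ hc, hca]
  | @mul L f g hL hf hg ih =>
    obtain _ | ⟨a, as⟩ := as
    · simp at hlen
    have hlen' : as.length = L.length := by simpa using hlen
    obtain ⟨b, hb⟩ := wire L as f hlen' hf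
    obtain ⟨c, hc⟩ := wire L as g hlen' hg
    have ha : a ∉ as := (List.nodup_cons.1 hnd).1
    have hba : b ≠ a := fun h => ha (h ▸ (List.of_mem_zip hb).2)
    have hca : c ≠ a := fun h => ha (h ▸ (List.of_mem_zip hc).2)
    refine step _ _ _ _ hnd hdisj (ih as (List.nodup_cons.1 hnd).2 hlen'
      fun i h => hdisj i (List.mem_cons_of_mem _ h)) ⟨[.toffoli b c a hba hca],
        by simp [Gate.IsClassical], by simp, fun y z hy _ hz => ?_⟩
    simp [moveList, Gate.move, hy, hz _ hb, hz _ hc]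

/-- Compute, copy, uncompute: a function with a short straight-line program is added to the target
wire `t` by a short circuit that leaves the work wires `as` at zero. -/
theorem Computable.exists_circuit {I : Type} {c : ℕ} {f : Bits I → ZMod 2} (hf : Computable c f)
    (inp : I → W) (as : List W) (hnd : as.Nodup) (hlen : c ≤ as.length)
    (hdisj : ∀ i, inp i ∉ as) (t : W) (ht : t ∉ as)
    (hit : ∀ i, inp i ≠ t) :
    ∃ G : Circuit W, G.length ≤ 4 * c + 1 ∧ ∀ (ψ : QState W) (x : Bits W),
      ((∀ a ∈ as, x a = 0) →
        Circuit.run G ψ x = ψ (Function.update x t (x t + f (x ∘ inp)))) ∧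
      ((∃ a ∈ as, x a ≠ 0) → ∃ y, (∃ a ∈ as, y a ≠ 0) ∧ Circuit.run G ψ x = ψ y) := by
  obtain ⟨L, hL, hl, hfL⟩ := hf
  obtain ⟨G, hG, hGl, hGx⟩ := hL.exists_circuit inp (as.take L.length)
    (hnd.sublist (List.take_sublist _ _)) (by simp; omega)
    (fun i h => hdisj i (List.mem_of_mem_take h))
  obtain ⟨b, hb⟩ : ∃ b, (f, b) ∈ L.zip (as.take L.length) := by
    obtain ⟨n, hn, rfl⟩ := List.getElem_of_mem hfL
    refine ⟨as[n]'(by omega), ?_⟩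
    rw [List.mem_iff_getElem]
    exact ⟨n, by simp; omega, by simp⟩
  have hb' : b ∈ as := List.mem_of_mem_take (List.of_mem_zip hb).2
  have hbt : b ≠ t := fun h => ht (h ▸ hb')
  have ht' : t ∉ as.take L.length := fun h => ht (List.mem_of_mem_take h)
  set K : Circuit W := G ++ [.cnot b t hbt] ++ G.reverse with hK
  have hKc : ∀ g ∈ K, g.IsClassical := by
    intro g hg
    simp only [hK, List.mem_append, List.mem_singleton, List.mem_reverse] at hg
    rcases hg with (h | rfl) | h
    exacts [hG g h, trivial, hG g h]
  -- The circuit is a palindrome of involutions, hence its own inverse.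
  have hKr : K.reverse = K := by simp [hK]
  have hinv : ∀ x, moveList K (moveList K x) = x := fun x => by
    have h := moveList_reverse K x
    rwa [hKr] at h
  have hmove : ∀ x : Bits W, (∀ a ∈ as, x a = 0) →
      moveList K x = Function.update x t (x t + f (x ∘ inp)) := by
    intro x hx
    have hx0 : ∀ a ∈ as.take L.length, x a = 0 := fun a h => hx a (List.mem_of_mem_take h)
    set x' := Function.update x t (x t + f (x ∘ inp)) with hx'
    have hx0' : ∀ a ∈ as.take L.length, x' a = 0 := fun a h => by
      rw [hx', Function.update_of_ne (ne_of_mem_of_not_mem h ht')]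
      exact hx0 a h
    have hxi : x' ∘ inp = x ∘ inp := by
      funext i
      exact Function.update_of_ne (hit i) _ _
    obtain ⟨h1, h2⟩ := hGx x hx0
    obtain ⟨h1', h2'⟩ := hGx x' hx0'
    -- The target is neither an input nor a used work wire, so copying the result after the
    -- computation agrees with computing from the string whose target is already changed.
    -- Uncomputing then returns that string.
    have key : (Gate.cnot b t hbt).move (moveList G x) = moveList G x' := by
      funext w
      by_cases hw : w = t
      · subst hw
        rw [h1' _ ht', hx']
        simp [Gate.move, h1 _ ht', h2 _ hb]
      · simp only [Gate.move, Function.update_of_ne hw]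
        by_cases hwa : w ∈ as.take L.length
        · obtain ⟨g, hg⟩ : ∃ g, (g, w) ∈ L.zip (as.take L.length) := by
            obtain ⟨n, hn, rfl⟩ := List.getElem_of_mem hwa
            have hn' : n < L.length := by simp at hn; omega
            refine ⟨L[n], ?_⟩
            rw [List.mem_iff_getElem]
            exact ⟨n, by simp; simp at hn; omega, by simp⟩
          exact (h2 _ hg).trans ((h2' _ hg).trans (congrArg g hxi)).symm
        · rw [h1 w hwa, h1' w hwa, hx', Function.update_of_ne hw]
    rw [hK, moveList_append, moveList_append]
    change moveList G.reverse ((Gate.cnot b t hbt).move (moveList G x)) = x'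
    rw [key, moveList_reverse]
  refine ⟨K, by simp [hK]; omega, fun ψ x => ⟨fun hx => ?_, fun hx => ?_⟩⟩
  · rw [run_eq_moveList K hKc, hKr, hmove x hx]
  · refine ⟨moveList K x, ?_, by rw [run_eq_moveList K hKc, hKr]⟩
    -- An involution that preserves the strings with zero work wires also preserves the remaining
    -- strings. No control over their exact images is needed, because `embed` has amplitude zero
    -- there.
    by_contra! h
    obtain ⟨a, ha, hxa⟩ := hx
    have h3 := hmove _ h
    rw [hinv] at h3
    apply hxa
    rw [h3, Function.update_of_ne (ne_of_mem_of_not_mem ha ht)]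
    exact h a ha

end Reversible

/-! ### Operators implemented by circuits that read a serial number -/

section Implements

variable {S V W : Type}

open Classical in
/-- The state `|s⟩ |ψ⟩ |0⟩`. -/
def embed {p : ℕ} (s : Bits S) (ψ : QState W) : QState (S ⊕ W ⊕ Fin p) := fun x =>
  if (∀ i, x (.inl i) = s i) ∧ (∀ l, x (.inr (.inr l)) = 0)
  then ψ (fun w => x (.inr (.inl w))) else 0

theorem embed_eq_embed {p p' : ℕ} {s : Bits S} {ψ : QState V} {φ : QState W}
    {x : Bits (S ⊕ V ⊕ Fin p)} {y : Bits (S ⊕ W ⊕ Fin p')}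
    (hs : (∀ i, x (.inl i) = s i) ↔ ∀ i, y (.inl i) = s i)
    (hp : (∀ l, x (.inr (.inr l)) = 0) ↔ ∀ l, y (.inr (.inr l)) = 0)
    (h : ψ (fun w => x (.inr (.inl w))) = φ (fun w => y (.inr (.inl w)))) :
    embed s ψ x = embed s φ y := by
  rw [embed, embed, h]
  by_cases h' : (∀ i, x (.inl i) = s i) ∧ (∀ l, x (.inr (.inr l)) = 0)
  · rw [if_pos h', if_pos ⟨hs.1 h'.1, hp.1 h'.2⟩]
  · rw [if_neg h', if_neg fun h'' => h' ⟨hs.2 h''.1, hp.2 h''.2⟩]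

/-- For all serial numbers `s` in `G`, the operator `T s` is carried out by one circuit with at most
`l` gates that uses the wires `S` as controls and `p` work wires that start and end at zero. -/
def Implements [DecidableEq S] [DecidableEq W] (G : Set (Bits S)) (p l : ℕ)
    (T : Bits S → QState W →ₗ[ℂ] QState W) : Prop :=
  ∃ C : Circuit (S ⊕ W ⊕ Fin p), C.length ≤ l ∧
    ∀ s ∈ G, ∀ ψ, Circuit.run C (embed s ψ) = embed s (T s ψ)

variable [DecidableEq S] [DecidableEq V] [DecidableEq W] {G : Set (Bits S)} {p p' l l' : ℕ}

theorem Implements.congr {T T' : Bits S → QState W →ₗ[ℂ] QState W} (h : Implements G p l T)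
    (hT : ∀ s ∈ G, ∀ ψ, T s ψ = T' s ψ) : Implements G p l T' := by
  obtain ⟨C, hl, hC⟩ := h
  exact ⟨C, hl, fun s hs ψ => by rw [hC s hs, hT s hs]⟩

theorem Implements.refl : Implements G p 0 (fun _ => (LinearMap.id : QState W →ₗ[ℂ] QState W)) :=
  ⟨[], le_rfl, fun _ _ _ => rfl⟩

theorem Implements.comp {T T' : Bits S → QState W →ₗ[ℂ] QState W} (h : Implements G p l T)
    (h' : Implements G p l' T') : Implements G p (l' + l) (fun s => T s ∘ₗ T' s) := by
  obtain ⟨C, hl, hC⟩ := h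
  obtain ⟨C', hl', hC'⟩ := h'
  refine ⟨C' ++ C, by simpa using Nat.add_le_add hl' hl, fun s hs ψ => ?_⟩
  rw [Circuit.run_append, hC' s hs, hC s hs]
  rfl

/-- The extra wires, both of the state and of the work space, are untouched by the moved circuit.
Where an extra work wire is nonzero, both sides vanish; elsewhere the slice is again of the form
`embed`. -/
theorem Implements.lift {T : Bits S → QState V →ₗ[ℂ] QState V} (h : Implements G p l T)
    {e : V → W} (he : Function.Injective e) (hp : p ≤ p') (hl : l ≤ l') :
    Implements G p' l' (fun s => HiddenSubspace.lift e (T s)) := by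
  obtain ⟨C, hCl, hC⟩ := h
  let e' : S ⊕ V ⊕ Fin p → S ⊕ W ⊕ Fin p' := Sum.map id (Sum.map e (Fin.castLE hp))
  have he' : Function.Injective e' :=
    Function.injective_id.sumMap (he.sumMap (Fin.castLE_injective hp))
  have ex0 : ∀ (y : Bits (S ⊕ V ⊕ Fin p)) (x : Bits (S ⊕ W ⊕ Fin p')) i, Function.extend e' y x (.inl i) = y (.inl i) := fun y x i =>
    he'.extend_apply y x (.inl i)
  have ex1 : ∀ (y : Bits (S ⊕ V ⊕ Fin p)) (x : Bits (S ⊕ W ⊕ Fin p')) w, Function.extend e' y x (.inr (.inl w)) =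
      Function.extend e (fun v => y (.inr (.inl v))) (fun w => x (.inr (.inl w))) w := by
    intro y x w
    by_cases hw : ∃ v, e v = w
    · obtain ⟨v, rfl⟩ := hw
      rw [he.extend_apply]
      exact he'.extend_apply y x (.inr (.inl v))
    · rw [Function.extend_apply' _ _ _ hw, Function.extend_apply']
      rintro ⟨a | a | a, ha⟩ <;> simp [e'] at ha
      exact hw ⟨a, ha⟩
  have ex2 : ∀ (y : Bits (S ⊕ V ⊕ Fin p)) (x : Bits (S ⊕ W ⊕ Fin p')) j, Function.extend e' y x (.inr (.inr (Fin.castLE hp j))) = y (.inr (.inr j)) :=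
    fun y x j => he'.extend_apply y x (.inr (.inr j))
  have ex3 : ∀ (y : Bits (S ⊕ V ⊕ Fin p)) (x : Bits (S ⊕ W ⊕ Fin p')) (j : Fin p'), p ≤ j → Function.extend e' y x (.inr (.inr j)) =
      x (.inr (.inr j)) := by
    intro y x j hj
    rw [Function.extend_apply']
    rintro ⟨a | a | a, ha⟩ <;> simp [e'] at ha
    subst ha
    simp at hj
    omega
  refine ⟨Circuit.map e' he' C, by rw [Circuit.length_map]; exact hCl.trans hl,
    fun s hs ψ => ?_⟩
  rw [Circuit.run_map]
  funext x
  rw [lift_apply]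
  by_cases hx : ∀ j : Fin p', p ≤ j → x (.inr (.inr j)) = 0
  · have hsl : slice e' x (embed s ψ) =
        embed s (slice e (fun w => x (.inr (.inl w))) ψ) := by
      funext y
      rw [slice_apply]
      have hiff : (∀ j : Fin p', Function.extend e' y x (.inr (.inr j)) = 0) ↔
          ∀ j, y (.inr (.inr j)) = 0 := by
        constructor
        · intro h j
          rw [← ex2 y x j]
          exact h _
        · intro h j
          by_cases hj : p ≤ j
          · rw [ex3 y x j hj]
            exact hx j hj
          · have : j = Fin.castLE hp ⟨j, by omega⟩ := rfl
            rw [this, ex2]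
            exact h _
      refine embed_eq_embed (by simp only [ex0]) hiff ?_
      simp only [ex1]
      rfl
    rw [hsl, Circuit.lin_apply, hC s hs]
    have hiff : (∀ j : Fin p, (x ∘ e') (.inr (.inr j)) = 0) ↔
        ∀ j : Fin p', x (.inr (.inr j)) = 0 := by
      constructor
      · intro h j
        by_cases hj : p ≤ j
        · exact hx j hj
        · exact h ⟨j, by omega⟩
      · intro h j
        exact h _
    exact embed_eq_embed Iff.rfl hiff rfl
  · have hsl : slice e' x (embed s ψ) = 0 := by
      push Not at hx
      obtain ⟨j, hj, hxj⟩ := hx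
      funext y
      rw [slice_apply, embed, if_neg]
      · rfl
      · rintro ⟨-, h⟩
        exact hxj (by rw [← ex3 y x j hj]; exact h j)
    rw [hsl, map_zero, embed, if_neg]
    · rfl
    · rintro ⟨-, h⟩
      exact hx fun j _ => h j

theorem lift_id_wires (T : QState W →ₗ[ℂ] QState W) (ψ : QState W) :
    HiddenSubspace.lift id T ψ = T ψ := by
  funext x
  have h : slice id x ψ = ψ := by
    funext y
    rw [slice_apply]
    congr 1
    funext w
    exact Function.injective_id.extend_apply y x w
  rw [lift_apply, h]
  rfl

theorem Implements.mono {T : Bits S → QState W →ₗ[ℂ] QState W} (h : Implements G p l T)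
    (hp : p ≤ p') (hl : l ≤ l') : Implements G p' l' T :=
  (h.lift Function.injective_id hp hl).congr fun s _ ψ => lift_id_wires (T s) ψ

theorem Implements.circuit (C : Circuit W) :
    Implements G p C.length (fun _ => Circuit.lin C) := by
  have he : Function.Injective (fun w : W => (.inr (.inl w) : S ⊕ W ⊕ Fin p)) :=
    Sum.inr_injective.comp Sum.inl_injective
  refine ⟨Circuit.map _ he C, by rw [Circuit.length_map], fun s _ ψ => ?_⟩
  rw [Circuit.run_map]
  funext x
  rw [lift_apply]
  have ex0 : ∀ y i, Function.extend (fun w : W => (.inr (.inl w) : S ⊕ W ⊕ Fin p)) y x (.inl i) =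
      x (.inl i) := fun y i => Function.extend_apply' _ _ _ (by simp)
  have ex1 : ∀ y w, Function.extend (fun w : W => (.inr (.inl w) : S ⊕ W ⊕ Fin p)) y x
      (.inr (.inl w)) = y w := fun y w => he.extend_apply y x w
  have ex2 : ∀ y j, Function.extend (fun w : W => (.inr (.inl w) : S ⊕ W ⊕ Fin p)) y x
      (.inr (.inr j)) = x (.inr (.inr j)) := fun y i => Function.extend_apply' _ _ _ (by simp)
  by_cases hx : (∀ i, x (.inl i) = s i) ∧ (∀ l, x (.inr (.inr l)) = 0)
  · have hsl : slice (fun w : W => (.inr (.inl w) : S ⊕ W ⊕ Fin p)) x (embed s ψ) = ψ := by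
      funext y
      rw [slice_apply, embed, if_pos (by simpa only [ex0, ex2] using hx)]
      congr 1
      funext w
      exact ex1 y w
    rw [hsl, embed, if_pos hx]
    rfl
  · have hsl : slice (fun w : W => (.inr (.inl w) : S ⊕ W ⊕ Fin p)) x (embed s ψ) = 0 := by
      funext y
      rw [slice_apply, embed, if_neg (by simpa only [ex0, ex2] using hx)]
      rfl
    rw [hsl, map_zero, embed, if_neg hx]
    rfl

/-- The operator that permutes the basis states by adding `f` to the wire `t`. -/
def xorOp (t : W) (f : Bits W → ZMod 2) : QState W →ₗ[ℂ] QState W :=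
  LinearMap.funLeft ℂ ℂ fun x => Function.update x t (x t + f x)

theorem xorOp_apply (t : W) (f : Bits W → ZMod 2) (ψ : QState W) (x : Bits W) :
    xorOp t f ψ x = ψ (Function.update x t (x t + f x)) := rfl

/-- Compute, copy, uncompute, with the serial number and the wires `e` as inputs. The program may
read only wires other than the target, which is the role of `ht`. -/
theorem Implements.xor {c : ℕ} {f : Bits S → Bits V → ZMod 2}
    (hf : Computable c (fun x : Bits (S ⊕ V) => f (x ∘ .inl) (x ∘ .inr)))
    (e : V → W) (t : W) (ht : ∀ v, e v ≠ t) (hp : c ≤ p) (hl : 4 * c + 1 ≤ l) :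
    Implements G p l (fun s => xorOp t fun x => f s (x ∘ e)) := by
  let inp : S ⊕ V → S ⊕ W ⊕ Fin p := Sum.map id (fun v => .inl (e v))
  let as : List (S ⊕ W ⊕ Fin p) := (List.finRange p).map fun j => .inr (.inr j)
  have hmem : ∀ a, a ∈ as ↔ ∃ j, a = .inr (.inr j) := by
    intro a
    simp [as, eq_comm]
  obtain ⟨C, hC, hrun⟩ := hf.exists_circuit inp as
    ((List.nodup_finRange p).map (Sum.inr_injective.comp Sum.inr_injective))
    (by simpa [as] using hp) (by rintro (i | i) <;> simp [hmem, inp]) (.inr (.inl t))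
    (by simp [hmem]) (by rintro (i | i) <;> simp [inp, ht])
  refine ⟨C, hC.trans hl, fun s _ ψ => ?_⟩
  funext x
  obtain ⟨h1, h2⟩ := hrun (embed s ψ) x
  by_cases hx : ∀ j, x (.inr (.inr j)) = 0
  · rw [h1 (by intro a ha; obtain ⟨j, rfl⟩ := (hmem a).1 ha; exact hx j)]
    by_cases hs : ∀ i, x (.inl i) = s i
    · have hfx : f ((x ∘ inp) ∘ .inl) ((x ∘ inp) ∘ .inr) =
          f s ((fun w => x (.inr (.inl w))) ∘ e) := by
        congr 1
        funext i
        exact hs i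
      rw [hfx, embed, embed, if_pos ⟨hs, hx⟩, if_pos ⟨by simpa using hs, by simpa using hx⟩,
        xorOp_apply]
      congr 1
      funext w
      by_cases hw : w = t
      · subst hw; simp
      · rw [Function.update_of_ne (by simpa using hw), Function.update_of_ne hw]
    · rw [embed, embed, if_neg fun h => hs h.1, if_neg]
      rintro ⟨h, -⟩
      exact hs (by simpa using h)
  -- With a nonzero work wire the amplitude comes from a string that also has a nonzero work wire,
  -- so both sides are zero.
  · obtain ⟨y, ⟨a, ha, hya⟩, hy⟩ := h2 (by
      push Not at hx
      obtain ⟨j, hj⟩ := hx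
      exact ⟨_, (hmem _).2 ⟨j, rfl⟩, hj⟩)
    obtain ⟨j, rfl⟩ := (hmem a).1 ha
    rw [hy, embed, embed, if_neg fun h => hya (h.2 j), if_neg fun h => hx h.2]

/-! ### Work wires -/

/-- The state that is `ψ₀` or `ψ₁`, depending on an additional bit. -/
def comb (ψ₀ ψ₁ : QState W) : QState (W ⊕ Unit) := fun x =>
  if x (.inr ()) = 0 then ψ₀ (x ∘ .inl) else ψ₁ (x ∘ .inl)

/-- A bit that starts and ends at zero, which is what `comb _ 0` expresses, can be declared a work
wire. Intermediate results are discarded in this way. -/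
theorem Implements.hide {T' : Bits S → QState (W ⊕ Unit) →ₗ[ℂ] QState (W ⊕ Unit)}
    {T : Bits S → QState W →ₗ[ℂ] QState W} (h : Implements G p l T')
    (hT : ∀ s ∈ G, ∀ ψ, T' s (comb ψ 0) = comb (T s ψ) 0) : Implements G (p + 1) l T := by
  obtain ⟨C, hCl, hC⟩ := h
  let e : S ⊕ (W ⊕ Unit) ⊕ Fin p → S ⊕ W ⊕ Fin (p + 1) :=
    Sum.elim .inl (Sum.elim (Sum.elim (fun w => .inr (.inl w)) fun _ => .inr (.inr (Fin.last p)))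
      fun j => .inr (.inr j.castSucc))
  have he : Function.Injective e := by
    rintro (a | (a | a) | a) (b | (b | b) | b) h <;> simp [e] at h ⊢
    · exact h
    · exact h
    · exact (Fin.castSucc_lt_last _).ne h.symm
    · exact h
  refine ⟨Circuit.map e he C, by rw [Circuit.length_map]; exact hCl, fun s hs ψ => ?_⟩
  rw [Circuit.run_map]
  funext x
  rw [lift_apply]
  have hkey : ∀ (φ : QState W) (z : Bits (S ⊕ W ⊕ Fin (p + 1))),
      embed s φ z = embed s (comb φ 0) (z ∘ e) := by
    intro φ z
    have hz : (∀ j : Fin (p + 1), z (.inr (.inr j)) = 0) ↔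
        z (.inr (.inr (Fin.last p))) = 0 ∧ ∀ j : Fin p, z (.inr (.inr j.castSucc)) = 0 := by
      constructor
      · exact fun h => ⟨h _, fun j => h _⟩
      · rintro ⟨h1, h2⟩ j
        refine Fin.lastCases h1 h2 j
    have hc : comb φ 0 (fun w => (z ∘ e) (.inr (.inl w))) =
        if z (.inr (.inr (Fin.last p))) = 0 then φ (fun w => z (.inr (.inl w))) else 0 := rfl
    by_cases h1 : z (.inr (.inr (Fin.last p))) = 0
    · refine embed_eq_embed Iff.rfl (hz.trans (and_iff_right h1)) ?_
      rw [hc, if_pos h1]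
    · rw [embed, embed, hc, if_neg fun h => h1 (h.2 _), if_neg h1, ite_self]
  have hsl : slice e x (embed s ψ) = embed s (comb ψ 0) := by
    funext y
    rw [slice_apply, hkey, extend_comp_self he]
  rw [hsl, Circuit.lin_apply, hC s hs, hT s hs, ← hkey]

theorem comb_surj (ψ : QState (W ⊕ Unit)) : ∃ ψ₀ ψ₁, ψ = comb ψ₀ ψ₁ := by
  refine ⟨fun y => ψ (Sum.elim y fun _ => 0), fun y => ψ (Sum.elim y fun _ => 1), ?_⟩
  funext x
  have hx : ∀ b, x (.inr ()) = b → x = Sum.elim (x ∘ .inl) fun _ => b := by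
    rintro b rfl
    funext w
    rcases w with w | w <;> rfl
  rw [comb]
  split_ifs with h
  · exact congrArg ψ (hx 0 h)
  · exact congrArg ψ (hx 1 (zmod_two_ne_zero.1 h))

theorem slice_inl_comb (ψ₀ ψ₁ : QState W) (x : Bits (W ⊕ Unit)) :
    slice .inl x (comb ψ₀ ψ₁) = if x (.inr ()) = 0 then ψ₀ else ψ₁ := by
  funext y
  have h0 : Function.extend (Sum.inl : W → W ⊕ Unit) y x (.inr ()) = x (.inr ()) :=
    Function.extend_apply' _ _ _ (by simp)
  have h1 : Function.extend (Sum.inl : W → W ⊕ Unit) y x ∘ .inl = y :=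
    extend_comp_self Sum.inl_injective y x
  rw [slice_apply, comb, h0, h1]
  split_ifs <;> rfl

theorem lift_inl_comb (T : QState W →ₗ[ℂ] QState W) (ψ₀ ψ₁ : QState W) :
    HiddenSubspace.lift (.inl : W → W ⊕ Unit) T (comb ψ₀ ψ₁) = comb (T ψ₀) (T ψ₁) := by
  funext x
  rw [lift_apply, slice_inl_comb, comb]
  split_ifs <;> rfl

/-- The projection onto the span of the basis states in `Z`. -/
def proj (Z : Set (Bits W)) : QState W →ₗ[ℂ] QState W where
  toFun ψ := Z.indicator ψ
  map_add' ψ φ := Set.indicator_add' Z ψ φ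
  map_smul' c ψ := Set.indicator_const_smul Z c ψ

theorem proj_apply (Z : Set (Bits W)) (ψ : QState W) : proj Z ψ = Z.indicator ψ := rfl

theorem proj_proj (Z : Set (Bits W)) (ψ : QState W) : proj Z (proj Z ψ) = proj Z ψ := by
  simp [proj_apply, Set.indicator_indicator]

theorem update_inr_comp_inl (x : Bits (W ⊕ Unit)) (b : ZMod 2) :
    Function.update x (.inr ()) b ∘ .inl = x ∘ .inl := by
  funext w
  simp

/-- Adding f to the extra bit exchanges the two halves of the state exactly on the part where f is
one. -/
theorem xorOp_comb (f : Bits W → ZMod 2) (ψ₀ ψ₁ : QState W) :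
    xorOp (.inr ()) (fun x => f (x ∘ .inl)) (comb ψ₀ ψ₁) =
      comb (ψ₀ - proj {x | f x = 1} ψ₀ + proj {x | f x = 1} ψ₁)
        (ψ₁ - proj {x | f x = 1} ψ₁ + proj {x | f x = 1} ψ₀) := by
  funext x
  rw [xorOp_apply]
  simp only [comb, Function.update_self, update_inr_comp_inl, Pi.add_apply, Pi.sub_apply, proj_apply]
  have h2 : (1 + 1 : ZMod 2) = 0 := by decide
  rcases zmod_two_cases (f (x ∘ .inl)) with hf | hf <;>
    rcases zmod_two_cases (x (.inr ())) with hx | hx <;>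
      simp [Set.indicator, hf, hx, h2]

theorem comb_add (a b c d : QState W) : comb a b + comb c d = comb (a + c) (b + d) := by
  funext x
  simp only [comb, Pi.add_apply]
  split_ifs <;> rfl

theorem comb_sub (a b c d : QState W) : comb a b - comb c d = comb (a - c) (b - d) := by
  funext x
  simp only [comb, Pi.sub_apply]
  split_ifs <;> rfl

theorem comb_zero : comb (0 : QState W) 0 = 0 := by
  funext x
  simp [comb]

/-! ### Testing a projector and reflecting about it -/

/-- Two predicates on the basis states and a circuit. They describe the operator that is the
projection to the first predicate, followed by the projection to the second predicate in the basis
given by the circuit. -/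
structure TestData (S W : Type) where
  fst : Bits S → Bits W → ZMod 2
  snd : Bits S → Bits W → ZMod 2
  layer : Circuit W

/-- The operator that is tested. -/
def TestData.op (D : TestData S W) (s : Bits S) : QState W →ₗ[ℂ] QState W :=
  Circuit.lin D.layer ∘ₗ proj {x | D.snd s x = 1} ∘ₗ Circuit.lin D.layer ∘ₗ
    proj {x | D.fst s x = 1}

/-- The two projections commute, and the predicates have straight-line programs of length `c`. -/
structure TestData.Valid (D : TestData S W) (G : Set (Bits S)) (c : ℕ) : Prop where
  layer_layer : ∀ ψ, Circuit.lin D.layer (Circuit.lin D.layer ψ) = ψ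
  proj_op : ∀ s ∈ G, ∀ ψ, proj {x | D.fst s x = 1} (D.op s ψ) = D.op s ψ
  computable_fst : Computable c fun x : Bits (S ⊕ W) => D.fst (x ∘ .inl) (x ∘ .inr)
  computable_snd : Computable c fun x : Bits (S ⊕ W) => D.snd (x ∘ .inl) (x ∘ .inr)

/-- The range of the operator is fixed by the first projection, so in the square the inner first
projection disappears. The two adjacent layers then cancel and the second projection is idempotent.
-/
theorem TestData.Valid.op_op {D : TestData S W} {c : ℕ} (hD : D.Valid G c) {s : Bits S}
    (hs : s ∈ G) (ψ : QState W) : D.op s (D.op s ψ) = D.op s ψ := by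
  have h := hD.proj_op s hs
  simp only [TestData.op, LinearMap.comp_apply] at h ⊢
  rw [h, hD.layer_layer, proj_proj]

/-- Toggle an additional bit on the range of `P`. -/
def toggle (P : QState W →ₗ[ℂ] QState W) : QState (W ⊕ Unit) →ₗ[ℂ] QState (W ⊕ Unit) :=
  LinearMap.id - HiddenSubspace.lift .inl P +
    HiddenSubspace.lift .inl P ∘ₗ xorOp (.inr ()) fun _ => 1

theorem toggle_comb (P : QState W →ₗ[ℂ] QState W) (ψ₀ ψ₁ : QState W) :
    toggle P (comb ψ₀ ψ₁) = comb (ψ₀ - P ψ₀ + P ψ₁) (ψ₁ - P ψ₁ + P ψ₀) := by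
  have hx : xorOp (.inr ()) (fun _ => 1) (comb ψ₀ ψ₁) = comb ψ₁ ψ₀ := by
    have h : proj (Set.univ : Set (Bits W)) = LinearMap.id := by
      ext1
      ext1
      simp [proj_apply]
    have := xorOp_comb (fun _ => 1) ψ₀ ψ₁
    simpa [proj_apply] using this
  rw [toggle, LinearMap.add_apply, LinearMap.sub_apply, LinearMap.comp_apply, hx,
    lift_inl_comb, lift_inl_comb, LinearMap.id_apply, comb_sub, comb_add]

/-- The outer bit acts as a control: only the half in which it is one sees the inner toggle. -/
theorem xorOp_mid_comb (f : Bits W → ZMod 2) (ψ₀ ψ₁ : QState (W ⊕ Unit)) :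
    xorOp (.inl (.inr ())) (fun x => x (.inr ()) * f (x ∘ .inl ∘ .inl)) (comb ψ₀ ψ₁) =
      comb ψ₀ (xorOp (.inr ()) (fun x => f (x ∘ .inl)) ψ₁) := by
  funext x
  rw [xorOp_apply]
  simp only [comb]
  rw [Function.update_of_ne (by simp)]
  rcases zmod_two_cases (x (.inr ())) with hx | hx
  · simp [hx]
  · simp only [hx, one_mul, one_ne_zero, if_false, xorOp_apply]
    congr 1
    funext w
    rcases w with w | w
    · rw [Function.comp_apply, Function.update_of_ne (by simp), Function.update_of_ne (by simp)]
      rfl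
    · simp [Function.comp_def]

/-- The first predicate is written to a work bit; in the basis of the layer, the second predicate,
controlled on that bit, toggles the flag; then the layer and the work bit are undone. Without the
control bit set, the two layers simply cancel. -/
theorem TestData.Valid.implements_toggle {D : TestData S W} {c : ℕ} (hD : D.Valid G c)
    {L : ℕ} (hL : D.layer.length ≤ L) :
    Implements G (c + 3) (3 * (4 * (c + 2) + 1) + 2 * L) (fun s => toggle (D.op s)) := by
  have h1 : Implements G (c + 2) (4 * (c + 2) + 1)
      (fun s => xorOp (.inr ()) fun x : Bits ((W ⊕ Unit) ⊕ Unit) => D.fst s (x ∘ (.inl ∘ .inl))) :=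
    Implements.xor hD.computable_fst _ _ (by simp) (by omega) (by omega)
  have h2 : Implements G (c + 2) L
      (fun _ => HiddenSubspace.lift (.inl ∘ .inl : W → (W ⊕ Unit) ⊕ Unit)
        (Circuit.lin D.layer)) :=
    (Implements.circuit (p := c + 2) D.layer).lift (Sum.inl_injective.comp Sum.inl_injective)
      le_rfl hL
  have hc3 : Computable (c + 2) fun x : Bits (S ⊕ (W ⊕ Unit)) =>
      (x ∘ .inr) (.inr ()) * D.snd (x ∘ .inl) ((x ∘ .inr) ∘ .inl) :=
    (Computable.mul (Computable.var (.inr (.inr ()) : S ⊕ (W ⊕ Unit)))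
      (hD.computable_snd.comp (Sum.map id .inl : S ⊕ W → S ⊕ (W ⊕ Unit)))).mono (by omega)
  have h3 : Implements G (c + 2) (4 * (c + 2) + 1)
      (fun s => xorOp (.inl (.inr ())) fun x : Bits ((W ⊕ Unit) ⊕ Unit) =>
        x (.inr ()) * D.snd s (x ∘ .inl ∘ .inl)) :=
    Implements.xor (V := W ⊕ Unit)
      (f := fun s y => y (.inr ()) * D.snd s (y ∘ .inl)) hc3
      (Sum.map .inl id : W ⊕ Unit → (W ⊕ Unit) ⊕ Unit) _ (by rintro (v | v) <;> simp)
      le_rfl le_rfl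
  refine Implements.hide (((h1.comp (h2.comp (h3.comp (h2.comp h1)))).mono le_rfl
    (by omega))) fun s hs ψ => ?_
  have eL : ∀ ψ₀ ψ₁ : QState (W ⊕ Unit),
      HiddenSubspace.lift (.inl ∘ .inl : W → (W ⊕ Unit) ⊕ Unit) (Circuit.lin D.layer)
        (comb ψ₀ ψ₁) = comb (HiddenSubspace.lift .inl (Circuit.lin D.layer) ψ₀)
          (HiddenSubspace.lift .inl (Circuit.lin D.layer) ψ₁) := fun ψ₀ ψ₁ => by
    rw [← lift_lift Sum.inl_injective Sum.inl_injective, lift_inl_comb]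
  have eX : ∀ ψ₀ ψ₁ : QState (W ⊕ Unit),
      xorOp (.inr ()) (fun x : Bits ((W ⊕ Unit) ⊕ Unit) => D.fst s (x ∘ (.inl ∘ .inl)))
        (comb ψ₀ ψ₁) = _ := fun ψ₀ ψ₁ =>
    xorOp_comb (fun y : Bits (W ⊕ Unit) => D.fst s (y ∘ .inl)) ψ₀ ψ₁
  have eP : ∀ a b : QState W, proj {x : Bits (W ⊕ Unit) | D.fst s (x ∘ .inl) = 1} (comb a b) =
      comb (proj {x | D.fst s x = 1} a) (proj {x | D.fst s x = 1} b) := by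
    intro a b
    funext x
    simp only [proj_apply, comb, Set.indicator, Set.mem_ofPred_eq]
    split_ifs <;> rfl
  obtain ⟨a, b, rfl⟩ := comb_surj ψ
  -- Uncomputing the work bit succeeds because the component selected by both predicates still
  -- satisfies the first one.
  have hop := hD.proj_op s hs
  simp only [TestData.op, LinearMap.comp_apply] at hop
  simp only [LinearMap.comp_apply, eX, eL, eP, xorOp_mid_comb, xorOp_comb, toggle_comb,
    TestData.op, comb_sub, comb_add, map_add, map_sub, map_zero, sub_zero, zero_add,
    lift_inl_comb, hD.layer_layer, hop, proj_proj, add_zero, sub_self]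
  congr 1
  · congr 1 <;> abel
  · rw [← comb_zero]

/-- Toggling moves the range of the projection to the half where a work bit is one, four phase gates
act there as -1, and the second toggle moves it back and clears the bit. -/
theorem TestData.Valid.implements_reflection {D : TestData S W} {c : ℕ} (hD : D.Valid G c)
    {L : ℕ} (hL : D.layer.length ≤ L) :
    Implements G (c + 4) (2 * (3 * (4 * (c + 2) + 1) + 2 * L) + 4)
      (fun s => LinearMap.id - (2 : ℂ) • D.op s) := by
  have h1 := hD.implements_toggle hL
  have h2 : Implements G (c + 3) 4 (fun _ => Circuit.lin (List.replicate 4 (.phase (.inr ())) :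
      Circuit (W ⊕ Unit))) := by
    simpa using Implements.circuit (G := G) (p := c + 3)
      (List.replicate 4 (.phase (.inr ())) : Circuit (W ⊕ Unit))
  refine Implements.hide ((h1.comp (h2.comp h1)).mono le_rfl (by omega)) fun s hs ψ => ?_
  have eZ : ∀ a b : QState W, Circuit.lin (List.replicate 4 (.phase (.inr ())) :
      Circuit (W ⊕ Unit)) (comb a b) = comb a (-b) := by
    intro a b
    funext x
    rw [Circuit.lin_apply, run_replicate_phase]
    rcases zmod_two_cases (x (.inr ())) with h | h <;> simp [comb, h, exp_pi_four_pow]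
  simp only [LinearMap.comp_apply, toggle_comb, eZ, map_zero, sub_zero, zero_add, add_zero,
    map_sub, map_neg, hD.op_op hs, LinearMap.sub_apply, LinearMap.id_apply, LinearMap.smul_apply,
    sub_self]
  congr 1
  · rw [two_smul]
    abel

end Implements

/-! ### Unitarity of implemented operators. -/

section Unitarity

variable {S W : Type} [Fintype S] [DecidableEq S] [Fintype W] [DecidableEq W]
  {G : Set (Bits S)} {p l : ℕ}

theorem sum_embed {M : Type} [AddCommMonoid M] (s : Bits S) (ψ : QState W)
    (F : Bits (S ⊕ W ⊕ Fin p) → ℂ → M) (hF : ∀ x, F x 0 = 0) :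
    ∑ x : Bits (S ⊕ W ⊕ Fin p), F x (embed s ψ x) =
      ∑ y : Bits W, F (Sum.elim s (Sum.elim y 0)) (ψ y) := by
  symm
  refine Finset.sum_of_injOn (fun y => Sum.elim s (Sum.elim y 0)) ?_ (by simp) ?_ ?_
  · intro y _ y' _ h
    funext w
    exact congrFun h (.inr (.inl w))
  · intro x _ hx
    rw [embed, if_neg, hF]
    rintro ⟨h1, h2⟩
    refine hx ⟨fun w => x (.inr (.inl w)), by simp, ?_⟩
    funext w
    rcases w with w | w | w
    · exact (h1 w).symm
    · rfl
    · exact (h2 w).symm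
  · intro y _
    rw [embed, if_pos (by simp)]
    rfl

theorem herm_embed (s : Bits S) (ψ φ : QState W) :
    herm (embed (p := p) s ψ) (embed s φ) = herm ψ φ := by
  rw [herm, herm, sum_embed s ψ fun x a => (starRingEnd ℂ) a * embed s φ x]
  · refine Finset.sum_congr rfl fun y _ => ?_
    rw [embed, if_pos (by simp)]
    rfl
  · simp

/-- Circuits preserve the Hermitian product, and `embed` is isometric, so unitarity passes to the
operator for each admissible serial number. -/
theorem Implements.herm_apply {T : Bits S → QState W →ₗ[ℂ] QState W} (h : Implements G p l T)
    {s : Bits S} (hs : s ∈ G) (ψ φ : QState W) : herm (T s ψ) (T s φ) = herm ψ φ := by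
  obtain ⟨C, -, hC⟩ := h
  rw [← herm_embed (p := p) s, ← hC s hs, ← hC s hs, Circuit.herm_run, herm_embed]

end Unitarity

/-! ### Amplification -/

section Amplifier

variable {S B : Type}

/-- The operator tested by `D`, controlled on an additional bit being zero. -/
def TestData.control (D : TestData S B) : TestData S (B ⊕ Unit) where
  fst s x := D.fst s (x ∘ .inl) * (x (.inr ()) + 1)
  snd s x := D.snd s (x ∘ .inl)
  layer := Circuit.map .inl Sum.inl_injective D.layer

variable [DecidableEq S] [DecidableEq B] {G : Set (Bits S)}

/-- The first projection kills the half where the control bit is one, and nothing later acts on that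
bit. Controlling one predicate is therefore enough. -/
theorem TestData.control_op (D : TestData S B) (s : Bits S) (a b : QState B) :
    D.control.op s (comb a b) = comb (D.op s a) 0 := by
  have h1 : ∀ a b : QState B, proj {x | D.control.fst s x = 1} (comb a b) =
      comb (proj {x | D.fst s x = 1} a) 0 := by
    intro a b
    funext x
    simp only [proj_apply, comb, Set.indicator, Set.mem_ofPred_eq, TestData.control]
    rcases zmod_two_cases (x (.inr ())) with h | h
    · simp [h]
    · have h2 : (1 + 1 : ZMod 2) = 0 := by decide
      simp [h, h2]
  have h2 : ∀ a b : QState B, proj {x | D.control.snd s x = 1} (comb a b) =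
      comb (proj {x | D.snd s x = 1} a) (proj {x | D.snd s x = 1} b) := by
    intro a b
    funext x
    simp only [proj_apply, comb, Set.indicator, Set.mem_ofPred_eq, TestData.control]
    split_ifs <;> rfl
  have h3 : ∀ a b : QState B, Circuit.lin D.control.layer (comb a b) =
      comb (Circuit.lin D.layer a) (Circuit.lin D.layer b) := by
    intro a b
    rw [Circuit.lin_apply, TestData.control, Circuit.run_map, lift_inl_comb]
  simp only [TestData.op, LinearMap.comp_apply, h1, h2, h3, map_zero]

theorem TestData.Valid.control {D : TestData S B} {c : ℕ} (hD : D.Valid G c) :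
    D.control.Valid G (c + 4) where
  layer_layer ψ := by
    obtain ⟨a, b, rfl⟩ := comb_surj ψ
    simp only [TestData.control, Circuit.lin_apply, Circuit.run_map, lift_inl_comb]
    simp only [← Circuit.lin_apply, hD.layer_layer]
  proj_op s hs ψ := by
    obtain ⟨a, b, rfl⟩ := comb_surj ψ
    rw [TestData.control_op]
    conv_rhs => rw [← hD.proj_op s hs]
    funext x
    simp only [proj_apply, comb, Set.indicator, Set.mem_ofPred_eq, TestData.control]
    rcases zmod_two_cases (x (.inr ())) with h | h
    · simp [h]
    · simp [h]
  computable_fst :=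
    ((hD.computable_fst.comp (Sum.map id .inl : S ⊕ B → S ⊕ (B ⊕ Unit))).mul
      (Computable.var (.inr (.inr ()) : S ⊕ (B ⊕ Unit))).not).mono (by omega)
  computable_snd :=
    (hD.computable_snd.comp (Sum.map id .inl : S ⊕ B → S ⊕ (B ⊕ Unit))).mono (by omega)

variable {T : ℕ}

/-- The part of a state with given values of the flags. -/
def part (z : Bits (Fin (T + 1))) : QState (B ⊕ Fin (T + 1)) →ₗ[ℂ] QState B where
  toFun φ := fun y => φ (Sum.elim y z)
  map_add' _ _ := rfl
  map_smul' _ _ := rfl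

theorem part_apply (z : Bits (Fin (T + 1))) (φ : QState (B ⊕ Fin (T + 1))) (y : Bits B) :
    part z φ y = φ (Sum.elim y z) := rfl

theorem part_lift_inl (z : Bits (Fin (T + 1))) (R : QState B →ₗ[ℂ] QState B)
    (φ : QState (B ⊕ Fin (T + 1))) : part z (lift .inl R φ) = R (part z φ) := by
  funext y
  rw [part_apply, lift_apply]
  have h : slice .inl (Sum.elim y z) φ = part z φ := by
    funext y'
    rw [slice_apply, part_apply]
    congr 1
    funext w
    rcases w with w | w
    · exact Sum.inl_injective.extend_apply _ _ _
    · exact Function.extend_apply' _ _ _ (by simp)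
  rw [h]
  rfl

/-- The wires of `B` and one flag. -/
def flagWire (B : Type) {T : ℕ} (r : Fin (T + 1)) : B ⊕ Unit → B ⊕ Fin (T + 1) :=
  Sum.map id fun _ => r

theorem flagWire_injective (r : Fin (T + 1)) : Function.Injective (flagWire B r) :=
  Function.injective_id.sumMap fun _ _ _ => rfl

/-- An operator on B and the flag r sees only the two parts of the state that differ in this flag;
together they form a `comb`. -/
theorem part_lift_flagWire (z : Bits (Fin (T + 1))) (r : Fin (T + 1))
    (R : QState (B ⊕ Unit) →ₗ[ℂ] QState (B ⊕ Unit)) (φ : QState (B ⊕ Fin (T + 1)))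
    {a b : QState B}
    (h : R (comb (part (Function.update z r 0) φ) (part (Function.update z r 1) φ)) = comb a b) :
    part z (lift (flagWire B r) R φ) = if z r = 0 then a else b := by
  funext y
  rw [part_apply, lift_apply]
  have h' : slice (flagWire B r) (Sum.elim y z) φ =
      comb (part (Function.update z r 0) φ) (part (Function.update z r 1) φ) := by
    funext y'
    have e : ∀ b, y' (.inr ()) = b → Function.extend (flagWire B r) y' (Sum.elim y z) =
        Sum.elim (y' ∘ .inl) (Function.update z r b) := by
      intro b hb
      funext w
      rcases w with w | w
      · exact (flagWire_injective r).extend_apply y' _ (.inl w)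
      · by_cases hw : w = r
        · subst hw
          rw [Sum.elim_inr, Function.update_self, ← hb]
          exact (flagWire_injective w).extend_apply y' _ (.inr ())
        · rw [Sum.elim_inr, Function.update_of_ne hw, Function.extend_apply']
          · rfl
          · rintro ⟨a | a, ha⟩ <;> simp [flagWire] at ha
            exact hw ha.symm
    rw [slice_apply, comb]
    split_ifs with h0
    · rw [e 0 h0]; rfl
    · rw [e 1 (zmod_two_ne_zero.1 h0)]; rfl
  rw [h', h, comb]
  change (if z r = 0 then a y else b y) = _
  split_ifs <;> rfl

theorem part_toggle (z : Bits (Fin (T + 1))) (r : Fin (T + 1)) (P : QState B →ₗ[ℂ] QState B)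
    (φ : QState (B ⊕ Fin (T + 1))) :
    part z (lift (flagWire B r) (toggle P) φ) =
      part z φ - P (part z φ) + P (part (Function.update z r (z r + 1)) φ) := by
  rw [part_lift_flagWire z r _ φ (toggle_comb _ _ _)]
  rcases zmod_two_cases (z r) with h | h
  · have hz : Function.update z r 0 = z := by rw [← h, Function.update_eq_self]
    rw [if_pos h, hz, h, zero_add]
  · have hz : Function.update z r 1 = z := by rw [← h, Function.update_eq_self]
    have h2 : (1 + 1 : ZMod 2) = 0 := by decide
    rw [if_neg (by simp [h]), hz, h, h2]

theorem part_reflection (z : Bits (Fin (T + 1))) (r : Fin (T + 1)) (D : TestData S B) (s : Bits S)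
    (φ : QState (B ⊕ Fin (T + 1))) :
    part z (lift (flagWire B r) (LinearMap.id - (2 : ℂ) • D.control.op s) φ) =
      if z r = 0 then part z φ - (2 : ℂ) • D.op s (part z φ) else part z φ := by
  rw [part_lift_flagWire z r _ φ (a := part (Function.update z r 0) φ -
    (2 : ℂ) • D.op s (part (Function.update z r 0) φ)) (b := part (Function.update z r 1) φ)]
  · rcases zmod_two_cases (z r) with h | h
    · have hz : Function.update z r 0 = z := by rw [← h, Function.update_eq_self]
      rw [if_pos h, if_pos h, hz]
    · have hz : Function.update z r 1 = z := by rw [← h, Function.update_eq_self]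
      rw [if_neg (by simp [h]), if_neg (by simp [h]), hz]
  · rw [LinearMap.sub_apply, LinearMap.id_apply, LinearMap.smul_apply, TestData.control_op]
    have : ∀ c : ℂ, ∀ a : QState B, c • comb a 0 = comb (c • a) 0 := by
      intro c a
      funext x
      simp only [comb, Pi.smul_apply]
      split_ifs <;> simp
    rw [this, comb_sub, sub_zero]

/-- The operator `U`, followed by a test `P` and `n` rounds in each of which, unless the previous
test was passed, a reflection about the start state is made and the test is repeated. The results
of the tests are kept in flags. -/
def amplify (U V : QState B →ₗ[ℂ] QState B) (P : QState B →ₗ[ℂ] QState B)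
    (R : QState (B ⊕ Unit) →ₗ[ℂ] QState (B ⊕ Unit)) (T : ℕ) :
    ℕ → (QState (B ⊕ Fin (T + 1)) →ₗ[ℂ] QState (B ⊕ Fin (T + 1)))
  | 0 => lift (flagWire B 0) (toggle P) ∘ₗ lift .inl U
  | n + 1 => (lift (flagWire B (Fin.ofNat (T + 1) (n + 1))) (toggle P) ∘ₗ lift .inl U) ∘ₗ
      (lift (flagWire B (Fin.ofNat (T + 1) n)) R ∘ₗ lift .inl V) ∘ₗ amplify U V P R T n

/-- One round costs two preparations, a toggle and a controlled reflection. The control lengthens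
the programs by four and the reflection needs four work wires more, hence the requirement of c + 8.
-/
theorem Implements.amplify {U V : Bits S → QState B →ₗ[ℂ] QState B} {A D : TestData S B}
    {c L p lU : ℕ} (hp : c + 8 ≤ p)
    (hU : Implements G p lU U) (hV : Implements G p lU V) (hA : A.Valid G c) (hD : D.Valid G c)
    (hAL : A.layer.length ≤ L) (hDL : D.layer.length ≤ L) (T n : ℕ) :
    Implements G p ((n + 1) * (2 * lU + 36 * c + 6 * L + 300))
      (fun s => HiddenSubspace.amplify (U s) (V s) (A.op s)
        (LinearMap.id - (2 : ℂ) • D.control.op s) T n) := by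
  have hU' := hU.lift (Sum.inl_injective : Function.Injective (.inl : B → B ⊕ Fin (T + 1)))
    le_rfl le_rfl
  have hV' := hV.lift (Sum.inl_injective : Function.Injective (.inl : B → B ⊕ Fin (T + 1)))
    le_rfl le_rfl
  have hA' : ∀ r, _ := fun r : Fin (T + 1) =>
    (hA.implements_toggle hAL).lift (flagWire_injective r) (show c + 3 ≤ p by omega) le_rfl
  have hD' : ∀ r, _ := fun r : Fin (T + 1) =>
    (hD.control.implements_reflection (L := L)
      (by rw [TestData.control, Circuit.length_map]; exact hDL)).lift
      (flagWire_injective r) (show c + 4 + 4 ≤ p by omega) le_rfl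
  induction n with
  | zero => exact ((hA' 0).comp hU').mono le_rfl (by omega)
  | succ n ih =>
    refine ((((hA' _).comp hU').comp (((hD' _).comp hV').comp ih))).mono le_rfl ?_
    rw [add_mul (n + 1) 1]
    omega

/-- The state `|v⟩ |0⟩`, where the flags are zero. -/
def withFlags (T : ℕ) (v : QState B) : QState (B ⊕ Fin (T + 1)) := fun x =>
  if x ∘ .inr = 0 then v (x ∘ .inl) else 0

theorem part_withFlags (v : QState B) (z : Bits (Fin (T + 1))) :
    part z (withFlags T v) = if z = 0 then v else 0 := by
  funext y
  rw [part_apply, withFlags, Sum.elim_comp_inr, Sum.elim_comp_inl]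
  by_cases hz : z = 0
  · rw [if_pos hz, if_pos hz]
  · rw [if_neg hz, if_neg hz]
    rfl

/-- Only the branch in which all tests failed is reflected. There, the reflection subtracts a
multiple of U v, and the failed test keeps only the component of U v outside the range of P. The
branch thus stays on one line and is rescaled by 1 - 2b in each round. A branch that has passed is
restored by U after V, passes every later test, and so has its current flag set; later flags are
still unused. -/
theorem amplify_parts {U V P Q : QState B →ₗ[ℂ] QState B}
    {R : QState (B ⊕ Unit) →ₗ[ℂ] QState (B ⊕ Unit)} {v : QState B} {b : ℂ}
    (hR : ∀ (z : Bits (Fin (T + 1))) r φ, part z (lift (flagWire B r) R φ) =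
      if z r = 0 then part z φ - (2 : ℂ) • Q (part z φ) else part z φ)
    (hUV : ∀ ψ, U (V ψ) = ψ) (hP : ∀ ψ, P (P ψ) = P ψ)
    (hQ : U (Q (V (U v - P (U v)))) = b • U v) (n : ℕ) (hn : n ≤ T) :
    part 0 (amplify U V P R T n (withFlags T v)) = (1 - 2 * b) ^ n • (U v - P (U v)) ∧
    ∀ z : Bits (Fin (T + 1)), z ≠ 0 →
      P (part z (amplify U V P R T n (withFlags T v))) =
        part z (amplify U V P R T n (withFlags T v)) ∧
      (part z (amplify U V P R T n (withFlags T v)) ≠ 0 →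
        z (Fin.ofNat (T + 1) n) = 1 ∧ ∀ j : Fin (T + 1), n < j → z j = 0) := by
  have hone : (1 + 1 : ZMod 2) = 0 := by decide
  induction n with
  | zero =>
    simp only [amplify, LinearMap.comp_apply, part_toggle, part_lift_inl, part_withFlags]
    have hne : Function.update (0 : Bits (Fin (T + 1))) 0 ((0 : Bits (Fin (T + 1))) 0 + 1) ≠ 0 :=
      fun h => by simpa using congrFun h 0
    refine ⟨by rw [if_pos trivial, if_neg hne]; simp, fun z hz => ?_⟩
    rw [if_neg hz, map_zero, map_zero, sub_zero, zero_add]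
    refine ⟨hP _, fun h => ?_⟩
    have h0 : Function.update z 0 (z 0 + 1) = 0 := by
      by_contra h0
      rw [if_neg h0] at h
      simp at h
    have h1 : z 0 = 1 := by
      have := congrFun h0 0
      simp only [Function.update_self, Pi.zero_apply] at this
      rcases zmod_two_cases (z 0) with h | h
      · simp [h] at this
      · exact h
    refine ⟨h1, fun j hj => ?_⟩
    have hj0 : j ≠ 0 := by
      rintro rfl
      simp at hj
    have := congrFun h0 j
    rwa [Function.update_of_ne hj0] at this
  | succ n ih =>
    obtain ⟨ih0, ih1⟩ := ih (by omega)
    set φ := amplify U V P R T n (withFlags T v)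
    set χ := lift (.inl : B → B ⊕ Fin (T + 1)) U (lift (flagWire B (Fin.ofNat (T + 1) n)) R
      (lift .inl V φ)) with hχ
    have hφ' : amplify U V P R T (n + 1) (withFlags T v) =
        lift (flagWire B (Fin.ofNat (T + 1) (n + 1))) (toggle P) χ := rfl
    have hval : ∀ m ≤ T, (Fin.ofNat (T + 1) m : Fin (T + 1)).val = m := fun m hm =>
      Nat.mod_eq_of_lt (by omega)
    -- Branches other than the failure branch carry the flag n, which switches the reflection off,
    -- so undoing and redoing the preparation cancel.
    have hχz : ∀ z, z ≠ 0 → part z χ = part z φ := by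
      intro z hz
      rw [hχ, part_lift_inl, hR, part_lift_inl]
      split_ifs with h0
      · have : part z φ = 0 := by
          by_contra h
          have := ((ih1 z hz).2 h).1
          rw [h0] at this
          exact zero_ne_one this
        rw [this]
        simp
      · exact hUV _
    have hχ0 : part 0 χ = (1 - 2 * b) ^ n • (U v - P (U v)) -
        ((1 - 2 * b) ^ n * (2 * b)) • U v := by
      rw [hχ, part_lift_inl, hR, part_lift_inl, if_pos (by rfl), ih0, map_sub, hUV]
      simp only [map_smul]
      rw [hQ, smul_smul, smul_smul]
      congr 2
      ring
    have hne : Function.update (0 : Bits (Fin (T + 1))) (Fin.ofNat (T + 1) (n + 1))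
        ((0 : Bits (Fin (T + 1))) (Fin.ofNat (T + 1) (n + 1)) + 1) ≠ 0 :=
      fun h => by simpa using congrFun h (Fin.ofNat (T + 1) (n + 1))
    have hnn : (Fin.ofNat (T + 1) n : Fin (T + 1)) ≠ Fin.ofNat (T + 1) (n + 1) := by
      intro h
      have := congrArg Fin.val h
      rw [hval n (by omega), hval (n + 1) hn] at this
      omega
    rw [hφ']
    refine ⟨?_, fun z hz => ?_⟩
    · rw [part_toggle, hχz _ hne]
      -- The string whose only set flag is number n + 1 has flag n unset, so it carries no amplitude
      -- before this round and nothing flows back into the failure branch.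
      have : part (Function.update (0 : Bits (Fin (T + 1))) (Fin.ofNat (T + 1) (n + 1))
          ((0 : Bits (Fin (T + 1))) (Fin.ofNat (T + 1) (n + 1)) + 1)) φ = 0 := by
        by_contra h
        have := ((ih1 _ hne).2 h).1
        rw [Function.update_of_ne hnn] at this
        exact zero_ne_one this
      rw [this, hχ0]
      simp only [map_sub, map_smul, hP, map_zero, sub_self, smul_zero, zero_sub, add_zero]
      rw [pow_succ]
      module
    · rw [part_toggle, hχz z hz, (ih1 z hz).1, sub_self, zero_add]
      refine ⟨hP _, fun h => ?_⟩
      set w := Function.update z (Fin.ofNat (T + 1) (n + 1)) (z (Fin.ofNat (T + 1) (n + 1)) + 1)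
        with hw
      have hwj : ∀ j, j ≠ Fin.ofNat (T + 1) (n + 1) → w j = z j := fun j hj =>
        Function.update_of_ne hj _ _
      have hwn : w (Fin.ofNat (T + 1) (n + 1)) = z (Fin.ofNat (T + 1) (n + 1)) + 1 :=
        Function.update_self _ _ _
      -- Here `w` is the flag string before the toggle. Its flags beyond n are still zero, so the
      -- toggle must have set flag n + 1.
      have hlate : ∀ j : Fin (T + 1), n < j → w j = 0 := by
        intro j hj
        by_cases hw0 : w = 0
        · rw [hw0]; rfl
        · rw [hχz w hw0] at h
          refine ((ih1 w hw0).2 fun h' => h ?_).2 j hj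
          rw [h', map_zero]
      constructor
      · have := hlate (Fin.ofNat (T + 1) (n + 1)) (by rw [hval _ hn]; omega)
        rw [hwn] at this
        rcases zmod_two_cases (z (Fin.ofNat (T + 1) (n + 1))) with h | h
        · rw [h, zero_add] at this
          exact absurd this one_ne_zero
        · exact h
      · intro j hj
        rw [← hwj j]
        · exact hlate j (by omega)
        · rintro rfl
          rw [hval _ hn] at hj
          omega

variable [Fintype S] [Fintype B]

theorem normSq_eq_sum_part (φ : QState (B ⊕ Fin (T + 1))) :
    normSq φ = ∑ z : Bits (Fin (T + 1)), normSq (part z φ) := by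
  simp only [normSq, part_apply]
  rw [Finset.sum_comm, ← Fintype.sum_prod_type' (f := fun y z => ‖φ (Sum.elim y z)‖ ^ 2)]
  exact ((Equiv.sumArrowEquivProdArrow B (Fin (T + 1)) (ZMod 2)).symm.sum_comp
    (fun x => ‖φ x‖ ^ 2)).symm

theorem normSq_withFlags (v : QState B) : normSq (withFlags T v) = normSq v := by
  rw [normSq_eq_sum_part]
  simp only [part_withFlags]
  rw [Finset.sum_eq_single 0]
  · rw [if_pos rfl]
  · intro z _ hz
    rw [if_neg hz]
    simp [normSq]
  · simp

theorem part_proj_last (z : Bits (Fin (T + 1))) (φ : QState (B ⊕ Fin (T + 1))) :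
    part z (proj {x | x (.inr (Fin.last T)) = 1} φ) =
      if z (Fin.last T) = 1 then part z φ else 0 := by
  funext y
  rw [part_apply, proj_apply]
  by_cases hz : z (Fin.last T) = 1
  · rw [if_pos hz, Set.indicator_of_mem (by exact hz)]
    rfl
  · rw [if_neg hz, Set.indicator_of_notMem (by exact hz)]
    rfl

/-- The result of amplification: if the test `P` is passed by `U v` with probability `q`, then the
last flag is set with probability `1 - (1 - q) (1 - 2 q) ^ (2 T)`, and the part of the state where it
is set is in the range of `P`. -/
theorem amplify_spec {U V : Bits S → QState B →ₗ[ℂ] QState B} {A D : TestData S B}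
    {c L p lU : ℕ} (hp : c + 8 ≤ p)
    (hU : Implements G p lU U) (hV : Implements G p lU V) (hA : A.Valid G c) (hD : D.Valid G c)
    (hAL : A.layer.length ≤ L) (hDL : D.layer.length ≤ L) (T : ℕ) {s : Bits S} (hs : s ∈ G)
    (hUV : ∀ ψ, U s (V s ψ) = ψ) (hherm : ∀ ψ φ, herm (A.op s ψ) φ = herm ψ (A.op s φ))
    {v : QState B} (hv : normSq v = 1) (hDv : ∀ ψ, D.op s ψ = herm v ψ • v) {q : ℝ}
    (hq : normSq (A.op s (U s v)) = q) :
    let φ := proj {x | x (.inr (Fin.last T)) = 1} (HiddenSubspace.amplify (U s) (V s) (A.op s)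
        (LinearMap.id - (2 : ℂ) • D.control.op s) T T (withFlags T v))
    normSq φ = 1 - (1 - q) * (1 - 2 * q) ^ (2 * T) ∧ ∀ z, A.op s (part z φ) = part z φ := by
  intro φ
  have hamp := (Implements.amplify hp hU hV hA hD hAL hDL T T).herm_apply hs
  have hAA := fun ψ => hA.op_op hs ψ
  have hUv : herm (U s v) (U s v) = 1 := by
    rw [hU.herm_apply hs, ← normSq_eq_herm, hv, Complex.ofReal_one]
  -- The test is a self-adjoint idempotent, so its acceptance probability is an expectation value.
  have hqh : herm (U s v) (A.op s (U s v)) = q := by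
    rw [← hq, normSq_eq_herm, hherm, hAA]
  have hb : herm (U s v) (U s v - A.op s (U s v)) = ((1 - q : ℝ) : ℂ) := by
    rw [herm_sub_right, hUv, hqh]
    push_cast
    rfl
  have hq1 : normSq (U s v - A.op s (U s v)) = 1 - q := by
    apply Complex.ofReal_injective
    rw [normSq_eq_herm, herm_sub_left, hb, hherm, map_sub, hAA, sub_self]
    simp [herm]
  obtain ⟨h0, h1⟩ := amplify_parts (T := T) (U := U s) (V := V s) (P := A.op s) (Q := D.op s)
    (R := LinearMap.id - (2 : ℂ) • D.control.op s) (v := v) (b := ((1 - q : ℝ) : ℂ))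
    (fun z r φ => part_reflection z r D s φ) hUV hAA (by
      rw [hDv, map_smul, ← hU.herm_apply hs, hUV, hb]) T le_rfl
  have hlast : (Fin.ofNat (T + 1) T : Fin (T + 1)) = Fin.last T := by
    apply Fin.ext
    exact Nat.mod_eq_of_lt (by omega)
  rw [hlast] at h1
  set χ := HiddenSubspace.amplify (U s) (V s) (A.op s)
        (LinearMap.id - (2 : ℂ) • D.control.op s) T T (withFlags T v)
  have hpart : ∀ z, part z φ = if z = 0 then 0 else part z χ := by
    intro z
    rw [part_proj_last]
    by_cases hz : z = 0
    · subst hz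
      simp
    · rw [if_neg hz]
      split_ifs with hl
      · rfl
      · by_contra h
        exact hl ((h1 z hz).2 fun h' => h h'.symm).1
  refine ⟨?_, fun z => ?_⟩
  · have hχ1 : normSq χ = 1 := by
      rw [normSq_of_herm hamp, normSq_withFlags, hv]
    have hsum : normSq χ = normSq φ + normSq (part 0 χ) := by
      rw [normSq_eq_sum_part χ, normSq_eq_sum_part φ, ← Finset.sum_erase_add _ _ (Finset.mem_univ 0),
        ← Finset.sum_erase_add _ (fun z => normSq (part z φ)) (Finset.mem_univ 0)]
      rw [hpart 0, if_pos rfl]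
      have hz : normSq (0 : QState B) = 0 := by simp [normSq]
      rw [hz, add_zero]
      congr 1
      refine Finset.sum_congr rfl fun z hz => ?_
      rw [hpart z, if_neg (Finset.ne_of_mem_erase hz)]
    have h2 : normSq (part 0 χ) = (1 - q) * (1 - 2 * q) ^ (2 * T) := by
      rw [h0, normSq_smul, hq1]
      -- With b = 1 - q the factor per round is -(1 - 2q); the sign disappears in the squared norm.
      have : (1 - 2 * ((1 - q : ℝ) : ℂ)) ^ T = (((-(1 - 2 * q)) ^ T : ℝ) : ℂ) := by
        push_cast
        ring
      rw [this, Complex.norm_real, Real.norm_eq_abs, sq_abs, ← pow_mul, mul_comm T 2,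
        Even.neg_pow (even_two_mul T)]
      ring
    linarith
  · rw [hpart z]
    split_ifs with hz
    · simp
    · exact (h1 z hz).1

end Amplifier

/-! ### The Hadamard transform and the verification operator -/

section Hadamard

variable {W : Type} [DecidableEq W] [Fintype W]

/-- The sum runs over strings on all wires although only the values on `l` matter, and the division
by 2^|W| together with the factors 2 corrects for this. With the index set fixed, one more gate is
exactly one use of `sum_bits_split`. -/
theorem run_map_hadamard (l : List W) (hl : l.Nodup) (ψ : QState W) (x : Bits W) :
    Circuit.run (l.map .hadamard) ψ x =
      (2 * (1 / (Real.sqrt 2 : ℂ))) ^ l.length * (1 / 2 ^ Fintype.card W) *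
        ∑ z : Bits W, sgn (l.map fun i => x i * z i).sum * ψ fun w => if w ∈ l then z w else x w := by
  induction l generalizing ψ with
  | nil =>
    have : (2 : ℂ) ^ Fintype.card W ≠ 0 := pow_ne_zero _ two_ne_zero
    simp [Circuit.run, sgn_zero, ZMod.card]
  | cons a l ih =>
    have ha : a ∉ l := (List.nodup_cons.1 hl).1
    rw [List.map_cons, Circuit.run_cons, ih (List.nodup_cons.1 hl).2]
    rw [sum_bits_split a (fun z => sgn ((a :: l).map fun i => x i * z i).sum *
      ψ fun w => if w ∈ a :: l then z w else x w)]
    rw [List.length_cons, pow_succ, Finset.mul_sum, Finset.mul_sum]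
    refine Finset.sum_congr rfl fun z _ => ?_
    have e1 : ∀ b, (l.map fun i => x i * Function.update z a b i) = l.map fun i => x i * z i := by
      intro b
      refine List.map_congr_left fun i hi => ?_
      rw [Function.update_of_ne (ne_of_mem_of_not_mem hi ha)]
    have e2 : ∀ b, (fun w => if w ∈ a :: l then Function.update z a b w else x w) =
        Function.update (fun w => if w ∈ l then z w else x w) a b := by
      intro b
      funext w
      by_cases hw : w = a
      · subst hw; simp
      · simp [hw]
    simp only [List.map_cons, List.sum_cons, e1, e2, Function.update_self, Gate.apply, if_neg ha,
      mul_zero, zero_add, mul_one, sgn_add]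
    ring

/-- The Hadamard gates on all the wires. -/
def hadamardCircuit (n : ℕ) : Circuit (Fin n) := (List.finRange n).map .hadamard

theorem length_hadamardCircuit (n : ℕ) : (hadamardCircuit n).length = n := by
  simp [hadamardCircuit]

theorem lin_hadamardCircuit (n : ℕ) : Circuit.lin (hadamardCircuit n) = hadamardAll n := by
  refine LinearMap.ext fun ψ => ?_
  funext x
  rw [Circuit.lin_apply, hadamardCircuit, run_map_hadamard _ (List.nodup_finRange n)]
  simp only [hadamardAll, LinearMap.coe_mk, AddHom.coe_mk, List.length_finRange,
    List.mem_finRange, if_true, Fintype.card_fin]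
  have h2 : ((Real.sqrt 2 : ℝ) : ℂ) ≠ 0 := by
    rw [Complex.ofReal_ne_zero]
    positivity
  have h3 : (((Real.sqrt (2 ^ n) : ℝ)) : ℂ) = (Real.sqrt 2 : ℂ) ^ n := by
    rw [← Complex.ofReal_pow, ← Real.sqrt_sq (pow_nonneg (Real.sqrt_nonneg 2) n), ← pow_mul,
      mul_comm n 2, pow_mul, Real.sq_sqrt (by norm_num)]
  have h4 : ∀ z : Vec n, (List.map (fun i => x i * z i) (List.finRange n)).sum = x ⬝ᵥ z := by
    intro z
    simp [dotProduct, List.sum_ofFn, ← List.ofFn_eq_map]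
  simp only [h3, h4, mul_pow, one_div_pow]
  field_simp

theorem hadamardAll_hadamardAll {n : ℕ} (ψ : QState (Fin n)) :
    hadamardAll n (hadamardAll n ψ) = ψ := by
  have hs : (1 / (Real.sqrt (2 ^ n) : ℂ)) * (1 / (Real.sqrt (2 ^ n) : ℂ)) * 2 ^ n = 1 := by
    have h2 : ((Real.sqrt (2 ^ n) : ℝ) : ℂ) * ((Real.sqrt (2 ^ n) : ℝ) : ℂ) = 2 ^ n := by
      rw [← Complex.ofReal_mul, Real.mul_self_sqrt (by positivity)]
      norm_num
    have h0 : (2 : ℂ) ^ n ≠ 0 := pow_ne_zero _ two_ne_zero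
    rw [div_mul_div_comm, h2]
    field_simp
  funext x
  simp only [hadamardAll, LinearMap.coe_mk, AddHom.coe_mk]
  have : ∀ y : Vec n, sgn (x ⬝ᵥ y) * (1 / (Real.sqrt (2 ^ n) : ℂ) * ∑ z, sgn (y ⬝ᵥ z) * ψ z) =
      ∑ z, (1 / (Real.sqrt (2 ^ n) : ℂ)) * ψ z * sgn (y ⬝ᵥ (x + z)) := by
    intro y
    rw [Finset.mul_sum, Finset.mul_sum]
    refine Finset.sum_congr rfl fun z _ => ?_
    rw [dotProduct_add, sgn_add, dotProduct_comm x y]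
    ring
  simp only [this]
  rw [Finset.sum_comm]
  simp only [← Finset.mul_sum, sum_sgn]
  rw [Finset.sum_eq_single x]
  · rw [if_pos (by funext i; exact zmod_two_add_self _)]
    linear_combination ψ x * hs
  · intro z _ hz
    rw [if_neg, mul_zero]
    intro h
    apply hz
    funext i
    have h1 := congrFun h i
    simp only [Pi.add_apply, Pi.zero_apply] at h1
    generalize x i = a at h1 ⊢
    generalize z i = b at h1 ⊢
    revert a b
    decide
  · simp

-- Outside of the orthogonal complement some x in A has product one with w, and translation by x
-- makes the sum equal to its own negative.
open Classical in
theorem sum_subspace_sgn {n : ℕ} (A : Subspc n) (w : Vec n) :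
    ∑ y : Vec n, (if y ∈ A then sgn (w ⬝ᵥ y) else 0) =
      if w ∈ perp A then (Nat.card A : ℂ) else 0 := by
  split_ifs with hw
  · have h : ∀ y : Vec n, (if y ∈ A then sgn (w ⬝ᵥ y) else 0) = if y ∈ A then (1 : ℂ) else 0 := by
      intro y
      split_ifs with hy
      · rw [dotProduct_comm, hw y hy, sgn_zero]
      · rfl
    simp only [h]
    rw [← Finset.sum_filter, Finset.sum_const, nsmul_eq_mul, mul_one, Nat.card_eq_fintype_card,
      Fintype.card_subtype]
  · obtain ⟨x, hx, hxw⟩ : ∃ x ∈ A, x ⬝ᵥ w ≠ 0 := by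
      by_contra! h
      exact hw h
    have hxw' : sgn (w ⬝ᵥ x) = -1 := by
      rw [dotProduct_comm, zmod_two_ne_zero.1 hxw, sgn_one]
    have key : ∑ y : Vec n, (if y ∈ A then sgn (w ⬝ᵥ y) else 0) =
        ∑ y : Vec n, -(if y ∈ A then sgn (w ⬝ᵥ y) else 0) := by
      refine Fintype.sum_equiv (Equiv.addRight x) _ _ fun y => ?_
      have : y + x ∈ A ↔ y ∈ A := A.add_mem_iff_left hx
      simp only [Equiv.coe_addRight, this, dotProduct_add, sgn_add, hxw']
      split_ifs <;> simp
    rw [Finset.sum_neg_distrib] at key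
    exact self_eq_neg.1 key

-- The indicator of the complement is written as an average of characters over A, and orthogonality
-- of characters on the whole space evaluates the rest. This is the kernel of the projection to the
-- complement in the Hadamard basis.
open Classical in
theorem sum_perp_sgn {n : ℕ} (A : Subspc n) (x : Vec n) :
    ∑ w : Vec n, (if w ∈ perp A then sgn (x ⬝ᵥ w) else 0) =
      if x ∈ A then (2 : ℂ) ^ n / Nat.card A else 0 := by
  have hA : (Nat.card A : ℂ) ≠ 0 := by exact_mod_cast Nat.card_pos.ne'
  have h : ∀ w : Vec n, (if w ∈ perp A then sgn (x ⬝ᵥ w) else 0) =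
      ∑ y : Vec n, (1 / (Nat.card A : ℂ)) * (if y ∈ A then sgn (w ⬝ᵥ (x + y)) else 0) := by
    intro w
    have := sum_subspace_sgn A w
    rw [← Finset.mul_sum]
    have h2 : ∀ y : Vec n, (if y ∈ A then sgn (w ⬝ᵥ (x + y)) else 0) =
        sgn (x ⬝ᵥ w) * if y ∈ A then sgn (w ⬝ᵥ y) else 0 := by
      intro y
      split_ifs
      · rw [dotProduct_add, sgn_add, dotProduct_comm w x]
      · simp
    simp only [h2]
    rw [← Finset.mul_sum, this]
    split_ifs
    · field_simp
    · simp
  simp only [h]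
  rw [Finset.sum_comm]
  have h3 : ∀ y : Vec n, ∑ w : Vec n, (1 / (Nat.card A : ℂ)) *
      (if y ∈ A then sgn (w ⬝ᵥ (x + y)) else 0) =
      if y = x then (if x ∈ A then (2 : ℂ) ^ n / Nat.card A else 0) else 0 := by
    intro y
    rw [← Finset.mul_sum]
    have hxy : x + y = 0 ↔ y = x := by
      constructor
      · intro h
        funext i
        have h1 := congrFun h i
        simp only [Pi.add_apply, Pi.zero_apply] at h1
        generalize x i = a at h1 ⊢
        generalize y i = b at h1 ⊢
        revert a b
        decide
      · rintro rfl
        funext i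
        exact zmod_two_add_self _
    by_cases hy : y ∈ A
    · simp only [if_pos hy, sum_sgn, hxy]
      by_cases hyx : y = x
      · subst hyx
        rw [if_pos rfl, if_pos rfl, if_pos hy]
        ring
      · rw [if_neg hyx, if_neg hyx, mul_zero]
    · simp only [if_neg hy, Finset.sum_const_zero, mul_zero]
      by_cases hyx : y = x
      · subst hyx
        rw [if_pos rfl, if_neg hy]
      · rw [if_neg hyx]
  simp only [h3]
  simp

/-- Character sum over the complement at the point zero. -/
theorem card_perp {n : ℕ} (A : Subspc n) : Nat.card A * Nat.card (perp A) = 2 ^ n := by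
  classical
  have hA : (Nat.card A : ℂ) ≠ 0 := by exact_mod_cast Nat.card_pos.ne'
  have h := sum_perp_sgn A 0
  simp only [zero_dotProduct, sgn_zero, A.zero_mem, if_true] at h
  rw [← Finset.sum_filter, Finset.sum_const, nsmul_eq_mul, mul_one, ← Fintype.card_subtype,
    ← Nat.card_eq_fintype_card, eq_div_iff hA] at h
  rw [mul_comm]
  exact_mod_cast h

theorem finrank_perp {n : ℕ} (A : Subspc n) :
    Module.finrank (ZMod 2) A + Module.finrank (ZMod 2) (perp A) = n := by
  have h := card_perp A
  have h1 : ∀ B : Subspc n, Nat.card B = 2 ^ Module.finrank (ZMod 2) B := fun B => by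
    rw [Module.natCard_eq_pow_finrank (K := ZMod 2), Nat.card_zmod]
  rw [h1, h1, ← pow_add] at h
  exact Nat.pow_right_injective le_rfl h

theorem subspaceState_apply {n : ℕ} (A : Subspc n) (x : Vec n) [Decidable (x ∈ A)] :
    subspaceState A x = if x ∈ A then 1 / (Real.sqrt (Nat.card A) : ℂ) else 0 := by
  rw [subspaceState]
  by_cases h : x ∈ A
  · rw [if_pos h, Set.indicator_of_mem (by exact h)]
  · rw [if_neg h, Set.indicator_of_notMem (by exact h)]

theorem hadamardAll_subspaceState_of_notMem {n : ℕ} (A : Subspc n) {x : Vec n}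
    (hx : x ∉ perp A) : hadamardAll n (subspaceState A) x = 0 := by
  classical
  have h := sum_subspace_sgn A x
  rw [if_neg hx] at h
  simp only [hadamardAll, LinearMap.coe_mk, AddHom.coe_mk, subspaceState_apply]
  have : ∀ y : Vec n, sgn (x ⬝ᵥ y) * (if y ∈ A then 1 / (Real.sqrt (Nat.card A) : ℂ) else 0) =
      (1 / (Real.sqrt (Nat.card A) : ℂ)) * if y ∈ A then sgn (x ⬝ᵥ y) else 0 := by
    intro y
    split_ifs <;> ring
  simp only [this]
  rw [← Finset.mul_sum, h, mul_zero, mul_zero]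

/-- A money state is left unchanged by the verification with sets that contain the subspace and its
orthogonal complement. -/
theorem verOp_subspaceState {n : ℕ} (A : Subspc n) {Z W : Set (Vec n)} (hZ : ∀ x ∈ A, x ∈ Z)
    (hW : ∀ x ∈ perp A, x ∈ W) : verOp Z W (subspaceState A) = subspaceState A := by
  have h1 : basisProj Z (subspaceState A) = subspaceState A := by
    refine Set.indicator_eq_self.2 fun x hx => hZ x ?_
    by_contra h
    exact hx (Set.indicator_of_notMem (by exact h) _)
  have h2 : basisProj W (hadamardAll n (subspaceState A)) = hadamardAll n (subspaceState A) := by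
    refine Set.indicator_eq_self.2 fun x hx => hW x ?_
    by_contra h
    exact hx (hadamardAll_subspaceState_of_notMem A h)
  simp only [verOp, LinearMap.comp_apply, h1, h2, hadamardAll_hadamardAll]

/-- If the two sets are the subspace and its orthogonal complement, then verification is the
projection to the money state. -/
theorem verOp_eq {n : ℕ} (A : Subspc n) (ψ : QState (Fin n)) :
    verOp (A : Set (Vec n)) (perp A : Set (Vec n)) ψ =
      herm (subspaceState A) ψ • subspaceState A := by
  classical
  have hA : (0 : ℝ) < Nat.card A := by exact_mod_cast Nat.card_pos
  have hA' : (Nat.card A : ℂ) ≠ 0 := by exact_mod_cast Nat.card_pos.ne'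
  have h2 : ∀ m : ℝ, 0 < m → ((Real.sqrt m : ℝ) : ℂ) * ((Real.sqrt m : ℝ) : ℂ) = m := fun m hm => by
    rw [← Complex.ofReal_mul, Real.mul_self_sqrt hm.le]
  have h2n := h2 (2 ^ n) (by positivity)
  push_cast at h2n
  have h2A := h2 _ hA
  push_cast at h2A
  have hn0 : (2 : ℂ) ^ n ≠ 0 := pow_ne_zero _ two_ne_zero
  have hs0 : ((Real.sqrt (2 ^ n) : ℝ) : ℂ) ≠ 0 := fun h => by
    rw [h, mul_zero] at h2n
    exact hn0 h2n.symm
  have hsA : ((Real.sqrt (Nat.card A) : ℝ) : ℂ) ≠ 0 := fun h => by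
    rw [h, mul_zero] at h2A
    exact hA' h2A.symm
  funext x
  have hproj : ∀ (B : Subspc n) (φ : QState (Fin n)) (y : Vec n),
      basisProj (B : Set (Vec n)) φ y = if y ∈ B then φ y else 0 := by
    intro B φ y
    by_cases h : y ∈ B
    · rw [if_pos h]; exact Set.indicator_of_mem (by exact h) _
    · rw [if_neg h]; exact Set.indicator_of_notMem (by exact h) _
  -- The kernel of Hadamard, projection to the complement, Hadamard is 1/|A| where x + y lies in A
  -- and zero elsewhere. For y in A the condition no longer involves y, so the operator has rank
  -- one.
  have lhs : verOp (A : Set (Vec n)) (perp A : Set (Vec n)) ψ x =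
      ∑ y : Vec n, (1 / 2 ^ n) * (if y ∈ A then ψ y else 0) *
        (if x + y ∈ A then (2 : ℂ) ^ n / Nat.card A else 0) := by
    rw [verOp]
    simp only [LinearMap.comp_apply]
    conv_lhs => rw [hadamardAll]
    simp only [LinearMap.coe_mk, AddHom.coe_mk, hproj]
    simp only [← sum_perp_sgn]
    rw [Finset.mul_sum]
    simp only [Finset.mul_sum]
    rw [Finset.sum_comm]
    refine Finset.sum_congr rfl fun w _ => ?_
    by_cases hw : w ∈ perp A
    · simp only [if_pos hw]
      rw [Finset.mul_sum, Finset.mul_sum]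
      refine Finset.sum_congr rfl fun y _ => ?_
      rw [add_dotProduct, sgn_add, dotProduct_comm w y, ← h2n]
      field_simp
    · simp [if_neg hw]
  rw [lhs, herm, Pi.smul_apply, smul_eq_mul, Finset.sum_mul]
  refine Finset.sum_congr rfl fun y _ => ?_
  simp only [subspaceState_apply]
  by_cases hy : y ∈ A
  · have : x + y ∈ A ↔ x ∈ A := A.add_mem_iff_left hy
    simp only [if_pos hy, this, map_div₀, map_one, Complex.conj_ofReal]
    split_ifs
    · rw [← h2A]
      field_simp
    · simp
  · simp [if_neg hy]

end Hadamard

/-! ### Tests for money states -/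

section Tests

variable {S B : Type} [DecidableEq B] {n : ℕ} {m₁ m₂ : Bits S → Vec n → ZMod 2}

/-- The predicates that belong to the serial number `s` describe `A` and its orthogonal
complement. -/
def Hides (m₁ m₂ : Bits S → Vec n → ZMod 2) (s : Bits S) (A : Subspc n) : Prop :=
  (∀ y, m₁ s y = 1 ↔ y ∈ A) ∧ ∀ y, m₂ s y = 1 ↔ y ∈ perp A

/-- The serial numbers that hide a subspace. -/
def hidingSet (m₁ m₂ : Bits S → Vec n → ZMod 2) : Set (Bits S) := {s | ∃ A, Hides m₁ m₂ s A}

theorem lift_proj {V : Type} [DecidableEq V] {e : V → B} (he : Function.Injective e) (Z : Set (Bits V))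
    (ψ : QState B) : lift e (proj Z) ψ = proj {x | x ∘ e ∈ Z} ψ := by
  funext x
  rw [lift_apply, proj_apply, proj_apply]
  by_cases hx : x ∘ e ∈ Z
  · rw [Set.indicator_of_mem hx, Set.indicator_of_mem (by exact hx), slice_apply, extend_self he]
  · rw [Set.indicator_of_notMem hx, Set.indicator_of_notMem (by exact hx)]

theorem proj_inter (Z Z' : Set (Bits B)) (ψ : QState B) :
    proj Z (proj Z' ψ) = proj (Z ∩ Z') ψ := by
  simp [proj_apply, Set.indicator_indicator]

/-- A condition that does not read the wires `e` commutes with everything done on them. This is what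
permits postponing the flag conditions of earlier stages. -/
theorem lift_proj_comm {V : Type} {e : V → B}
    (T : QState V →ₗ[ℂ] QState V) {Z : Set (Bits B)}
    (hZ : ∀ y x, Function.extend e y x ∈ Z ↔ x ∈ Z) (ψ : QState B) :
    lift e T (proj Z ψ) = proj Z (lift e T ψ) := by
  funext x
  rw [lift_apply, proj_apply _ (lift e T ψ)]
  by_cases hx : x ∈ Z
  · rw [Set.indicator_of_mem hx, lift_apply]
    have : slice e x (proj Z ψ) = slice e x ψ := by
      funext y
      rw [slice_apply, proj_apply, Set.indicator_of_mem ((hZ y x).2 hx), slice_apply]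
    rw [this]
  · rw [Set.indicator_of_notMem hx]
    have : slice e x (proj Z ψ) = 0 := by
      funext y
      rw [slice_apply, proj_apply, Set.indicator_of_notMem (fun h => hx ((hZ y x).1 h))]
      rfl
    rw [this, map_zero]
    rfl

/-- The projection to the money state of `A`. -/
abbrev moneyProj (A : Subspc n) : QState (Fin n) →ₗ[ℂ] QState (Fin n) :=
  verOp (A : Set (Vec n)) (perp A : Set (Vec n))

theorem proj_moneyProj (A : Subspc n) (ψ : QState (Fin n)) :
    proj (A : Set (Vec n)) (moneyProj A ψ) = moneyProj A ψ := by
  rw [moneyProj, verOp_eq, map_smul]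
  congr 1
  refine Set.indicator_eq_self.2 fun x hx => ?_
  by_contra h
  exact hx (Set.indicator_of_notMem (by exact h) _)

theorem herm_smul_right {W : Type} [DecidableEq W] [Fintype W] (c : ℂ) (ψ φ : QState W) :
    herm ψ (c • φ) = c * herm ψ φ := by
  simp only [herm, Pi.smul_apply, smul_eq_mul, Finset.mul_sum]
  exact Finset.sum_congr rfl fun x _ => by ring

theorem herm_smul_left {W : Type} [DecidableEq W] [Fintype W] (c : ℂ) (ψ φ : QState W) :
    herm (c • ψ) φ = (starRingEnd ℂ) c * herm ψ φ := by
  simp only [herm, Pi.smul_apply, smul_eq_mul, Finset.mul_sum, map_mul]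
  exact Finset.sum_congr rfl fun x _ => by ring

theorem conj_herm {W : Type} [DecidableEq W] [Fintype W] (ψ φ : QState W) :
    (starRingEnd ℂ) (herm ψ φ) = herm φ ψ := by
  simp only [herm, map_sum, map_mul, Complex.conj_conj]
  exact Finset.sum_congr rfl fun x _ => by ring

theorem herm_moneyProj (A : Subspc n) (ψ φ : QState (Fin n)) :
    herm (moneyProj A ψ) φ = herm ψ (moneyProj A φ) := by
  rw [moneyProj, verOp_eq, verOp_eq, herm_smul_left, herm_smul_right, conj_herm]
  ring

theorem lin_map_hadamardCircuit {ρ : Fin n → B} (hρ : Function.Injective ρ) :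
    Circuit.lin (Circuit.map ρ hρ (hadamardCircuit n)) = lift ρ (hadamardAll n) := by
  refine LinearMap.ext fun ψ => ?_
  rw [Circuit.lin_apply, Circuit.run_map, lin_hadamardCircuit]

theorem Hides.proj_fst {s : Bits S} {A : Subspc n} (h : Hides m₁ m₂ s A) (ρ : Fin n → B)
    (hρ : Function.Injective ρ) (ψ : QState B) :
    proj {x | m₁ s (x ∘ ρ) = 1} ψ = lift ρ (proj (A : Set (Vec n))) ψ := by
  rw [lift_proj hρ]
  congr 2
  ext x
  exact h.1 _

theorem Hides.proj_snd {s : Bits S} {A : Subspc n} (h : Hides m₁ m₂ s A) (ρ : Fin n → B)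
    (hρ : Function.Injective ρ) (ψ : QState B) :
    proj {x | m₂ s (x ∘ ρ) = 1} ψ = lift ρ (proj (perp A : Set (Vec n))) ψ := by
  rw [lift_proj hρ]
  congr 2
  ext x
  exact h.2 _

theorem lift_moneyProj {ρ : Fin n → B} (hρ : Function.Injective ρ) (A : Subspc n) (ψ : QState B) :
    lift ρ (moneyProj A) ψ = lift ρ (hadamardAll n) (lift ρ (proj (perp A : Set (Vec n)))
      (lift ρ (hadamardAll n) (lift ρ (proj (A : Set (Vec n))) ψ))) := by
  rw [moneyProj, verOp, lift_comp hρ, lift_comp hρ, lift_comp hρ]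
  rfl

theorem zmod_two_mul_eq_one {a b : ZMod 2} : a * b = 1 ↔ a = 1 ∧ b = 1 := by
  revert a b
  decide

theorem prod_add_one_eq_one (l : List B) (x : Bits B) :
    (l.map fun w => x w + 1).prod = 1 ↔ ∀ w ∈ l, x w = 0 := by
  have h : ∀ a : ZMod 2, a + 1 = 1 ↔ a = 0 := by decide
  induction l with
  | nil => simp
  | cons a l ih => simp [ih, h]

/-- The test for the money state on one register. -/
def moneyTest (m₁ m₂ : Bits S → Vec n → ZMod 2) : TestData S (Fin n) where
  fst := m₁
  snd := m₂
  layer := hadamardCircuit n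

theorem moneyTest_op {s : Bits S} {A : Subspc n} (h : Hides m₁ m₂ s A) :
    (moneyTest m₁ m₂).op s = moneyProj A := by
  refine LinearMap.ext fun ψ => ?_
  have h1 : {x | m₁ s x = 1} = (A : Set (Vec n)) := by
    ext x
    exact h.1 x
  have h2 : {x | m₂ s x = 1} = (perp A : Set (Vec n)) := by
    ext x
    exact h.2 x
  simp only [TestData.op, moneyTest, lin_hadamardCircuit, h1, h2]
  rfl

theorem moneyTest_valid {c : ℕ}
    (h₁ : Computable c fun x : Bits (S ⊕ Fin n) => m₁ (x ∘ .inl) (x ∘ .inr))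
    (h₂ : Computable c fun x : Bits (S ⊕ Fin n) => m₂ (x ∘ .inl) (x ∘ .inr)) :
    (moneyTest m₁ m₂).Valid (hidingSet m₁ m₂) c where
  layer_layer ψ := by
    simp only [moneyTest, lin_hadamardCircuit, hadamardAll_hadamardAll]
  proj_op s hs ψ := by
    obtain ⟨A, hA⟩ := hs
    rw [moneyTest_op hA]
    have h1 : {x | (moneyTest m₁ m₂).fst s x = 1} = (A : Set (Vec n)) := by
      ext x
      exact hA.1 x
    rw [h1, proj_moneyProj]
  computable_fst := h₁
  computable_snd := h₂

/-- The test for the zero state on one register. -/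
def zeroTest (S : Type) (n : ℕ) : TestData S (Fin n) where
  fst _ x := ((List.finRange n).map fun i => x i + 1).prod
  snd _ _ := 1
  layer := []

theorem zeroTest_op (s : Bits S) (ψ : QState (Fin n)) :
    (zeroTest S n).op s ψ = herm (Pi.single 0 1) ψ • (Pi.single 0 1 : QState (Fin n)) := by
  funext x
  have h1 : ∀ x : Vec n, (zeroTest S n).fst s x = 1 ↔ x = 0 := by
    intro x
    rw [zeroTest, prod_add_one_eq_one, funext_iff]
    simp
  have h2 : herm (Pi.single 0 1) ψ = ψ 0 := by
    rw [herm, Finset.sum_eq_single 0]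
    · simp
    · intro y _ hy
      simp [hy]
    · simp
  have h3 : (zeroTest S n).op s ψ = proj {x | (zeroTest S n).fst s x = 1} ψ := by
    simp only [TestData.op, LinearMap.comp_apply, Circuit.lin_apply]
    simp only [zeroTest, Circuit.run_nil, proj_inter]
    simp
  rw [h3, h2, proj_apply]
  by_cases hx : x = 0
  · subst hx
    rw [Set.indicator_of_mem (by exact (h1 0).2 rfl)]
    simp
  · rw [Set.indicator_of_notMem (by exact fun h => hx ((h1 x).1 h))]
    simp [hx]

theorem zeroTest_valid (G : Set (Bits S)) : (zeroTest S n).Valid G (4 * n + 1) where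
  layer_layer ψ := rfl
  proj_op s hs ψ := by
    simp only [TestData.op, LinearMap.comp_apply, Circuit.lin_apply]
    simp only [zeroTest, Circuit.run_nil, proj_inter]
    congr 2
    ext x
    simp
  computable_fst := by
    have := (Computable.allZero (List.finRange n)).comp (.inr : Fin n → S ⊕ Fin n)
    simpa [zeroTest] using this
  computable_snd := Computable.one.mono (by omega)

variable {ρ σ : Fin n → B}

/-- The test for the money state on two registers. -/
def pairTest (m₁ m₂ : Bits S → Vec n → ZMod 2) (hρ : Function.Injective ρ)
    (hσ : Function.Injective σ) : TestData S B where
  fst s x := m₁ s (x ∘ ρ) * m₁ s (x ∘ σ)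
  snd s x := m₂ s (x ∘ ρ) * m₂ s (x ∘ σ)
  layer := Circuit.map ρ hρ (hadamardCircuit n) ++ Circuit.map σ hσ (hadamardCircuit n)

theorem lin_pairTest_layer (hρ : Function.Injective ρ) (hσ : Function.Injective σ) (ψ : QState B) :
    Circuit.lin (pairTest m₁ m₂ hρ hσ).layer ψ =
      lift σ (hadamardAll n) (lift ρ (hadamardAll n) ψ) := by
  rw [Circuit.lin_apply, pairTest, Circuit.run_append, Circuit.run_map, Circuit.run_map,
    lin_hadamardCircuit]

theorem Hides.proj_pair_fst {s : Bits S} {A : Subspc n} (h : Hides m₁ m₂ s A)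
    (hρ : Function.Injective ρ) (hσ : Function.Injective σ) (ψ : QState B) :
    proj {x | (pairTest m₁ m₂ hρ hσ).fst s x = 1} ψ =
      lift ρ (proj (A : Set (Vec n))) (lift σ (proj (A : Set (Vec n))) ψ) := by
  rw [← h.proj_fst ρ hρ, ← h.proj_fst σ hσ, proj_inter]
  congr 2
  ext x
  exact zmod_two_mul_eq_one

theorem Hides.proj_pair_snd {s : Bits S} {A : Subspc n} (h : Hides m₁ m₂ s A)
    (hρ : Function.Injective ρ) (hσ : Function.Injective σ) (ψ : QState B) :
    proj {x | (pairTest m₁ m₂ hρ hσ).snd s x = 1} ψ =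
      lift ρ (proj (perp A : Set (Vec n))) (lift σ (proj (perp A : Set (Vec n))) ψ) := by
  rw [← h.proj_snd ρ hρ, ← h.proj_snd σ hσ, proj_inter]
  congr 2
  ext x
  exact zmod_two_mul_eq_one

/-- Operators on disjoint registers commute, so the factors of the joint test can be sorted into one
money test for each register. -/
theorem pairTest_op {s : Bits S} {A : Subspc n} (h : Hides m₁ m₂ s A)
    (hρ : Function.Injective ρ) (hσ : Function.Injective σ) (hρσ : ∀ i j, ρ i ≠ σ j)
    (ψ : QState B) :
    (pairTest m₁ m₂ hρ hσ).op s ψ = lift ρ (moneyProj A) (lift σ (moneyProj A) ψ) := by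
  have hc : ∀ (T R : QState (Fin n) →ₗ[ℂ] QState (Fin n)) (ψ : QState B),
      lift σ T (lift ρ R ψ) = lift ρ R (lift σ T ψ) := fun T R ψ => lift_comm hρσ hρ hσ T R ψ
  simp only [TestData.op, LinearMap.comp_apply, h.proj_pair_fst, h.proj_pair_snd,
    lin_pairTest_layer, lift_moneyProj hρ, lift_moneyProj hσ, hc]

theorem herm_pairTest_op [Fintype B] {s : Bits S} {A : Subspc n} (h : Hides m₁ m₂ s A)
    (hρ : Function.Injective ρ) (hσ : Function.Injective σ) (hρσ : ∀ i j, ρ i ≠ σ j)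
    (ψ φ : QState B) :
    herm ((pairTest m₁ m₂ hρ hσ).op s ψ) φ = herm ψ ((pairTest m₁ m₂ hρ hσ).op s φ) := by
  rw [pairTest_op h hρ hσ hρσ, pairTest_op h hρ hσ hρσ, herm_lift_left hρ (herm_moneyProj A),
    herm_lift_left hσ (herm_moneyProj A), lift_comm hρσ hρ hσ]

theorem pairTest_valid (hρ : Function.Injective ρ) (hσ : Function.Injective σ)
    (hρσ : ∀ i j, ρ i ≠ σ j) {c : ℕ}
    (h₁ : Computable c fun x : Bits (S ⊕ Fin n) => m₁ (x ∘ .inl) (x ∘ .inr))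
    (h₂ : Computable c fun x : Bits (S ⊕ Fin n) => m₂ (x ∘ .inl) (x ∘ .inr)) :
    (pairTest m₁ m₂ hρ hσ).Valid (hidingSet m₁ m₂) (2 * c + 1) where
  layer_layer ψ := by
    rw [lin_pairTest_layer, lin_pairTest_layer, ← lift_comm hρσ hρ hσ, ← lift_comp hσ,
      ← lift_comp hρ]
    have : hadamardAll n ∘ₗ hadamardAll n = LinearMap.id :=
      LinearMap.ext fun ψ => hadamardAll_hadamardAll ψ
    rw [this, lift_id hρ, lift_id hσ]
  proj_op s hs ψ := by
    obtain ⟨A, hA⟩ := hs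
    have hp : proj (A : Set (Vec n)) ∘ₗ moneyProj A = moneyProj A :=
      LinearMap.ext fun ψ => proj_moneyProj A ψ
    rw [pairTest_op hA hρ hσ hρσ, hA.proj_pair_fst, lift_comm hρσ hρ hσ, ← lift_comp hσ,
      ← lift_comp hρ, hp]
  computable_fst :=
    ((h₁.comp (Sum.map id ρ : S ⊕ Fin n → S ⊕ B)).mul
      (h₁.comp (Sum.map id σ : S ⊕ Fin n → S ⊕ B))).mono (by omega)
  computable_snd :=
    ((h₂.comp (Sum.map id ρ : S ⊕ Fin n → S ⊕ B)).mul
      (h₂.comp (Sum.map id σ : S ⊕ Fin n → S ⊕ B))).mono (by omega)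

/-- The test for the money state on one register and zeros on the wires `l`. -/
def startTest (m₁ m₂ : Bits S → Vec n → ZMod 2) (hρ : Function.Injective ρ) (l : List B) :
    TestData S B where
  fst s x := m₁ s (x ∘ ρ) * (l.map fun w => x w + 1).prod
  snd s x := m₂ s (x ∘ ρ)
  layer := Circuit.map ρ hρ (hadamardCircuit n)

theorem Hides.proj_start_fst {s : Bits S} {A : Subspc n} (h : Hides m₁ m₂ s A)
    (hρ : Function.Injective ρ) (l : List B) (ψ : QState B) :
    proj {x | (startTest m₁ m₂ hρ l).fst s x = 1} ψ =
      lift ρ (proj (A : Set (Vec n))) (proj {x | ∀ w ∈ l, x w = 0} ψ) := by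
  rw [← h.proj_fst ρ hρ, proj_inter]
  congr 2
  ext x
  exact zmod_two_mul_eq_one.trans (and_congr Iff.rfl (prod_add_one_eq_one l x))

theorem startTest_op {s : Bits S} {A : Subspc n} (h : Hides m₁ m₂ s A)
    (hρ : Function.Injective ρ) (l : List B) (ψ : QState B) :
    (startTest m₁ m₂ hρ l).op s ψ = lift ρ (moneyProj A) (proj {x | ∀ w ∈ l, x w = 0} ψ) := by
  have h2 : ∀ ψ : QState B, proj {x | (startTest m₁ m₂ hρ l).snd s x = 1} ψ =
      lift ρ (proj (perp A : Set (Vec n))) ψ := h.proj_snd ρ hρ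
  have h3 : Circuit.lin (startTest m₁ m₂ hρ l).layer = lift ρ (hadamardAll n) :=
    lin_map_hadamardCircuit hρ
  simp only [TestData.op, LinearMap.comp_apply, h.proj_start_fst, h2, h3, lift_moneyProj hρ]

theorem startTest_valid (hρ : Function.Injective ρ) {l : List B} (hl : ∀ i, ρ i ∉ l) {c : ℕ}
    (h₁ : Computable c fun x : Bits (S ⊕ Fin n) => m₁ (x ∘ .inl) (x ∘ .inr))
    (h₂ : Computable c fun x : Bits (S ⊕ Fin n) => m₂ (x ∘ .inl) (x ∘ .inr)) :
    (startTest m₁ m₂ hρ l).Valid (hidingSet m₁ m₂) (c + 4 * l.length + 2) where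
  layer_layer ψ := by
    have : hadamardAll n ∘ₗ hadamardAll n = LinearMap.id :=
      LinearMap.ext fun ψ => hadamardAll_hadamardAll ψ
    rw [startTest, lin_map_hadamardCircuit, ← lift_comp hρ, this, lift_id hρ]
  proj_op s hs ψ := by
    obtain ⟨A, hA⟩ := hs
    have hp : proj (A : Set (Vec n)) ∘ₗ moneyProj A = moneyProj A :=
      LinearMap.ext fun ψ => proj_moneyProj A ψ
    have hZ : ∀ (y : Vec n) (x : Bits B), Function.extend ρ y x ∈ {x : Bits B | ∀ w ∈ l, x w = 0} ↔
        x ∈ {x : Bits B | ∀ w ∈ l, x w = 0} := by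
      intro y x
      refine forall₂_congr fun w hw => ?_
      rw [Function.extend_apply']
      rintro ⟨i, rfl⟩
      exact hl i hw
    rw [startTest_op hA, hA.proj_start_fst, ← lift_proj_comm _ hZ, proj_proj, ← lift_comp hρ,
      hp]
  computable_fst :=
    ((h₁.comp (Sum.map id ρ : S ⊕ Fin n → S ⊕ B)).mul
      ((Computable.allZero l).comp (.inr : B → S ⊕ B))).mono (by omega)
  computable_snd := (h₂.comp (Sum.map id ρ : S ⊕ Fin n → S ⊕ B)).mono (by omega)

open Classical in
/-- The state `ψ` of one register when all other wires are zero. -/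
def alone (ρ : Fin n → B) (ψ : QState (Fin n)) : QState B := fun x =>
  if ∀ w, (¬ ∃ i, ρ i = w) → x w = 0 then ψ (x ∘ ρ) else 0

theorem sum_alone [Fintype B] {M : Type} [AddCommMonoid M] (hρ : Function.Injective ρ)
    (ψ : QState (Fin n)) (F : Bits B → ℂ → M) (hF : ∀ x, F x 0 = 0) :
    ∑ x : Bits B, F x (alone ρ ψ x) = ∑ y : Vec n, F (Function.extend ρ y 0) (ψ y) := by
  symm
  refine Finset.sum_of_injOn (fun y => Function.extend ρ y 0) ?_ (by simp) ?_ ?_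
  · intro y _ y' _ h
    rw [← extend_comp_self hρ y 0, ← extend_comp_self hρ y' 0]
    exact congrArg (· ∘ ρ) h
  · intro x _ hx
    rw [alone, if_neg, hF]
    intro h
    refine hx ⟨x ∘ ρ, by simp, ?_⟩
    change Function.extend ρ (x ∘ ρ) 0 = x
    conv_rhs => rw [← extend_self hρ x]
    exact extend_congr hρ _ fun w hw => (h w hw).symm
  · intro y _
    rw [alone, if_pos, extend_comp_self hρ]
    intro w hw
    exact Function.extend_apply' _ _ _ hw

theorem normSq_alone [Fintype B] (hρ : Function.Injective ρ) (ψ : QState (Fin n)) :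
    normSq (alone ρ ψ) = normSq ψ :=
  sum_alone hρ ψ (fun _ a => ‖a‖ ^ 2) (by simp)

/-- When `l` lists all wires outside the register, the test is the projection to the single vector
|A⟩|0⟩. The amplification of a copying stage needs the reflection about exactly this start state. -/
theorem startTest_op_eq [Fintype B] {s : Bits S} {A : Subspc n} (h : Hides m₁ m₂ s A)
    (hρ : Function.Injective ρ) {l : List B} (hl : ∀ w, w ∈ l ↔ ¬ ∃ i, ρ i = w) (ψ : QState B) :
    (startTest m₁ m₂ hρ l).op s ψ =
      herm (alone ρ (subspaceState A)) ψ • alone ρ (subspaceState A) := by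
  have hh : herm (alone ρ (subspaceState A)) ψ =
      herm (subspaceState A) (slice ρ 0 ψ) := by
    rw [herm, sum_alone hρ _ (fun x a => (starRingEnd ℂ) a * ψ x) (by simp)]
    rfl
  rw [startTest_op h, hh]
  funext x
  rw [lift_apply, moneyProj, verOp_eq, Pi.smul_apply, Pi.smul_apply, smul_eq_mul, smul_eq_mul,
    alone]
  by_cases hx : ∀ w, (¬ ∃ i, ρ i = w) → x w = 0
  · rw [if_pos hx]
    congr 2
    funext y
    have h0 : Function.extend ρ y x = Function.extend ρ y 0 :=
      extend_congr hρ y fun w hw => hx w hw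
    rw [slice_apply, slice_apply, proj_apply, h0, Set.indicator_of_mem]
    intro w hw
    exact Function.extend_apply' _ _ _ ((hl w).1 hw)
  · rw [if_neg hx]
    have h0 : slice ρ x (proj {x | ∀ w ∈ l, x w = 0} ψ) = 0 := by
      funext y
      rw [slice_apply, proj_apply, Set.indicator_of_notMem]
      · rfl
      · intro h'
        refine hx fun w hw => ?_
        rw [← h' w ((hl w).2 hw), Function.extend_apply' _ _ _ hw]
    rw [h0]
    simp [herm]

end Tests

/-! ### Copying the serial number -/

section Serial

variable {S B : Type} [DecidableEq S] [DecidableEq B]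

/-- The operator that adds the serial number to the wires `ι`. -/
def addSerial (ι : S → B) (s : Bits S) : QState B →ₗ[ℂ] QState B :=
  LinearMap.funLeft ℂ ℂ fun x => x + Function.extend ι s 0

theorem addSerial_apply (ι : S → B) (s : Bits S) (ψ : QState B) (x : Bits B) :
    addSerial ι s ψ x = ψ (x + Function.extend ι s 0) := rfl

theorem addSerial_addSerial (ι : S → B) (s : Bits S) (ψ : QState B) :
    addSerial ι s (addSerial ι s ψ) = ψ := by
  funext x
  rw [addSerial_apply, addSerial_apply]
  congr 1
  funext b
  simp only [Pi.add_apply, add_assoc, zmod_two_add_self, add_zero]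

/-- The serial number is added bit by bit; one bit has a program of length one and therefore costs 4
· 1 + 1 gates. -/
theorem Implements.addSerial [Fintype S] {G : Set (Bits S)} {p : ℕ} (hp : 1 ≤ p) {ι : S → B}
    (hι : Function.Injective ι) :
    Implements G p (5 * Fintype.card S) (fun s => HiddenSubspace.addSerial ι s) := by
  have key : ∀ l : List S, l.Nodup → Implements G p (5 * l.length)
      (fun s => LinearMap.funLeft ℂ ℂ fun x : Bits B => x + Function.extend ι (fun i =>
        if i ∈ l then s i else 0) 0) := by
    intro l hl
    induction l with
    | nil =>
      refine Implements.refl.congr fun s _ ψ => ?_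
      funext x
      change ψ x = ψ (x + _)
      congr 1
      funext b
      by_cases hb : ∃ i, ι i = b
      · obtain ⟨i, rfl⟩ := hb
        simp [hι.extend_apply]
      · simp [Function.extend_apply' _ _ _ hb]
    | cons a l ih =>
      have ha : a ∉ l := (List.nodup_cons.1 hl).1
      have h1 : Implements G p 5 (fun s => xorOp (ι a) fun _ : Bits B => s a) :=
        Implements.xor (V := Empty) (f := fun s _ => s a) (c := 1)
          (Computable.var (.inl a : S ⊕ Empty)) (fun v => v.elim) (ι a) (fun v => v.elim) hp le_rfl
      refine (((ih (List.nodup_cons.1 hl).2).comp h1).mono le_rfl (by simp; omega)).congr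
        fun s _ ψ => ?_
      funext x
      change ψ (Function.update (x + _) (ι a) ((x + _) (ι a) + s a)) = ψ (x + _)
      congr 1
      funext b
      by_cases hb : ∃ i, ι i = b
      · obtain ⟨i, rfl⟩ := hb
        by_cases hi : i = a
        · subst hi
          simp [hι.extend_apply, ha]
        · rw [Function.update_of_ne (hι.ne hi)]
          simp [hι.extend_apply, hi]
      · rw [Function.update_of_ne fun h => hb ⟨a, h.symm⟩]
        simp [Function.extend_apply' _ _ _ hb]
  refine ((key Finset.univ.toList (Finset.nodup_toList _)).mono le_rfl (by simp)).congr
    fun s _ ψ => ?_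
  simp only [Finset.mem_toList, Finset.mem_univ, if_true]
  rfl

end Serial

theorem TestData.Valid.mono {S B : Type} [DecidableEq S] [DecidableEq B] {D : TestData S B}
    {G : Set (Bits S)} {c c' : ℕ} (h : D.Valid G c) (hc : c ≤ c') : D.Valid G c' :=
  ⟨h.layer_layer, h.proj_op, h.computable_fst.mono hc, h.computable_snd.mono hc⟩

/-! ### The initial stage and the copying stage. -/

section Stages

variable {S : Type} [Fintype S] [DecidableEq S] {n : ℕ} {m₁ m₂ : Bits S → Vec n → ZMod 2} {c : ℕ}

theorem normSq_moneyProj (A : Subspc n) (ψ : QState (Fin n)) :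
    normSq (moneyProj A ψ) = ‖herm (subspaceState A) ψ‖ ^ 2 := by
  rw [moneyProj, verOp_eq, normSq_smul, normSq_subspaceState, mul_one]

/-- The uniform superposition has overlap √(|A| / 2^n) with |A⟩. This is the only place where the
finder has to be lucky; for dimension n/2 the probability is 2^(-n/2). -/
theorem normSq_moneyProj_hadamardAll (A : Subspc n) :
    normSq (moneyProj A (hadamardAll n (Pi.single 0 1))) = (Nat.card A : ℝ) / 2 ^ n := by
  classical
  have hA : (0 : ℝ) < Nat.card A := by exact_mod_cast Nat.card_pos
  have h1 : ∀ x, hadamardAll n (Pi.single 0 1) x = ((1 / Real.sqrt (2 ^ n) : ℝ) : ℂ) := by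
    intro x
    simp only [hadamardAll, LinearMap.coe_mk, AddHom.coe_mk]
    rw [Finset.sum_eq_single 0]
    · simp [sgn_zero]
    · intro y _ hy
      simp [hy]
    · simp
  have h2 : herm (subspaceState A) (hadamardAll n (Pi.single 0 1)) =
      ((Nat.card A * (1 / Real.sqrt (Nat.card A) * (1 / Real.sqrt (2 ^ n))) : ℝ) : ℂ) := by
    simp only [herm, h1, subspaceState_apply]
    have : ∀ x : Vec n, (starRingEnd ℂ) (if x ∈ A then 1 / (Real.sqrt (Nat.card A) : ℂ) else 0) *
        ((1 / Real.sqrt (2 ^ n) : ℝ) : ℂ) = if x ∈ A then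
          ((1 / Real.sqrt (Nat.card A) * (1 / Real.sqrt (2 ^ n)) : ℝ) : ℂ) else 0 := by
      intro x
      split_ifs
      · push_cast
        rw [map_div₀, map_one, Complex.conj_ofReal]
      · simp
    simp only [this]
    rw [← Finset.sum_filter, Finset.sum_const, nsmul_eq_mul, ← Fintype.card_subtype,
      ← Nat.card_eq_fintype_card]
    push_cast
    rfl
  rw [normSq_moneyProj, h2, Complex.norm_real, Real.norm_eq_abs, sq_abs]
  have h3 := Real.sq_sqrt hA.le
  have h4 : Real.sqrt (2 ^ n) ^ 2 = 2 ^ n := Real.sq_sqrt (by positivity)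
  rw [mul_pow, mul_pow, div_pow, div_pow, h3, h4]
  field_simp

/-- From the zero state, the money state is found with a probability that is proportional to the
number of rounds. -/
theorem exists_initOp
    (h₁ : Computable c fun x : Bits (S ⊕ Fin n) => m₁ (x ∘ .inl) (x ∘ .inr))
    (h₂ : Computable c fun x : Bits (S ⊕ Fin n) => m₂ (x ∘ .inl) (x ∘ .inr)) (T : ℕ) :
    ∃ I : Bits S → QState (Fin n ⊕ Fin (T + 1)) →ₗ[ℂ] QState (Fin n ⊕ Fin (T + 1)),
      Implements (hidingSet m₁ m₂) (c + 4 * n + 9) ((T + 1) * (36 * c + 152 * n + 336)) I ∧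
      ∀ s A, Hides m₁ m₂ s A →
        normSq (proj {x | x (.inr (Fin.last T)) = 1} (I s (withFlags T (Pi.single 0 1)))) =
          1 - (1 - Nat.card A / 2 ^ n) * (1 - 2 * (Nat.card A / 2 ^ n)) ^ (2 * T) ∧
        ∀ z, moneyProj A (part z (proj {x | x (.inr (Fin.last T)) = 1}
          (I s (withFlags T (Pi.single 0 1))))) =
            part z (proj {x | x (.inr (Fin.last T)) = 1} (I s (withFlags T (Pi.single 0 1)))) := by
  have hU : Implements (hidingSet m₁ m₂) (c + 4 * n + 9) n (fun _ => hadamardAll n) := by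
    have := Implements.circuit (S := S) (G := hidingSet m₁ m₂) (p := c + 4 * n + 9)
      (hadamardCircuit n)
    rwa [length_hadamardCircuit, lin_hadamardCircuit] at this
  have hA := (moneyTest_valid h₁ h₂).mono (show c ≤ c + 4 * n + 1 by omega)
  have hD := (zeroTest_valid (n := n) (hidingSet m₁ m₂)).mono
    (show 4 * n + 1 ≤ c + 4 * n + 1 by omega)
  have hAL : (moneyTest m₁ m₂).layer.length ≤ n := (length_hadamardCircuit n).le
  have hDL : (zeroTest S n).layer.length ≤ n := Nat.zero_le _
  have hp : c + 4 * n + 1 + 8 ≤ c + 4 * n + 9 := by omega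
  refine ⟨_, (Implements.amplify hp hU hU hA hD hAL hDL T T).mono le_rfl
    (Nat.mul_le_mul_left _ (by omega)), fun s A hs => ?_⟩
  have h := amplify_spec hp hU hU hA hD hAL hDL T (s := s) ⟨A, hs⟩
    (fun ψ => hadamardAll_hadamardAll ψ)
    (by rw [moneyTest_op hs]; exact herm_moneyProj A) (v := Pi.single 0 1)
    (by
      rw [normSq, Finset.sum_eq_single 0]
      · simp
      · intro y _ hy
        simp [hy]
      · simp)
    (zeroTest_op s) rfl
  rw [moneyTest_op hs, normSq_moneyProj_hadamardAll] at h
  rw [moneyTest_op hs]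
  exact h

/-- The first output register of a counterfeiter. -/
def firstReg (S : Type) (n a : ℕ) : Fin n → CopyWire S n a := fun j => .inr (.inl j)

/-- The second output register of a counterfeiter. -/
def secondReg (S : Type) (n a : ℕ) : Fin n → CopyWire S n a := fun j => .inr (.inr (.inl j))

theorem firstReg_injective (S : Type) (n a : ℕ) : Function.Injective (firstReg S n a) :=
  Sum.inr_injective.comp Sum.inl_injective

theorem secondReg_injective (S : Type) (n a : ℕ) : Function.Injective (secondReg S n a) :=
  Sum.inr_injective.comp (Sum.inr_injective.comp Sum.inl_injective)

theorem firstReg_ne_secondReg (S : Type) (n a : ℕ) (i j : Fin n) :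
    firstReg S n a i ≠ secondReg S n a j := by
  simp [firstReg, secondReg]

theorem onFirst_eq_lift {a : ℕ} (V : QState (Fin n) →ₗ[ℂ] QState (Fin n))
    (φ : QState (CopyWire S n a)) : onFirst V φ = lift (firstReg S n a) V φ := by
  funext x
  rw [onFirst, lift_apply]
  have : slice (firstReg S n a) x φ = fun y => φ (Sum.elim (fun i => x (.inl i))
      (Sum.elim y (fun l => x (.inr (.inr l))))) := by
    funext y
    rw [slice_apply]
    congr 1
    funext w
    rcases w with w | w | w
    · exact Function.extend_apply' _ _ _ (by simp [firstReg])
    · exact (firstReg_injective S n a).extend_apply y x w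
    · exact Function.extend_apply' _ _ _ (by simp [firstReg])
  rw [this]
  rfl

theorem onSecond_eq_lift {a : ℕ} (V : QState (Fin n) →ₗ[ℂ] QState (Fin n))
    (φ : QState (CopyWire S n a)) : onSecond V φ = lift (secondReg S n a) V φ := by
  funext x
  rw [onSecond, lift_apply]
  have : slice (secondReg S n a) x φ = fun y => φ (Sum.elim (fun i => x (.inl i))
      (Sum.elim (fun j => x (.inr (.inl j))) (Sum.elim y (fun l => x (.inr (.inr (.inr l))))))) := by
    funext y
    rw [slice_apply]
    congr 1
    funext w
    rcases w with w | w | w | w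
    · exact Function.extend_apply' _ _ _ (by simp [secondReg])
    · exact Function.extend_apply' _ _ _ (by simp [secondReg])
    · exact (secondReg_injective S n a).extend_apply y x w
    · exact Function.extend_apply' _ _ _ (by simp [secondReg])
  rw [this]
  rfl

/-- The counterfeiter may alter its serial number, so it gets a private copy. Counting the copying
as part of the preparation makes the start state |A⟩|0⟩ with zeros on all other wires. -/
theorem addSerial_alone {a : ℕ} (s : Bits S) (ψ : QState (Fin n)) :
    addSerial (.inl : S → CopyWire S n a) s (alone (firstReg S n a) ψ) = copyInput s ψ := by
  funext x
  rw [addSerial_apply, alone, copyInput]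
  have h0 : ∀ i, (x + Function.extend (Sum.inl : S → CopyWire S n a) s 0) (.inl i) =
      x (.inl i) + s i := fun i => by
    rw [Pi.add_apply, Sum.inl_injective.extend_apply]
  have h1 : ∀ j, (x + Function.extend (Sum.inl : S → CopyWire S n a) s 0) (.inr j) =
      x (.inr j) := fun j => by
    rw [Pi.add_apply, Function.extend_apply' _ _ _ (by simp)]
    simp
  have h2 : ∀ a b : ZMod 2, a + b = 0 ↔ a = b := by decide
  have hiff : (∀ w, (¬ ∃ i, firstReg S n a i = w) →
      (x + Function.extend (Sum.inl : S → CopyWire S n a) s 0) w = 0) ↔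
      (∀ i, x (.inl i) = s i) ∧ (∀ j, x (.inr (.inr (.inl j))) = 0) ∧
      (∀ l, x (.inr (.inr (.inr l))) = 0) := by
    constructor
    · intro h
      refine ⟨fun i => (h2 _ _).1 ?_, fun j => ?_, fun l => ?_⟩
      · rw [← h0]
        exact h _ (by simp [firstReg])
      · rw [← h1]
        exact h _ (by simp [firstReg])
      · rw [← h1]
        exact h _ (by simp [firstReg])
    · rintro ⟨ha, hb, hc⟩ (w | w | w | w) hw
      · rw [h0, (h2 _ _).2 (ha w)]
      · exact absurd ⟨w, rfl⟩ hw
      · rw [h1, hb]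
      · rw [h1, hc]
  have hreg : (x + Function.extend (Sum.inl : S → CopyWire S n a) s 0) ∘ firstReg S n a =
      fun j => x (.inr (.inl j)) := by
    funext j
    exact h1 _
  by_cases h : ∀ w, (¬ ∃ i, firstReg S n a i = w) →
      (x + Function.extend (Sum.inl : S → CopyWire S n a) s 0) w = 0
  · rw [if_pos h, if_pos (hiff.1 h), hreg]
  · rw [if_neg h, if_neg fun h' => h (hiff.2 h')]

/-- The amplified counterfeiter: from one money state it makes two with high probability. -/
theorem exists_copyOp
    (h₁ : Computable c fun x : Bits (S ⊕ Fin n) => m₁ (x ∘ .inl) (x ∘ .inr))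
    (h₂ : Computable c fun x : Bits (S ⊕ Fin n) => m₂ (x ∘ .inl) (x ∘ .inr)) {a : ℕ}
    (C : Circuit (CopyWire S n a)) (T : ℕ) :
    ∃ K : Bits S → QState (CopyWire S n a ⊕ Fin (T + 1)) →ₗ[ℂ]
        QState (CopyWire S n a ⊕ Fin (T + 1)),
      Implements (hidingSet m₁ m₂) (2 * c + 4 * (Fintype.card S + 2 * n + a) + 10)
        ((T + 1) * (14 * C.length + 72 * c + 154 * Fintype.card S + 300 * n + 144 * a + 372)) K ∧
      ∀ s A, Hides m₁ m₂ s A → ∀ q, normSq (onFirst (moneyProj A) (onSecond (moneyProj A)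
          (Circuit.run C (copyInput s (subspaceState A))))) = q →
        normSq (proj {x | x (.inr (Fin.last T)) = 1}
          (K s (withFlags T (alone (firstReg S n a) (subspaceState A))))) =
            1 - (1 - q) * (1 - 2 * q) ^ (2 * T) ∧
        ∀ z, lift (firstReg S n a) (moneyProj A) (lift (secondReg S n a) (moneyProj A)
          (part z (proj {x | x (.inr (Fin.last T)) = 1}
            (K s (withFlags T (alone (firstReg S n a) (subspaceState A))))))) =
          part z (proj {x | x (.inr (Fin.last T)) = 1}
            (K s (withFlags T (alone (firstReg S n a) (subspaceState A))))) := by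
  classical
  set N := Fintype.card S + 2 * n + a with hN
  set p := 2 * c + 4 * N + 10 with hp0
  set G := hidingSet m₁ m₂ with hG
  -- All wires other than the first register, which the start test requires to be zero.
  let l : List (CopyWire S n a) :=
    (Finset.univ.filter fun w => ¬ ∃ i, firstReg S n a i = w).toList
  have hl : ∀ w, w ∈ l ↔ ¬ ∃ i, firstReg S n a i = w := by simp [l]
  have hlN : l.length ≤ N := by
    rw [Finset.length_toList]
    refine (Finset.card_le_univ _).trans ?_
    simp [Fintype.card_sum]
    omega
  have hX : Implements G p (5 * Fintype.card S)
      (fun s => addSerial (.inl : S → CopyWire S n a) s) :=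
    Implements.addSerial (by omega) Sum.inl_injective
  have hU : Implements G p (5 * Fintype.card S + 7 * C.length)
      (fun s => Circuit.lin C ∘ₗ addSerial (.inl : S → CopyWire S n a) s) :=
    ((Implements.circuit C).comp hX).mono le_rfl (by omega)
  -- A phase gate is inverted by seven gates, hence the factor 7. The same bound is used for the
  -- forward direction, since `Implements.amplify` takes one bound for both.
  have hV : Implements G p (5 * Fintype.card S + 7 * C.length)
      (fun s => addSerial (.inl : S → CopyWire S n a) s ∘ₗ Circuit.lin (Circuit.inv C)) :=
    (hX.comp (Implements.circuit _)).mono le_rfl (by have := Circuit.length_inv C; omega)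
  have hA := (pairTest_valid (firstReg_injective S n a) (secondReg_injective S n a)
    (firstReg_ne_secondReg S n a) h₁ h₂).mono (show 2 * c + 1 ≤ 2 * c + 4 * N + 2 by omega)
  have hD := (startTest_valid (firstReg_injective S n a) (l := l)
    (fun i h => (hl _).1 h ⟨i, rfl⟩) h₁ h₂).mono
    (show c + 4 * l.length + 2 ≤ 2 * c + 4 * N + 2 by omega)
  have hAL : (pairTest m₁ m₂ (firstReg_injective S n a) (secondReg_injective S n a)).layer.length
      ≤ 2 * n := by
    rw [pairTest, List.length_append, Circuit.length_map, Circuit.length_map,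
      length_hadamardCircuit]
    omega
  have hDL : (startTest m₁ m₂ (firstReg_injective S n a) l).layer.length ≤ 2 * n := by
    rw [startTest, Circuit.length_map, length_hadamardCircuit]
    omega
  have hp : 2 * c + 4 * N + 2 + 8 ≤ p := by omega
  refine ⟨_, (Implements.amplify hp hU hV hA hD hAL hDL T T).mono le_rfl
    (Nat.mul_le_mul_left _ (by omega)), fun s A hs q hq => ?_⟩
  have h := amplify_spec hp hU hV hA hD hAL hDL T (s := s) ⟨A, hs⟩
    (by
      intro ψ
      simp only [LinearMap.comp_apply]
      rw [addSerial_addSerial, Circuit.lin_apply, Circuit.lin_apply, Circuit.run_run_inv])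
    (herm_pairTest_op hs _ _ (firstReg_ne_secondReg S n a))
    (v := alone (firstReg S n a) (subspaceState A))
    (by rw [normSq_alone (firstReg_injective S n a), normSq_subspaceState])
    (startTest_op_eq hs _ hl) (q := q)
    (by
      rw [pairTest_op hs _ _ (firstReg_ne_secondReg S n a), LinearMap.comp_apply, addSerial_alone,
        Circuit.lin_apply, ← onSecond_eq_lift, ← onFirst_eq_lift, hq])
  refine ⟨h.1, fun z => ?_⟩
  have := h.2 z
  rw [pairTest_op hs _ _ (firstReg_ne_secondReg S n a)] at this
  exact this

end Stages

/-! ### Composition of amplified stages -/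

section Compose

variable {V U W : Type} [Fintype V] [DecidableEq V] [Fintype U] [DecidableEq U] [Fintype W]
  [DecidableEq W] {n T : ℕ}

theorem lift_eq_self_iff {e : V → W} (he : Function.Injective e) (R : QState V →ₗ[ℂ] QState V)
    (φ : QState W) : lift e R φ = φ ↔ ∀ x, R (slice e x φ) = slice e x φ := by
  constructor
  · intro h x
    rw [← slice_lift he, h]
  · intro h
    funext x
    rw [lift_apply, h, slice_apply, extend_self he]

theorem moneyProj_moneyProj (A : Subspc n) (ψ : QState (Fin n)) :
    moneyProj A (moneyProj A ψ) = moneyProj A ψ := by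
  have h1 : herm (subspaceState A) (subspaceState A) = 1 := by
    rw [← normSq_eq_herm, normSq_subspaceState, Complex.ofReal_one]
  rw [moneyProj, verOp_eq A (verOp _ _ ψ), verOp_eq A ψ, herm_smul_right, h1, mul_one]

theorem lift_moneyProj_idem {ρ : Fin n → W} (hρ : Function.Injective ρ) (A : Subspc n)
    (ψ : QState W) : lift ρ (moneyProj A) (lift ρ (moneyProj A) ψ) = lift ρ (moneyProj A) ψ := by
  rw [← lift_comp hρ]
  congr 2
  exact LinearMap.ext (moneyProj_moneyProj A)

/-- The register is in the range of a rank-one projection, so it factors off, and the remaining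
wires contribute only their zero string. -/
theorem eq_smul_alone {ρ : Fin n → W} (hρ : Function.Injective ρ) {A : Subspc n} {χ : QState W}
    (h : lift ρ (moneyProj A) χ = χ) (h0 : ∀ x, χ x ≠ 0 → ∀ w, (¬ ∃ i, ρ i = w) → x w = 0) :
    χ = herm (subspaceState A) (slice ρ 0 χ) • alone ρ (subspaceState A) := by
  funext x
  rw [Pi.smul_apply, alone, smul_eq_mul]
  by_cases hx : ∀ w, (¬ ∃ i, ρ i = w) → x w = 0
  · rw [if_pos hx]
    have hs : slice ρ x χ = slice ρ 0 χ := by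
      funext y
      rw [slice_apply, slice_apply, extend_congr hρ y (x := x) (x' := 0) hx]
    conv_lhs => rw [← h]
    rw [lift_apply, hs, moneyProj, verOp_eq, Pi.smul_apply, smul_eq_mul]
  · rw [if_neg hx, mul_zero]
    by_contra hne
    exact hx (h0 x hne)

theorem withFlags_alone (ρ : Fin n → V) (ψ : QState (Fin n)) :
    withFlags T (alone ρ ψ) = alone (Sum.inl ∘ ρ : Fin n → V ⊕ Fin (T + 1)) ψ := by
  funext x
  simp only [withFlags, alone]
  by_cases h : x ∘ .inr = 0
  · rw [if_pos h]
    by_cases h' : ∀ w, (¬ ∃ i, ρ i = w) → (x ∘ .inl) w = 0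
    · rw [if_pos h', if_pos]
      · rfl
      · rintro (w | w) hw
        · exact h' w fun ⟨i, hi⟩ => hw ⟨i, congrArg _ hi⟩
        · exact congrFun h w
    · rw [if_neg h', if_neg]
      intro h''
      refine h' fun w hw => h'' (.inl w) ?_
      rintro ⟨i, hi⟩
      exact hw ⟨i, Sum.inl_injective hi⟩
  · rw [if_neg h, if_neg]
    intro h''
    exact h (funext fun w => h'' (.inr w) (by simp))

theorem slice_proj_flag {e : V ⊕ Fin (T + 1) → W} (he : Function.Injective e) (x : Bits W)
    (φ : QState W) : slice e x (proj {x | x (e (.inr (Fin.last T))) = 1} φ) =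
      proj {x | x (.inr (Fin.last T)) = 1} (slice e x φ) := by
  funext y
  rw [slice_apply, proj_apply, proj_apply]
  by_cases h : y (.inr (Fin.last T)) = 1
  · rw [Set.indicator_of_mem (by rwa [Set.mem_ofPred_eq, he.extend_apply]),
      Set.indicator_of_mem (by exact h), slice_apply]
  · rw [Set.indicator_of_notMem (by rwa [Set.mem_ofPred_eq, he.extend_apply]),
      Set.indicator_of_notMem (by exact h)]

/-- If a stage starts in a fixed state, whatever the other wires are, then so does it end. -/
theorem slice_stage {e : V ⊕ Fin (T + 1) → W} (he : Function.Injective e)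
    {v : QState V} {K : QState (V ⊕ Fin (T + 1)) →ₗ[ℂ] QState (V ⊕ Fin (T + 1))} {ψ : QState W}
    {x : Bits W} {c : ℂ} (hc : slice e x ψ = c • withFlags T v) :
    slice e x (proj {x | x (e (.inr (Fin.last T))) = 1} (lift e K ψ)) =
      c • proj {x | x (.inr (Fin.last T)) = 1} (K (withFlags T v)) := by
  rw [slice_proj_flag he, slice_lift he, hc, map_smul, map_smul]

/-- On every slice the stage starts from a multiple of the same unit vector, so its success
probability is the same factor κ on each slice. In this way the probabilities of consecutive stages
multiply. -/
theorem normSq_stage {e : V ⊕ Fin (T + 1) → W} (he : Function.Injective e)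
    {v : QState V} (hv : normSq v = 1)
    {K : QState (V ⊕ Fin (T + 1)) →ₗ[ℂ] QState (V ⊕ Fin (T + 1))} {ψ : QState W} {κ : ℝ}
    (hκ : normSq (proj {x | x (.inr (Fin.last T)) = 1} (K (withFlags T v))) = κ)
    (hc : ∀ x, ∃ c : ℂ, slice e x ψ = c • withFlags T v) :
    normSq (proj {x | x (e (.inr (Fin.last T))) = 1} (lift e K ψ)) = κ * normSq ψ := by
  refine normSq_lift_of_slices he κ fun x => ?_
  obtain ⟨c, hc⟩ := hc x
  rw [slice_stage he hc, hc, normSq_smul, normSq_smul, hκ, normSq_withFlags, hv]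
  ring

theorem eq_of_part_eq {φ χ : QState (V ⊕ Fin (T + 1))} (h : ∀ z : Bits (Fin (T + 1)), part z φ = part z χ) :
    φ = χ := by
  funext x
  have := congrFun (h (x ∘ .inr)) (x ∘ .inl)
  rw [part_apply, part_apply] at this
  rwa [Sum.elim_comp_inl_inr] at this

/-- If all slices of a state are multiples of a state that is fixed by an operator on some of the
wires, then the operator fixes the state. -/
theorem lift_eq_self_of_slice {e : V → W} (he : Function.Injective e) {d : U → V}
    (hd : Function.Injective d) {R : QState U →ₗ[ℂ] QState U} {φ : QState W} {χ : QState V}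
    (hχ : lift d R χ = χ) (h : ∀ x, ∃ c : ℂ, slice e x φ = c • χ) : lift (e ∘ d) R φ = φ := by
  rw [← lift_lift hd he, lift_eq_self_iff he]
  intro x
  obtain ⟨c, hc⟩ := h x
  rw [hc, map_smul, hχ]

end Compose

/-! ### Spanning lists of vectors -/

section Span

variable {n l : ℕ} {W : Type} [Fintype W] [DecidableEq W]

theorem moneyProj_eq_self {A : Subspc n} {ψ : QState (Fin n)} (h : moneyProj A ψ = ψ) :
    (∀ x, ψ x ≠ 0 → x ∈ A) ∧ ∀ a ∈ A, ∀ x, ψ (x + a) = ψ x := by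
  classical
  rw [moneyProj, verOp_eq] at h
  have hx : ∀ x, ψ x = herm (subspaceState A) ψ * subspaceState A x := fun x => by
    conv_lhs => rw [← h]
    rfl
  constructor
  · intro x hne
    by_contra hxA
    exact hne (by rw [hx, subspaceState_apply, if_neg hxA, mul_zero])
  · intro a ha x
    rw [hx, hx x, subspaceState_apply, subspaceState_apply]
    by_cases hxA : x ∈ A
    · rw [if_pos hxA, if_pos (A.add_mem hxA ha)]
    · rw [if_neg hxA, if_neg fun h' => hxA ?_]
      simpa using A.sub_mem h' ha

theorem lift_moneyProj_eq_self {ρ : Fin n → W} (hρ : Function.Injective ρ) {A : Subspc n}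
    {ψ : QState W} (h : lift ρ (moneyProj A) ψ = ψ) :
    (∀ x, ψ x ≠ 0 → x ∘ ρ ∈ A) ∧ ∀ a ∈ A, ∀ x, ψ (Function.extend ρ (x ∘ ρ + a) x) = ψ x := by
  have h' := fun x => moneyProj_eq_self ((lift_eq_self_iff hρ _ _).1 h x)
  constructor
  · intro x hx
    exact (h' x).1 _ (by rwa [slice_apply, extend_self hρ])
  · intro a ha x
    have := (h' x).2 a ha (x ∘ ρ)
    rwa [slice_apply, slice_apply, extend_self hρ] at this

/-- A linear functional that is nonzero on `A` vanishes on any given `j` of the output vectors with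
probability `2 ^ (-j)`. -/
theorem sum_filter_functional {ρ : Fin l → Fin n → W} (hρ : ∀ i, Function.Injective (ρ i))
    (hd : ∀ i j r r', i ≠ j → ρ i r ≠ ρ j r') {A : Subspc n} {ψ : QState W}
    (h : ∀ i, lift (ρ i) (moneyProj A) ψ = ψ) (g : Vec n →ₗ[ZMod 2] ZMod 2) {a : Vec n}
    (ha : a ∈ A) (hga : g a = 1) (J : Finset (Fin l)) :
    2 ^ J.card * ∑ x ∈ Finset.univ.filter (fun x : Bits W => ∀ i ∈ J, g (x ∘ ρ i) = 0), ‖ψ x‖ ^ 2 =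
      normSq ψ := by
  induction J using Finset.induction_on with
  | empty => simp [normSq]
  | insert i J hi ih =>
    rw [Finset.card_insert_of_notMem hi, pow_succ, mul_assoc, ← ih]
    congr 1
    -- Translating register i by `a` keeps the amplitude and the values of g on the other registers,
    -- and exchanges g = 0 with g = 1 on register i. Each new condition therefore halves the mass.
    let s : Bits W → Bits W := fun x => Function.extend (ρ i) (x ∘ ρ i + a) x
    have hsi : ∀ x, s x ∘ ρ i = x ∘ ρ i + a := fun x => extend_comp_self (hρ i) _ _
    have hsj : ∀ x, ∀ j ∈ J, s x ∘ ρ j = x ∘ ρ j := fun x j hj =>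
      extend_comp_of_disjoint (fun u v => hd j i u v fun h => hi (h ▸ hj)) _ _
    have hss : Function.Involutive s := by
      intro x
      change Function.extend (ρ i) (s x ∘ ρ i + a) (s x) = x
      rw [hsi, extend_extend (hρ i), add_assoc]
      have : a + a = 0 := funext fun r => zmod_two_add_self _
      rw [this, add_zero, extend_self (hρ i)]
    have hψ : ∀ x, ψ (s x) = ψ x := (lift_moneyProj_eq_self (hρ i) (h i)).2 a ha
    rw [← Finset.sum_filter_add_sum_filter_not
      (Finset.univ.filter fun x : Bits W => ∀ i ∈ J, g (x ∘ ρ i) = 0) (fun x => g (x ∘ ρ i) = 0),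
      Finset.filter_filter, Finset.filter_filter, two_mul]
    have hiff : ∀ x, (∀ j ∈ insert i J, g (x ∘ ρ j) = 0) ↔
        (∀ j ∈ J, g (x ∘ ρ j) = 0) ∧ g (x ∘ ρ i) = 0 := by
      intro x
      rw [Finset.forall_mem_insert, and_comm]
    simp only [hiff]
    congr 1
    refine Finset.sum_bij (fun x _ => s x) ?_ (fun x _ y _ hxy => hss.injective hxy) ?_
      fun x _ => by rw [hψ]
    · intro x hx
      simp only [Finset.mem_filter, Finset.mem_univ, true_and] at hx ⊢
      refine ⟨fun j hj => by rw [hsj x j hj]; exact hx.1 j hj, ?_⟩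
      rw [hsi, map_add, hx.2, hga, zero_add]
      exact one_ne_zero
    · intro x hx
      simp only [Finset.mem_filter, Finset.mem_univ, true_and] at hx
      refine ⟨s x, ?_, hss x⟩
      simp only [Finset.mem_filter, Finset.mem_univ, true_and]
      refine ⟨fun j hj => by rw [hsj x j hj]; exact hx.1 j hj, ?_⟩
      rw [hsi, map_add, zmod_two_ne_zero.1 hx.2, hga]
      exact zmod_two_add_self 1

open Classical in
/-- If `l` registers are each in the money state of `A`, then the result of a measurement spans `A`
except with probability `|A| / 2 ^ l`. -/
theorem le_sum_span {ρ : Fin l → Fin n → W} (hρ : ∀ i, Function.Injective (ρ i))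
    (hd : ∀ i j r r', i ≠ j → ρ i r ≠ ρ j r') {A : Subspc n} {ψ : QState W}
    (h : ∀ i, lift (ρ i) (moneyProj A) ψ = ψ) :
    (1 - 2 ^ Module.finrank (ZMod 2) A / 2 ^ l) * normSq ψ ≤
      ∑ x ∈ Finset.univ.filter
        (fun x : Bits W => Submodule.span (ZMod 2) (Set.range fun i => x ∘ ρ i) = A), ‖ψ x‖ ^ 2 := by
  choose ext hext using fun g : A →ₗ[ZMod 2] ZMod 2 => LinearMap.exists_extend g
  have : Finite (A →ₗ[ZMod 2] ZMod 2) := Module.finite_of_finite (ZMod 2)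
  have : Fintype (A →ₗ[ZMod 2] ZMod 2) := Fintype.ofFinite _
  have hcard : Fintype.card (A →ₗ[ZMod 2] ZMod 2) = 2 ^ Module.finrank (ZMod 2) A := by
    have := Module.card_eq_pow_finrank (K := ZMod 2) (V := Module.Dual (ZMod 2) A)
    rwa [Subspace.dual_finrank_eq, ZMod.card] at this
  have hg : ∀ g : A →ₗ[ZMod 2] ZMod 2, g ≠ 0 →
      ∑ x ∈ Finset.univ.filter (fun x : Bits W => ∀ i, ext g (x ∘ ρ i) = 0), ‖ψ x‖ ^ 2 =
        normSq ψ / 2 ^ l := by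
    intro g hg0
    obtain ⟨a, ha⟩ : ∃ a, g a ≠ 0 := by
      by_contra hcon
      push Not at hcon
      exact hg0 (LinearMap.ext hcon)
    have hga : ext g a = 1 := by
      rw [← zmod_two_ne_zero.1 ha]
      exact LinearMap.congr_fun (hext g) a
    have := sum_filter_functional hρ hd h (ext g) a.2 hga Finset.univ
    simp only [Finset.mem_univ, true_imp_iff, Finset.card_univ, Fintype.card_fin] at this
    rw [eq_div_iff (by positivity), mul_comm]
    exact this
  -- Union bound: vectors of A that do not span A are killed by some nonzero functional on A. There
  -- are fewer than |A| of these, each vanishing on all the vectors with probability 2^(-l).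
  have hnon : ∑ x ∈ Finset.univ.filter
      (fun x : Bits W => ¬ Submodule.span (ZMod 2) (Set.range fun i => x ∘ ρ i) = A), ‖ψ x‖ ^ 2 ≤
        ∑ g ∈ Finset.univ.filter (fun g : A →ₗ[ZMod 2] ZMod 2 => g ≠ 0),
          ∑ x ∈ Finset.univ.filter (fun x : Bits W => ∀ i, ext g (x ∘ ρ i) = 0), ‖ψ x‖ ^ 2 := by
    simp only [Finset.sum_filter (s := (Finset.univ : Finset (Bits W)))]
    rw [Finset.sum_comm]
    refine Finset.sum_le_sum fun x _ => ?_
    have hnn : ∀ g ∈ Finset.univ.filter (fun g : A →ₗ[ZMod 2] ZMod 2 => g ≠ 0),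
        0 ≤ if ∀ i, ext g (x ∘ ρ i) = 0 then ‖ψ x‖ ^ 2 else 0 := by
      intro g _
      split_ifs <;> positivity
    by_cases hx : Submodule.span (ZMod 2) (Set.range fun i => x ∘ ρ i) = A
    · rw [if_neg (not_not.2 hx)]
      exact Finset.sum_nonneg hnn
    · rw [if_pos hx]
      by_cases hψ : ψ x = 0
      · rw [hψ]
        simp
      have hle : Submodule.span (ZMod 2) (Set.range fun i => x ∘ ρ i) ≤ A := by
        rw [Submodule.span_le]
        rintro _ ⟨i, rfl⟩
        exact (lift_moneyProj_eq_self (hρ i) (h i)).1 x hψ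
      have hlt : (Submodule.span (ZMod 2) (Set.range fun i => x ∘ ρ i)).comap A.subtype < ⊤ := by
        rw [lt_top_iff_ne_top]
        intro htop
        exact hx (le_antisymm hle (Submodule.comap_subtype_eq_top.1 htop))
      obtain ⟨g, hg0, hgk⟩ := Submodule.exists_le_ker_of_lt_top _ hlt
      have hgx : ∀ i, ext g (x ∘ ρ i) = 0 := by
        intro i
        have hmem : x ∘ ρ i ∈ Submodule.span (ZMod 2) (Set.range fun i => x ∘ ρ i) :=
          Submodule.subset_span ⟨i, rfl⟩
        have h1 := hgk (show (⟨x ∘ ρ i, hle hmem⟩ : A) ∈ _ from hmem)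
        rw [LinearMap.mem_ker, ← hext g] at h1
        exact h1
      refine le_trans (le_of_eq ?_) (Finset.single_le_sum hnn
        (show g ∈ _ from Finset.mem_filter.2 ⟨Finset.mem_univ _, hg0⟩))
      rw [if_pos hgx]
  have hsum := Finset.sum_filter_add_sum_filter_not (Finset.univ : Finset (Bits W))
    (fun x => Submodule.span (ZMod 2) (Set.range fun i => x ∘ ρ i) = A) (fun x => ‖ψ x‖ ^ 2)
  rw [Finset.sum_congr rfl fun g hg' => hg g (Finset.mem_filter.1 hg').2, Finset.sum_const,
    nsmul_eq_mul] at hnon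
  have hc : ((Finset.univ.filter fun g : A →ₗ[ZMod 2] ZMod 2 => g ≠ 0).card : ℝ) ≤
      2 ^ Module.finrank (ZMod 2) A := by
    have := Finset.card_filter_le (Finset.univ : Finset (A →ₗ[ZMod 2] ZMod 2)) (fun g => g ≠ 0)
    rw [Finset.card_univ, hcard] at this
    exact_mod_cast this
  have hnn : 0 ≤ normSq ψ / 2 ^ l := div_nonneg (normSq_nonneg _) (by positivity)
  have := mul_le_mul_of_nonneg_right hc hnn
  have hrw : (1 - 2 ^ Module.finrank (ZMod 2) A / 2 ^ l) * normSq ψ = normSq ψ -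
    2 ^ Module.finrank (ZMod 2) A * (normSq ψ / 2 ^ l) := by ring
  have hn : normSq ψ = ∑ x, ‖ψ x‖ ^ 2 := rfl
  rw [hrw]
  linarith

end Span

/-! ### The circuit that finds generators -/

section Finder

variable {S : Type} {n a T₁ T₂ : ℕ}

/-- The work wires of the circuit that finds generators: a register for the money state, flags for
the first stage, and a copy of the serial number, ancillas and flags for each other stage. -/
abbrev WorkWire (S : Type) (n a T₁ T₂ : ℕ) : Type :=
  Fin n ⊕ Fin (T₁ + 1) ⊕ (Fin n × (S ⊕ Fin a ⊕ Fin (T₂ + 1)))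

/-- The wires of the circuit that finds generators. -/
abbrev SearchWire (S : Type) (n a T₁ T₂ : ℕ) : Type := (Fin n × Fin n) ⊕ WorkWire S n a T₁ T₂

instance instDecidableEqWorkWire [DecidableEq S] : DecidableEq (WorkWire S n a T₁ T₂) :=
  inferInstanceAs (DecidableEq (_ ⊕ _))

instance instDecidableEqSearchWire [DecidableEq S] : DecidableEq (SearchWire S n a T₁ T₂) :=
  inferInstanceAs (DecidableEq (_ ⊕ _))

instance instFintypeWorkWire [Fintype S] : Fintype (WorkWire S n a T₁ T₂) :=
  inferInstanceAs (Fintype (_ ⊕ _))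

instance instFintypeSearchWire [Fintype S] : Fintype (SearchWire S n a T₁ T₂) :=
  inferInstanceAs (Fintype (_ ⊕ _))

/-- The register for the money state. -/
def mainReg (S : Type) (n a T₁ T₂ : ℕ) : Fin n → SearchWire S n a T₁ T₂ := fun r => .inr (.inl r)

/-- The output registers. -/
def outReg (S : Type) (n a T₁ T₂ : ℕ) (i : Fin n) : Fin n → SearchWire S n a T₁ T₂ :=
  fun r => .inl (i, r)

/-- The wires of the first stage. -/
def initEmb (S : Type) (n a T₁ T₂ : ℕ) : Fin n ⊕ Fin (T₁ + 1) → SearchWire S n a T₁ T₂ :=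
  Sum.elim (mainReg S n a T₁ T₂) fun f => .inr (.inr (.inl f))

/-- The wires of the stage that fills the output register `i`. -/
def copyEmb (S : Type) (n a T₁ T₂ : ℕ) (i : Fin n) :
    CopyWire S n a ⊕ Fin (T₂ + 1) → SearchWire S n a T₁ T₂ :=
  Sum.elim (Sum.elim (fun s => .inr (.inr (.inr (i, .inl s)))) (Sum.elim (mainReg S n a T₁ T₂)
    (Sum.elim (outReg S n a T₁ T₂ i) fun l => .inr (.inr (.inr (i, .inr (.inl l)))))))
    fun f => .inr (.inr (.inr (i, .inr (.inr f))))

theorem initEmb_injective : Function.Injective (initEmb S n a T₁ T₂) := by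
  rintro (x | x) (y | y) h <;> simp_all [initEmb, mainReg]

theorem copyEmb_injective (i : Fin n) : Function.Injective (copyEmb S n a T₁ T₂ i) := by
  rintro ((x | x | x | x) | x) ((y | y | y | y) | y) h <;> simp_all [copyEmb, mainReg, outReg]

theorem outReg_injective (i : Fin n) : Function.Injective (outReg S n a T₁ T₂ i) := fun x y h => by
  simpa [outReg] using h

/-- Two copying stages share only the main register. The garbage of a stage is never touched again.
-/
theorem copyEmb_disjoint {i j : Fin n} (hij : i ≠ j) (w w' : CopyWire S n a ⊕ Fin (T₂ + 1))
    (h : copyEmb S n a T₁ T₂ i w = copyEmb S n a T₁ T₂ j w') :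
    ∃ r, w = .inl (firstReg S n a r) := by
  rcases w with (x | x | x | x) | x <;> rcases w' with (y | y | y | y) | y <;>
    simp_all [copyEmb, mainReg, outReg, firstReg]

theorem copyEmb_ne_initEmb {i : Fin n} {w : CopyWire S n a ⊕ Fin (T₂ + 1)}
    (hw : ¬ ∃ r, w = .inl (firstReg S n a r)) (w' : Fin n ⊕ Fin (T₁ + 1)) :
    copyEmb S n a T₁ T₂ i w ≠ initEmb S n a T₁ T₂ w' := by
  rcases w with (x | x | x | x) | x <;> rcases w' with y | y <;>
    simp_all [copyEmb, mainReg, outReg, firstReg, initEmb]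

theorem initFlag_ne_copyEmb (i : Fin n) (f : Fin (T₁ + 1))
    (w : CopyWire S n a ⊕ Fin (T₂ + 1)) :
    initEmb S n a T₁ T₂ (.inr f) ≠ copyEmb S n a T₁ T₂ i w := by
  rcases w with (x | x | x | x) | x <;> simp [copyEmb, mainReg, outReg, initEmb]

variable [Fintype S] [DecidableEq S]

/-- The first stage, followed by the first `i` copying stages. -/
def searchOp (I : QState (Fin n ⊕ Fin (T₁ + 1)) →ₗ[ℂ] QState (Fin n ⊕ Fin (T₁ + 1)))
    (K : QState (CopyWire S n a ⊕ Fin (T₂ + 1)) →ₗ[ℂ] QState (CopyWire S n a ⊕ Fin (T₂ + 1))) :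
    ℕ → (QState (SearchWire S n a T₁ T₂) →ₗ[ℂ] QState (SearchWire S n a T₁ T₂))
  | 0 => lift (initEmb S n a T₁ T₂) I
  | i + 1 => (if h : i < n then lift (copyEmb S n a T₁ T₂ ⟨i, h⟩) K else LinearMap.id) ∘ₗ
      searchOp I K i

theorem Implements.searchOp {G : Set (Bits S)} {p l₁ l₂ : ℕ}
    {I : Bits S → QState (Fin n ⊕ Fin (T₁ + 1)) →ₗ[ℂ] QState (Fin n ⊕ Fin (T₁ + 1))}
    {K : Bits S → QState (CopyWire S n a ⊕ Fin (T₂ + 1)) →ₗ[ℂ]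
      QState (CopyWire S n a ⊕ Fin (T₂ + 1))}
    (hI : Implements G p l₁ I) (hK : Implements G p l₂ K) (i : ℕ) :
    Implements G p (l₁ + i * l₂) (fun s => HiddenSubspace.searchOp (I s) (K s) i) := by
  induction i with
  | zero => exact hI.lift initEmb_injective le_rfl (by omega)
  | succ i ih =>
    by_cases h : i < n
    · refine ((hK.lift (copyEmb_injective ⟨i, h⟩) le_rfl le_rfl).comp ih).mono le_rfl
        (by rw [add_mul]; omega) |>.congr fun s _ ψ => ?_
      rw [HiddenSubspace.searchOp, dif_pos h]
    · refine (ih.mono le_rfl (by rw [add_mul]; omega)).congr fun s _ ψ => ?_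
      rw [HiddenSubspace.searchOp, dif_neg h]
      rfl

/-- The state after `i` successful copying stages. -/
structure Ready (A : Subspc n) (i : ℕ) (φ : QState (SearchWire S n a T₁ T₂)) : Prop where
  main : lift (mainReg S n a T₁ T₂) (moneyProj A) φ = φ
  out : ∀ j : Fin n, (j : ℕ) < i → lift (outReg S n a T₁ T₂ j) (moneyProj A) φ = φ
  zero : ∀ j : Fin n, i ≤ j → ∀ x, φ x ≠ 0 → ∀ w, (¬ ∃ r, w = .inl (firstReg S n a r)) →
    x (copyEmb S n a T₁ T₂ j w) = 0

/-- The main register holds |A⟩ and all other wires of the next stage are still zero, so whatever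
the rest of the wires hold, the stage sees a multiple of its intended start state. -/
theorem Ready.slice_eq {A : Subspc n} {i : Fin n} {φ : QState (SearchWire S n a T₁ T₂)}
    (h : Ready A i φ) (x : Bits (SearchWire S n a T₁ T₂)) :
    ∃ c : ℂ, slice (copyEmb S n a T₁ T₂ i) x φ =
      c • withFlags T₂ (alone (firstReg S n a) (subspaceState A)) := by
  rw [withFlags_alone]
  have hinj : Function.Injective
      (Sum.inl ∘ firstReg S n a : Fin n → CopyWire S n a ⊕ Fin (T₂ + 1)) :=
    Sum.inl_injective.comp (firstReg_injective S n a)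
  refine ⟨_, eq_smul_alone hinj ?_ ?_⟩
  · have := h.main
    have he : mainReg S n a T₁ T₂ = copyEmb S n a T₁ T₂ i ∘ Sum.inl ∘ firstReg S n a := rfl
    rw [he, ← lift_lift hinj (copyEmb_injective i), lift_eq_self_iff (copyEmb_injective i)] at this
    exact this x
  · intro y hy w hw
    have := h.zero i le_rfl _ hy w fun ⟨r, hr⟩ => hw ⟨r, hr.symm⟩
    rwa [(copyEmb_injective i).extend_apply] at this

/-- On success every slice is a multiple of one fixed vector in the range of both money tests, so
main and output register hold |A⟩ again. Earlier output registers do not meet the wires of this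
stage, and its operator and flag condition therefore preserve their state. A later stage shares only
the main register with this one, so its other wires remain zero. -/
theorem Ready.step {A : Subspc n} {i : Fin n} {φ : QState (SearchWire S n a T₁ T₂)}
    (h : Ready A i φ)
    {K : QState (CopyWire S n a ⊕ Fin (T₂ + 1)) →ₗ[ℂ] QState (CopyWire S n a ⊕ Fin (T₂ + 1))}
    (hK : ∀ z, lift (firstReg S n a) (moneyProj A) (lift (secondReg S n a) (moneyProj A)
          (part z (proj {x | x (.inr (Fin.last T₂)) = 1}
            (K (withFlags T₂ (alone (firstReg S n a) (subspaceState A))))))) =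
          part z (proj {x | x (.inr (Fin.last T₂)) = 1}
            (K (withFlags T₂ (alone (firstReg S n a) (subspaceState A)))))) :
    Ready A (i + 1) (proj {x | x (copyEmb S n a T₁ T₂ i (.inr (Fin.last T₂))) = 1}
      (lift (copyEmb S n a T₁ T₂ i) K φ)) := by
  set v := withFlags T₂ (alone (firstReg S n a) (subspaceState A))
  set χ := proj {x | x (.inr (Fin.last T₂)) = 1} (K v)
  have hs : ∀ x, ∃ c : ℂ, slice (copyEmb S n a T₁ T₂ i) x
      (proj {x | x (copyEmb S n a T₁ T₂ i (.inr (Fin.last T₂))) = 1}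
        (lift (copyEmb S n a T₁ T₂ i) K φ)) = c • χ := fun x => by
    obtain ⟨c, hc⟩ := h.slice_eq x
    exact ⟨c, slice_stage (copyEmb_injective i) hc⟩
  have hinl := Sum.inl_injective (α := CopyWire S n a) (β := Fin (T₂ + 1))
  have h1 : lift (Sum.inl ∘ firstReg S n a) (moneyProj A) χ = χ := by
    rw [← lift_lift (firstReg_injective S n a) hinl]
    refine eq_of_part_eq fun z => ?_
    rw [part_lift_inl, ← hK z, lift_moneyProj_idem (firstReg_injective S n a)]
  have h2 : lift (Sum.inl ∘ secondReg S n a) (moneyProj A) χ = χ := by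
    rw [← lift_lift (secondReg_injective S n a) hinl]
    refine eq_of_part_eq fun z => ?_
    rw [part_lift_inl, ← hK z,
      lift_comm (firstReg_ne_secondReg S n a) (firstReg_injective S n a)
        (secondReg_injective S n a), lift_moneyProj_idem (secondReg_injective S n a)]
  refine ⟨?_, fun j hj => ?_, fun j hj x hx w hw => ?_⟩
  · exact lift_eq_self_of_slice (copyEmb_injective i)
      (hinl.comp (firstReg_injective S n a)) h1 hs
  · rcases eq_or_ne j i with rfl | hji
    · exact lift_eq_self_of_slice (copyEmb_injective j)
        (hinl.comp (secondReg_injective S n a)) h2 hs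
    · have hne : ∀ r w, outReg S n a T₁ T₂ j r ≠ copyEmb S n a T₁ T₂ i w := by
        intro r w hw
        obtain ⟨r', hr'⟩ := copyEmb_disjoint hji (.inl (secondReg S n a r)) w hw
        simp [firstReg, secondReg] at hr'
      have hj' : (j : ℕ) < i := by
        have : (j : ℕ) ≠ i := fun h => hji (Fin.ext h)
        omega
      rw [lift_proj_comm, ← lift_comm hne (outReg_injective j) (copyEmb_injective i),
        h.out j hj']
      intro y x
      rw [Set.mem_ofPred_eq, Set.mem_ofPred_eq, Function.extend_apply']
      rintro ⟨r, hr⟩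
      exact hne _ _ hr
  · have hji : j ≠ i := by
      rintro rfl
      omega
    have hx' : lift (copyEmb S n a T₁ T₂ i) K φ x ≠ 0 := by
      intro h0
      refine hx ?_
      rw [proj_apply]
      exact Set.indicator_apply_eq_zero.2 fun _ => h0
    by_contra hne
    refine hx' ?_
    rw [lift_apply]
    have : slice (copyEmb S n a T₁ T₂ i) x φ = 0 := by
      funext y
      rw [slice_apply]
      by_contra hy
      refine hne ?_
      rw [← h.zero j (by omega) _ hy w hw, Function.extend_apply']
      rintro ⟨w', hw'⟩
      exact hw (copyEmb_disjoint hji w w' hw'.symm)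
    rw [this, map_zero]
    rfl

theorem slice_single_zero {V W : Type} [Fintype V] [DecidableEq V] [Fintype W] [DecidableEq W] {e : V → W}
    (he : Function.Injective e) (x : Bits W) : ∃ c : ℂ,
    slice e x (Pi.single 0 1) = c • (Pi.single 0 1 : QState V) := by
  by_cases hx : ∀ w, (¬ ∃ v, e v = w) → x w = 0
  · refine ⟨1, ?_⟩
    funext y
    rw [slice_apply, one_smul, Pi.single_apply, Pi.single_apply]
    have : Function.extend e y x = 0 ↔ y = 0 := by
      rw [extend_congr he y (x' := 0) hx]
      constructor
      · intro h
        rw [← extend_comp_self he y 0, h]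
        rfl
      · rintro rfl
        exact Function.extend_const e 0
    simp only [this]
  · refine ⟨0, ?_⟩
    funext y
    rw [slice_apply, zero_smul, Pi.single_apply, if_neg]
    · rfl
    · intro h
      refine hx fun w hw => ?_
      rw [← Function.extend_apply' y x w hw, h]
      rfl

theorem withFlags_single_zero {B : Type} [Fintype B] [DecidableEq B] (T : ℕ) :
    withFlags T (Pi.single 0 1 : QState B) = Pi.single 0 1 := by
  funext x
  rw [withFlags, Pi.single_apply, Pi.single_apply]
  by_cases h : x = 0
  · subst h
    rw [if_pos (by rfl), if_pos (by rfl), if_pos rfl]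
  · rw [if_neg h]
    by_cases h1 : x ∘ .inr = 0
    · rw [if_pos h1, if_neg]
      intro h2
      refine h (funext fun w => ?_)
      rcases w with w | w
      · exact congrFun h2 w
      · exact congrFun h1 w
    · rw [if_neg h1]

theorem Ready.start {A : Subspc n}
    {I : QState (Fin n ⊕ Fin (T₁ + 1)) →ₗ[ℂ] QState (Fin n ⊕ Fin (T₁ + 1))}
    (hI : ∀ z, moneyProj A (part z (proj {x | x (.inr (Fin.last T₁)) = 1}
          (I (withFlags T₁ (Pi.single 0 1))))) =
            part z (proj {x | x (.inr (Fin.last T₁)) = 1} (I (withFlags T₁ (Pi.single 0 1))))) :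
    Ready A 0 (proj {x : Bits (SearchWire S n a T₁ T₂) |
        x (initEmb S n a T₁ T₂ (.inr (Fin.last T₁))) = 1}
      (lift (initEmb S n a T₁ T₂) I (Pi.single 0 1))) := by
  refine ⟨?_, fun j hj => absurd hj (by omega), fun j _ x hx w hw => ?_⟩
  · refine lift_eq_self_of_slice initEmb_injective (d := Sum.inl) (Sum.inl_injective)
      (χ := proj {x | x (.inr (Fin.last T₁)) = 1} (I (withFlags T₁ (Pi.single 0 1)))) ?_ ?_
    · refine eq_of_part_eq fun z => ?_
      rw [part_lift_inl, hI z]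
    · intro x
      obtain ⟨c, hc⟩ := slice_single_zero (initEmb_injective (S := S) (n := n) (a := a)
        (T₁ := T₁) (T₂ := T₂)) x
      rw [← withFlags_single_zero] at hc
      exact ⟨c, slice_stage initEmb_injective hc⟩
  · by_contra hne
    refine hx ?_
    rw [proj_apply]
    refine Set.indicator_apply_eq_zero.2 fun _ => ?_
    rw [lift_apply]
    have : slice (initEmb S n a T₁ T₂) x (Pi.single 0 1) = 0 := by
      funext y
      rw [slice_apply, Pi.single_apply, if_neg]
      · rfl
      · intro h0
        refine hne ?_
        have := congrFun h0 (copyEmb S n a T₁ T₂ j w)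
        rwa [Function.extend_apply'] at this
        rintro ⟨w', hw'⟩
        exact copyEmb_ne_initEmb hw w' hw'.symm
    rw [this, map_zero]
    rfl

/-- F is the condition that all success flags so far are set. The clause that F does not read the
wires of later stages is part of the induction, because it lets the condition be imposed at the end
instead of after each stage. -/
theorem exists_ready {A : Subspc n} {κ₁ κ₂ : ℝ}
    {I : QState (Fin n ⊕ Fin (T₁ + 1)) →ₗ[ℂ] QState (Fin n ⊕ Fin (T₁ + 1))}
    {K : QState (CopyWire S n a ⊕ Fin (T₂ + 1)) →ₗ[ℂ] QState (CopyWire S n a ⊕ Fin (T₂ + 1))}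
    (hI1 : normSq (proj {x | x (.inr (Fin.last T₁)) = 1} (I (withFlags T₁ (Pi.single 0 1)))) = κ₁)
    (hI : ∀ z, moneyProj A (part z (proj {x | x (.inr (Fin.last T₁)) = 1}
          (I (withFlags T₁ (Pi.single 0 1))))) =
            part z (proj {x | x (.inr (Fin.last T₁)) = 1} (I (withFlags T₁ (Pi.single 0 1)))))
    (hK1 : normSq (proj {x | x (.inr (Fin.last T₂)) = 1}
          (K (withFlags T₂ (alone (firstReg S n a) (subspaceState A))))) = κ₂)
    (hK : ∀ z, lift (firstReg S n a) (moneyProj A) (lift (secondReg S n a) (moneyProj A)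
          (part z (proj {x | x (.inr (Fin.last T₂)) = 1}
            (K (withFlags T₂ (alone (firstReg S n a) (subspaceState A))))))) =
          part z (proj {x | x (.inr (Fin.last T₂)) = 1}
            (K (withFlags T₂ (alone (firstReg S n a) (subspaceState A)))))) {i : ℕ} (hi : i ≤ n) :
    ∃ F : Set (Bits (SearchWire S n a T₁ T₂)),
      (∀ j : Fin n, i ≤ j → ∀ y x, Function.extend (copyEmb S n a T₁ T₂ j) y x ∈ F ↔ x ∈ F) ∧
      Ready A i (proj F (searchOp I K i (Pi.single 0 1))) ∧
      normSq (proj F (searchOp I K i (Pi.single 0 1))) = κ₂ ^ i * κ₁ := by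
  induction i with
  | zero =>
    refine ⟨_, fun j _ y x => ?_, Ready.start hI, ?_⟩
    · rw [Set.mem_ofPred_eq, Set.mem_ofPred_eq, Function.extend_apply']
      rintro ⟨w, hw⟩
      exact initFlag_ne_copyEmb _ _ _ hw.symm
    · have h0 : ∀ (B : Type) [Fintype B] [DecidableEq B],
          normSq (Pi.single 0 1 : QState B) = 1 := by
        intro B _ _
        rw [normSq, Finset.sum_eq_single 0]
        · simp
        · intro y _ hy
          simp [hy]
        · simp
      rw [searchOp, normSq_stage initEmb_injective (h0 _) hI1, h0]
      · ring
      · intro x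
        rw [withFlags_single_zero]
        exact slice_single_zero initEmb_injective x
  | succ i ih =>
    obtain ⟨F, hF, hr, hn⟩ := ih (by omega)
    have hin : i < n := by omega
    set e := copyEmb S n a T₁ T₂ ⟨i, hin⟩ with he
    have hee : Function.Injective e := copyEmb_injective _
    -- Deferred measurement: the old condition commutes with the new stage.
    have heq : proj ({x | x (e (.inr (Fin.last T₂))) = 1} ∩ F)
        (searchOp I K (i + 1) (Pi.single 0 1)) =
        proj {x | x (e (.inr (Fin.last T₂))) = 1} (lift e K
          (proj F (searchOp I K i (Pi.single 0 1)))) := by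
      rw [← proj_inter, lift_proj_comm K (hF ⟨i, hin⟩ le_rfl), searchOp, dif_pos hin]
      rfl
    refine ⟨{x | x (e (.inr (Fin.last T₂))) = 1} ∩ F, fun j hj y x => ?_, ?_, ?_⟩
    · refine and_congr ?_ (hF j (by omega) y x)
      rw [Set.mem_ofPred_eq, Set.mem_ofPred_eq, Function.extend_apply']
      rintro ⟨w, hw⟩
      have hji : (⟨i, hin⟩ : Fin n) ≠ j := by
        rintro rfl
        simp at hj
      obtain ⟨r, hr⟩ := copyEmb_disjoint hji _ _ hw.symm
      simp at hr
    · rw [heq]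
      exact Ready.step (i := ⟨i, hin⟩) hr hK
    · rw [heq, normSq_stage hee (by
        rw [normSq_alone (firstReg_injective S n a), normSq_subspaceState]) hK1, hn]
      · ring
      · exact Ready.slice_eq (i := ⟨i, hin⟩) hr

open Classical in
/-- A lower bound for the probability that the output registers span the hidden subspace. -/
theorem exists_searchOp {m₁ m₂ : Bits S → Vec n → ZMod 2} {c : ℕ}
    (h₁ : Computable c fun x : Bits (S ⊕ Fin n) => m₁ (x ∘ .inl) (x ∘ .inr))
    (h₂ : Computable c fun x : Bits (S ⊕ Fin n) => m₂ (x ∘ .inl) (x ∘ .inr))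
    (C : Circuit (CopyWire S n a)) (T₁ T₂ : ℕ) :
    ∃ R : Bits S → QState (SearchWire S n a T₁ T₂) →ₗ[ℂ] QState (SearchWire S n a T₁ T₂),
      Implements (hidingSet m₁ m₂) (2 * c + 4 * (Fintype.card S + 2 * n + a) + 10)
        ((T₁ + 1) * (36 * c + 152 * n + 336) + n * ((T₂ + 1) *
          (14 * C.length + 72 * c + 154 * Fintype.card S + 300 * n + 144 * a + 372))) R ∧
      ∀ s A, Hides m₁ m₂ s A → ∀ q, normSq (onFirst (moneyProj A) (onSecond (moneyProj A)
          (Circuit.run C (copyInput s (subspaceState A))))) = q →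
        (1 - 2 ^ Module.finrank (ZMod 2) A / 2 ^ n) * ((1 - (1 - q) * (1 - 2 * q) ^ (2 * T₂)) ^ n *
          (1 - (1 - Nat.card A / 2 ^ n) * (1 - 2 * (Nat.card A / 2 ^ n)) ^ (2 * T₁))) ≤
        ∑ x ∈ Finset.univ.filter (fun x : Bits (SearchWire S n a T₁ T₂) =>
          Submodule.span (ZMod 2) (Set.range fun i j => x (.inl (i, j))) = A),
          ‖R s (Pi.single 0 1) x‖ ^ 2 := by
  obtain ⟨I, hI, hI'⟩ := exists_initOp h₁ h₂ T₁
  obtain ⟨K, hK, hK'⟩ := exists_copyOp h₁ h₂ C T₂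
  refine ⟨fun s => searchOp (I s) (K s) n,
    (hI.mono (by omega) le_rfl).searchOp hK n, fun s A hs q hq => ?_⟩
  obtain ⟨hI1, hI2⟩ := hI' s A hs
  obtain ⟨hK1, hK2⟩ := hK' s A hs q hq
  obtain ⟨F, -, hr, hn⟩ := exists_ready (S := S) (a := a) (T₁ := T₁) (T₂ := T₂)
    hI1 hI2 hK1 hK2 le_rfl
  rw [← hn]
  refine (le_sum_span (ρ := outReg S n a T₁ T₂) outReg_injective ?_
    (fun i => hr.out i i.2)).trans ?_
  · intro i j r r' hij h
    simp [outReg, hij] at h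
  -- The flags are not measured by the finder; dropping the condition F only adds nonnegative terms.
  · refine Finset.sum_le_sum fun x _ => ?_
    rw [proj_apply]
    by_cases hx : x ∈ F
    · rw [Set.indicator_of_mem hx]
    · rw [Set.indicator_of_notMem hx]
      simp

end Finder

/-! ### Reindexing the wires of the finder -/

section Reindex

variable {β : ℝ} {d k a T₁ T₂ p l : ℕ}

-- A finder has only serial, output and ancilla wires, so the work wires of the search and the `p`
-- work wires of the implementation are numbered together as ancillas. All of them start at zero,
-- and the bijection respects the output register.
open Classical in
theorem exists_finderCircuit {G : Set (Bits (SystemWire β d k))}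
    {R : Bits (SystemWire β d k) → QState (SearchWire (SystemWire β d k) (2 * k) a T₁ T₂) →ₗ[ℂ]
      QState (SearchWire (SystemWire β d k) (2 * k) a T₁ T₂)} (hR : Implements G p l R)
    {b : ℕ} (hb : Fintype.card (WorkWire (SystemWire β d k) (2 * k) a T₁ T₂) + p = b) :
    ∃ C : Circuit (FinderWire β d k b), C.length ≤ l ∧ ∀ s ∈ G, ∀ A : Subspc (2 * k),
      ∑ x, {x | Submodule.span (ZMod 2) (Set.range (outputVectors x)) = A}.indicator
        (fun x => ‖Circuit.run C (finderInput s) x‖ ^ 2) x =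
      ∑ x ∈ Finset.univ.filter
        (fun x : Bits (SearchWire (SystemWire β d k) (2 * k) a T₁ T₂) =>
          Submodule.span (ZMod 2) (Set.range fun i j => x (.inl (i, j))) = A),
          ‖R s (Pi.single 0 1) x‖ ^ 2 := by
  obtain ⟨C, hCl, hC⟩ := hR
  let S := SystemWire β d k
  let Wk := WorkWire S (2 * k) a T₁ T₂
  let ι : Wk ⊕ Fin p ≃ Fin b := Fintype.equivFinOfCardEq (by
    rw [Fintype.card_sum, Fintype.card_fin]
    exact hb)
  let E : S ⊕ ((Fin (2 * k) × Fin (2 * k)) ⊕ Wk) ⊕ Fin p ≃ FinderWire β d k b :=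
    (Equiv.refl S).sumCongr ((Equiv.sumAssoc _ Wk (Fin p)).trans ((Equiv.refl _).sumCongr ι))
  refine ⟨Circuit.map E E.injective C, by rwa [Circuit.length_map], fun s hs A => ?_⟩
  have hstart : ∀ x : Bits (FinderWire β d k b), slice E x (finderInput s) =
      embed s (Pi.single 0 1) := by
    intro x
    funext y
    have h0 : ∀ w, Function.extend E y x (E w) = y w := fun w => E.injective.extend_apply y x w
    have h1 : ∀ i, Function.extend E y x (.inl i) = y (.inl i) := fun i => h0 (.inl i)
    have h2 : ∀ j, Function.extend E y x (.inr (.inl j)) = y (.inr (.inl (.inl j))) :=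
      fun j => h0 (.inr (.inl (.inl j)))
    have h3 : (∀ j, Function.extend E y x (.inr (.inr j)) = 0) ↔
        (∀ w, y (.inr (.inl (.inr w))) = 0) ∧ ∀ w, y (.inr (.inr w)) = 0 := by
      have hι : ∀ w : Wk ⊕ Fin p, Function.extend E y x (.inr (.inr (ι w))) =
          Sum.elim (fun w => y (.inr (.inl (.inr w)))) (fun w => y (.inr (.inr w))) w := by
        rintro (w | w)
        · exact h0 (.inr (.inl (.inr w)))
        · exact h0 (.inr (.inr w))
      constructor
      · intro h
        exact ⟨fun w => by have := hι (.inl w); rw [h] at this; exact this.symm,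
          fun w => by have := hι (.inr w); rw [h] at this; exact this.symm⟩
      · rintro ⟨ha, hb⟩ j
        obtain ⟨w, rfl⟩ := ι.surjective j
        rw [hι]
        rcases w with w | w
        · exact ha w
        · exact hb w
    rw [slice_apply, finderInput, embed, Pi.single_apply]
    simp only [h1, h2, h3]
    have hz : (fun w => y (.inr (.inl w))) = (0 : Bits ((Fin (2 * k) × Fin (2 * k)) ⊕ Wk)) ↔
        (∀ j, y (.inr (.inl (.inl j))) = 0) ∧ ∀ w, y (.inr (.inl (.inr w))) = 0 := by
      rw [funext_iff, Sum.forall]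
      rfl
    by_cases ha : ∀ i, y (.inl i) = s i
    · by_cases hb : ∀ w, y (.inr (.inr w)) = 0
      · by_cases hc : (fun w => y (.inr (.inl w))) =
          (0 : Bits ((Fin (2 * k) × Fin (2 * k)) ⊕ Wk))
        · rw [if_pos ⟨ha, (hz.1 hc).1, (hz.1 hc).2, hb⟩, if_pos ⟨ha, hb⟩, if_pos hc]
        · rw [if_neg fun h => hc (hz.2 ⟨h.2.1, h.2.2.1⟩), if_pos ⟨ha, hb⟩, if_neg hc]
      · rw [if_neg fun h => hb h.2.2.2, if_neg fun h => hb h.2]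
    · rw [if_neg fun h => ha h.1, if_neg fun h => ha h.1]
  have hrun : ∀ x, Circuit.run (Circuit.map E E.injective C) (finderInput s) x =
      embed s (R s (Pi.single 0 1)) (x ∘ E) := by
    intro x
    rw [Circuit.run_map, lift_apply, hstart, Circuit.lin_apply, hC s hs]
  have hout : ∀ x : Bits (FinderWire β d k b), outputVectors x =
      fun i j => (x ∘ E) (.inr (.inl (.inl (i, j)))) := fun x => rfl
  let F : Bits (S ⊕ ((Fin (2 * k) × Fin (2 * k)) ⊕ Wk) ⊕ Fin p) → ℂ → ℝ := fun y c =>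
    if Submodule.span (ZMod 2) (Set.range fun i j => y (.inr (.inl (.inl (i, j))))) = A
    then ‖c‖ ^ 2 else 0
  have hF : ∀ x : Bits (FinderWire β d k b),
      {x | Submodule.span (ZMod 2) (Set.range (outputVectors x)) = A}.indicator
        (fun x => ‖Circuit.run (Circuit.map E E.injective C) (finderInput s) x‖ ^ 2) x =
      F (x ∘ E) (embed s (R s (Pi.single 0 1)) (x ∘ E)) := by
    intro x
    rw [← hrun]
    by_cases h : Submodule.span (ZMod 2) (Set.range (outputVectors x)) = A
    · rw [Set.indicator_of_mem (by exact h)]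
      exact (if_pos h).symm
    · rw [Set.indicator_of_notMem (by exact h)]
      exact (if_neg h).symm
  simp only [hF]
  rw [Fintype.sum_equiv (Equiv.arrowCongr E.symm (Equiv.refl (ZMod 2)))
    (fun x => F (x ∘ E) (embed s (R s (Pi.single 0 1)) (x ∘ E)))
    (fun y => F y (embed s (R s (Pi.single 0 1)) y)) (fun x => rfl), sum_embed _ _ F
    (fun x => by simp [F]), Finset.sum_filter]
  rfl

end Reindex

/-! ### Estimates of the success probabilities -/

section Estimates

/-- By Bernoulli 1 + mx is at most (1 + x)^m, and (1 - x²)^m is at most one. This replaces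
exponential estimates by a rational bound. -/
theorem one_sub_pow_mul_le {x : ℝ} (h0 : 0 ≤ x) (h1 : x ≤ 1) (m : ℕ) :
    (1 - x) ^ m * (1 + m * x) ≤ 1 := by
  calc (1 - x) ^ m * (1 + m * x) ≤ (1 - x) ^ m * (1 + x) ^ m := by
        have := sub_nonneg.2 h1
        gcongr
        exact one_add_mul_le_pow (by linarith) m
    _ = (1 - x ^ 2) ^ m := by rw [← mul_pow]; ring
    _ ≤ 1 := pow_le_one₀ (by nlinarith) (by nlinarith)

theorem init_success_le {q : ℝ} {P : ℕ} (h0 : 0 ≤ q) (hq : 16 * P * q ≤ 1) (hP : 1 ≤ P) :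
    8 * P * q ≤ 1 - (1 - q) * (1 - 2 * q) ^ (2 * (4 * P)) := by
  have hP' : (1 : ℝ) ≤ P := by exact_mod_cast hP
  have hq' : 16 * q ≤ 1 := by nlinarith
  have h := one_sub_pow_mul_le (x := 2 * q) (by linarith) (by linarith) (2 * (4 * P))
  push_cast at h
  have hpos : 0 ≤ (1 - 2 * q) ^ (2 * (4 * P)) := pow_nonneg (by linarith) _
  set y := (1 - 2 * q) ^ (2 * (4 * P))
  -- With u = Pq the previous bound reads y(1 + 16u) ≤ 1, while (1 - 8u)(1 + 16u) ≥ 1 because u ≤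
  -- 1/16.
  have h1 : y ≤ 1 - 8 * P * q := by
    by_contra hcon
    push Not at hcon
    have hu : 0 ≤ (P : ℝ) * q := by positivity
    nlinarith
  nlinarith

theorem copy_failure_le {q : ℝ} {P T : ℕ} (hP : 1 ≤ P) (hT : 1 ≤ T) (h0 : 1 ≤ 4 * P * q)
    (h1 : q ≤ 1) : (1 - q) * (1 - 2 * q) ^ (2 * T) ≤ P / T := by
  have hP' : (1 : ℝ) ≤ P := by exact_mod_cast hP
  have hT' : (1 : ℝ) ≤ T := by exact_mod_cast hT
  have hq0 : 0 < q := by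
    by_contra hcon
    push Not at hcon
    nlinarith
  rw [le_div_iff₀ (by linarith)]
  rcases le_or_gt q (1 / 2) with hq | hq
  -- For q ≤ 1/2 the power is at most 1/(4Tq), and 1/(4q) is at most P by assumption.
  · have h := one_sub_pow_mul_le (x := 2 * q) (by linarith) (by linarith) (2 * T)
    push_cast at h
    have hpos : 0 ≤ (1 - 2 * q) ^ (2 * T) := pow_nonneg (by linarith) _
    set y := (1 - 2 * q) ^ (2 * T)
    have h2 : y * (4 * T * q) ≤ 1 := by nlinarith
    have h3 : y * T ≤ y * T * (4 * P * q) := le_mul_of_one_le_right (by positivity) h0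
    have h4 : y * T * (4 * P * q) ≤ P := by nlinarith
    have h5 : 0 ≤ y * T := by positivity
    nlinarith
  -- For q > 1/2 the even power is symmetric under q ↦ 1 - q, and the prefactor 1 - q takes over the
  -- role of q. The product with T is at most 1/4.
  · have h := one_sub_pow_mul_le (x := 2 * (1 - q)) (by linarith) (by linarith) (2 * T)
    push_cast at h
    have he : (1 - 2 * q) ^ (2 * T) = (1 - 2 * (1 - q)) ^ (2 * T) := by
      rw [pow_mul, pow_mul]
      congr 1
      ring
    rw [he]
    have hpos : 0 ≤ (1 - 2 * (1 - q)) ^ (2 * T) := pow_nonneg (by linarith) _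
    set y := (1 - 2 * (1 - q)) ^ (2 * T)
    nlinarith

/-- The success probability of the finder on an instance on which the counterfeiter succeeds with
probability at least `1 / (4 P)`. -/
theorem finder_success_le {q : ℝ} {P k : ℕ} (hk : 1 ≤ k) (hP : 1 ≤ P) (hPk : 16 * P ≤ 2 ^ k)
    (h0 : 1 ≤ 4 * P * q) (h1 : q ≤ 1) :
    (2 * P / 2 ^ k : ℝ) ≤ (1 - 2 ^ k / 2 ^ (2 * k)) *
      ((1 - (1 - q) * (1 - 2 * q) ^ (2 * (4 * k * P))) ^ (2 * k) *
        (1 - (1 - 2 ^ k / 2 ^ (2 * k)) * (1 - 2 * (2 ^ k / 2 ^ (2 * k))) ^ (2 * (4 * P)))) := by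
  have hP' : (1 : ℝ) ≤ P := by exact_mod_cast hP
  have hk' : (1 : ℝ) ≤ k := by exact_mod_cast hk
  have hPk' : (16 * P : ℝ) ≤ 2 ^ k := by exact_mod_cast hPk
  have h2k : (0 : ℝ) < 2 ^ k := by positivity
  have hdiv : (2 ^ k / 2 ^ (2 * k) : ℝ) = 1 / 2 ^ k := by
    rw [two_mul, pow_add]
    field_simp
  rw [hdiv]
  have hq0 : (1 / 2 ^ k : ℝ) ≤ 1 / 2 := by
    apply one_div_le_one_div_of_le two_pos
    linarith
  have hA : (1 / 2 : ℝ) ≤ 1 - 1 / 2 ^ k := by linarith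
  -- One copying stage fails with probability at most P/(4kP) = 1/(4k), and Bernoulli over 2k stages
  -- leaves 1/2.
  have hB : (1 / 2 : ℝ) ≤ (1 - (1 - q) * (1 - 2 * q) ^ (2 * (4 * k * P))) ^ (2 * k) := by
    have hf := copy_failure_le (T := 4 * k * P) hP (by nlinarith) h0 h1
    have hPT : (P : ℝ) / ((4 * k * P : ℕ) : ℝ) = 1 / (4 * k) := by
      push_cast
      field_simp
    rw [hPT] at hf
    have h4k : (1 : ℝ) / (4 * k) ≤ 1 / 4 := by
      apply one_div_le_one_div_of_le (by norm_num)
      linarith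
    calc (1 / 2 : ℝ) = 1 + (2 * k : ℕ) * (-(1 / (4 * k))) := by
          push_cast
          field_simp
          norm_num
      _ ≤ (1 + -(1 / (4 * k))) ^ (2 * k) := one_add_mul_le_pow (by linarith) _
      _ ≤ _ := pow_le_pow_left₀ (by linarith) (by linarith) _
  have hC := init_success_le (q := 1 / 2 ^ k) (P := P) (by positivity)
    (by rw [mul_one_div, div_le_one h2k]; exact hPk') hP
  have hC0 : (0 : ℝ) ≤ 8 * P * (1 / 2 ^ k) := by positivity
  calc (2 * P / 2 ^ k : ℝ) = 1 / 2 * (1 / 2 * (8 * P * (1 / 2 ^ k))) := by ring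
    _ ≤ _ := by gcongr

end Estimates

/-! ### Programs for membership -/

section Membership

variable {I : Type}

theorem Computable.zero : Computable 3 (fun _ : Bits I => 0) := by
  have h := (Computable.one (I := I)).add .one
  have h2 : (1 + 1 : ZMod 2) = 0 := by decide
  simpa only [h2] using h

theorem Computable.sum {ι : Type} {c : ℕ} {f : ι → Bits I → ZMod 2} (s : Finset ι)
    (h : ∀ i ∈ s, Computable c (f i)) :
    Computable (s.card * (c + 1) + 3) (fun x => ∑ i ∈ s, f i x) := by
  classical
  induction s using Finset.induction_on with
  | empty => simpa using Computable.zero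
  | insert i s hi ih =>
    simp only [Finset.sum_insert hi, Finset.card_insert_of_notMem hi]
    refine ((h i (Finset.mem_insert_self _ _)).add
      (ih fun j hj => h j (Finset.mem_insert_of_mem hj))).mono ?_
    rw [add_mul]
    omega

theorem Computable.prod {ι : Type} {c : ℕ} {f : ι → Bits I → ZMod 2} (s : Finset ι)
    (h : ∀ i ∈ s, Computable c (f i)) :
    Computable (s.card * (c + 1) + 1) (fun x => ∏ i ∈ s, f i x) := by
  classical
  induction s using Finset.induction_on with
  | empty => simpa using Computable.one
  | insert i s hi ih =>
    simp only [Finset.prod_insert hi, Finset.card_insert_of_notMem hi]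
    refine ((h i (Finset.mem_insert_self _ _)).mul
      (ih fun j hj => h j (Finset.mem_insert_of_mem hj))).mono ?_
    rw [add_mul]
    omega

/-- The bit `counter b i (j + 1)` says whether exactly `j` of the first `i` bits are one. -/
def counter (b : ℕ → Bits I → ZMod 2) : ℕ → ℕ → Bits I → ZMod 2
  | _, 0 => fun _ => 0
  | 0, j + 1 => fun _ => if j = 0 then 1 else 0
  | i + 1, j + 1 => fun x => counter b i (j + 1) x * (b i x + 1) + counter b i j x * b i x

theorem counter_eq (b : ℕ → Bits I → ZMod 2) (i j : ℕ) (x : Bits I) :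
    counter b i (j + 1) x = if ∑ l ∈ Finset.range i, (b l x).val = j then 1 else 0 := by
  have hone : (1 + 1 : ZMod 2) = 0 := by decide
  induction i generalizing j with
  | zero => simp [counter, eq_comm]
  | succ i ih =>
    rw [counter, Finset.sum_range_succ]
    beta_reduce
    rw [ih]
    rcases zmod_two_cases (b i x) with hb | hb
    · simp [hb]
    · rw [hb, hone, mul_zero, zero_add, mul_one]
      cases j with
      | zero => simp [counter, ZMod.val_one]
      | succ j => simp [ih, ZMod.val_one]

/-- Each row of the counting table is appended to a program that already contains the previous row:
three lines for an entry, and the bit and its negation once for a row. Sharing is essential, because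
combining separate programs for the two summands would double the length with every bit. -/
theorem exists_slp_counter (b : ℕ → Bits I → ZMod 2) {c : ℕ} (hb : ∀ i, Computable c (b i))
    (N i : ℕ) : ∃ L, SLP L ∧ L.length ≤ i * (c + 2 + 3 * N) + 4 ∧
      ∀ j ≤ N, counter b i j ∈ L := by
  induction i with
  | zero =>
    obtain ⟨L, hL, hl, hf⟩ := Computable.zero (I := I)
    refine ⟨_, hL.one, by rw [List.length_cons]; omega, fun j _ => ?_⟩
    match j with
    | 0 => exact List.mem_cons_of_mem _ (by rwa [counter])
    | 1 => simp [counter]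
    | j + 2 => exact List.mem_cons_of_mem _ (by simpa [counter] using hf)
  | succ i ih =>
    obtain ⟨L, hL, hl, hf⟩ := ih
    obtain ⟨L', hL', hl', hf'⟩ := hb i
    have key : ∀ M ≤ N, ∃ L₁, SLP L₁ ∧ L₁.length ≤ i * (c + 2 + 3 * N) + 4 + (c + 2) + 3 * M ∧
        (∀ j ≤ N, counter b i j ∈ L₁) ∧ b i ∈ L₁ ∧ (fun x => b i x + 1) ∈ L₁ ∧
        ∀ j ≤ M, counter b (i + 1) j ∈ L₁ := by
      intro M hM
      induction M with
      | zero =>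
        refine ⟨_, ((hL.append hL').one.add (b i) (fun _ => 1)
          (List.mem_cons_of_mem _ (List.mem_append_right _ hf')) (List.mem_cons_self)), ?_, ?_, ?_,
          List.mem_cons_self, ?_⟩
        · simp only [List.length_cons, List.length_append]
          omega
        · exact fun j hj => List.mem_cons_of_mem _ (List.mem_cons_of_mem _
            (List.mem_append_left _ (hf j hj)))
        · exact List.mem_cons_of_mem _ (List.mem_cons_of_mem _ (List.mem_append_right _ hf'))
        · intro j hj
          obtain rfl : j = 0 := by omega
          have := hf 0 (Nat.zero_le _)
          rw [counter] at this ⊢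
          exact List.mem_cons_of_mem _ (List.mem_cons_of_mem _ (List.mem_append_left _ this))
      | succ M ihM =>
        obtain ⟨L₁, h₁, hl₁, hc, hbi, hbn, hm⟩ := ihM (by omega)
        refine ⟨_, ((h₁.mul _ _ (hc (M + 1) hM) hbn).mul _ _
          (List.mem_cons_of_mem _ (hc M (by omega))) (List.mem_cons_of_mem _ hbi)).add _ _
          (List.mem_cons_of_mem _ List.mem_cons_self) List.mem_cons_self, ?_, ?_, ?_, ?_, ?_⟩
        · simp only [List.length_cons]
          omega
        · exact fun j hj => List.mem_cons_of_mem _ (List.mem_cons_of_mem _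
            (List.mem_cons_of_mem _ (hc j hj)))
        · exact List.mem_cons_of_mem _ (List.mem_cons_of_mem _ (List.mem_cons_of_mem _ hbi))
        · exact List.mem_cons_of_mem _ (List.mem_cons_of_mem _ (List.mem_cons_of_mem _ hbn))
        · intro j hj
          rcases Nat.lt_or_ge j (M + 1) with h | h
          · exact List.mem_cons_of_mem _ (List.mem_cons_of_mem _
              (List.mem_cons_of_mem _ (hm j (by omega))))
          · obtain rfl : j = M + 1 := by omega
            exact List.mem_cons_self
    obtain ⟨L₁, h₁, hl₁, -, -, -, hm⟩ := key N le_rfl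
    refine ⟨L₁, h₁, hl₁.trans ?_, hm⟩
    rw [add_mul]
    omega

/-- A program that decides whether at most `t` bits are one. -/
theorem Computable.threshold {m c : ℕ} {b : Fin m → Bits I → ZMod 2} (hb : ∀ i, Computable c (b i))
    (t : ℕ) : Computable ((t + 1) * (m * (c + 5 + 3 * (t + 1)) + 5) + 3)
      (fun x => if ∑ i, (b i x).val ≤ t then 1 else 0) := by
  -- `counter` expects an infinite sequence of bits, so the finite family is padded with zeros.
  let b' : ℕ → Bits I → ZMod 2 := fun i => if h : i < m then b ⟨i, h⟩ else fun _ => 0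
  have hb' : ∀ i, Computable (c + 3) (b' i) := by
    intro i
    by_cases h : i < m
    · simp only [b', dif_pos h]
      exact (hb _).mono (by omega)
    · simp only [b', dif_neg h]
      exact Computable.zero.mono (by omega)
  obtain ⟨L, hL, hl, hf⟩ := exists_slp_counter b' hb' (t + 1) m
  -- The events of exactly j ones are disjoint, so their sum for j ≤ t is the indicator of at most t
  -- ones, even modulo 2.
  have h := Computable.sum (c := m * (c + 5 + 3 * (t + 1)) + 4)
    (f := fun j => counter b' m (j + 1)) (Finset.range (t + 1)) fun j hj =>
    ⟨L, hL, hl.trans (by rw [show c + 3 + 2 = c + 5 by omega]),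
      hf (j + 1) (by have := Finset.mem_range.1 hj; omega)⟩
  rw [Finset.card_range] at h
  have hsum : ∀ x, ∑ l ∈ Finset.range m, (b' l x).val = ∑ i, (b i x).val := by
    intro x
    rw [Finset.sum_range]
    refine Finset.sum_congr rfl fun i _ => ?_
    simp [b']
  simp only [counter_eq, hsum, Finset.sum_ite_eq, Finset.mem_range, Nat.lt_succ_iff] at h
  exact h

end Membership

/-! ### Membership programs for systems of polynomials. -/

section Systems

variable {β : ℝ} {d k : ℕ}

/-- A set of at most d indices is the set of proper values of some function from d slots to the
indices and a blank. -/
theorem card_monom_le (n d : ℕ) : Fintype.card (Monom n d) ≤ (n + 1) ^ d := by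
  classical
  have hcard : Fintype.card (Fin d → Option (Fin n)) = (n + 1) ^ d := by simp
  rw [← hcard]
  refine Fintype.card_le_of_surjective
    (fun f => (⟨Finset.univ.filter fun i => ∃ j, f j = some i, ?_⟩ : Monom n d)) ?_
  · have hsub : (Finset.univ.filter fun i => ∃ j, f j = some i).map Function.Embedding.some ⊆
        (Finset.univ : Finset (Fin d)).image f := by
      intro o ho
      simp only [Finset.mem_map, Finset.mem_filter, Finset.mem_univ, true_and] at ho
      obtain ⟨i, ⟨j, hj⟩, rfl⟩ := ho
      exact Finset.mem_image.2 ⟨j, Finset.mem_univ _, hj⟩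
    have := (Finset.card_le_card hsub).trans Finset.card_image_le
    simpa using this
  · rintro ⟨s, hs⟩
    refine ⟨fun j => if h : (j : ℕ) < s.card then some (s.equivFin.symm ⟨j, h⟩) else none, ?_⟩
    apply Subtype.ext
    ext i
    simp only [Finset.mem_filter, Finset.mem_univ, true_and]
    constructor
    · rintro ⟨j, hj⟩
      split_ifs at hj with h
      rw [Option.some.injEq] at hj
      rw [← hj]
      exact (s.equivFin.symm ⟨j, h⟩).2
    · intro hi
      refine ⟨⟨s.equivFin ⟨i, hi⟩, (s.equivFin ⟨i, hi⟩).2.trans_le hs⟩, ?_⟩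
      rw [dif_pos (s.equivFin ⟨i, hi⟩).2]
      simp

theorem numPolys_le (β : ℝ) (k : ℕ) : numPolys β k ≤ ⌈β⌉₊ * (2 * k) := by
  rw [numPolys, Nat.ceil_le]
  push_cast
  exact mul_le_mul_of_nonneg_right (Nat.le_ceil β) (by positivity)

theorem computable_eval {I : Type} {n : ℕ} (ι : Monom n d → I) (κ : Fin n → I) :
    Computable ((n + 1) ^ d * (2 * d + 4) + 3)
      (fun x : Bits I => MLPoly.eval (fun S : Monom n d => x (ι S)) fun i => x (κ i)) := by
  have hS : ∀ S : Monom n d, Computable (2 * d + 3)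
      (fun x : Bits I => x (ι S) * ∏ i ∈ S.1, x (κ i)) := by
    intro S
    have h := (Computable.var (ι S)).mul
      (Computable.prod (f := fun i x => x (κ i)) S.1 fun i _ => Computable.var (κ i))
    refine h.mono ?_
    have := S.2
    omega
  refine (Computable.sum Finset.univ fun S _ => hS S).mono ?_
  rw [Finset.card_univ]
  gcongr
  exact card_monom_le n d

/-- The length of a program for the membership in the sets of accepted points. -/
def programLength (β : ℝ) (d k : ℕ) : ℕ :=
  (⌈β⌉₊ * (2 * k) + 1) * (⌈β⌉₊ * (2 * k) * (((2 * k + 1) ^ d * (2 * d + 4) + 3) + 5 +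
    3 * (⌈β⌉₊ * (2 * k) + 1)) + 5) + 3

/-- An integer count is at most εm exactly when it is at most the floor of εm, so acceptance is a
threshold test. The coefficients are inputs of the program, which makes it independent of the serial
number. -/
theorem exists_computable_acceptedPoints {ε : ℝ} (hε₀ : 0 ≤ ε) (hε : ε ≤ 1) {I : Type}
    (ι : Fin (numPolys β k) × Monom (2 * k) d → I) :
    ∃ m : Bits I → Vec (2 * k) → ZMod 2,
      Computable (programLength β d k)
        (fun x : Bits (I ⊕ Fin (2 * k)) => m (x ∘ .inl) (x ∘ .inr)) ∧
      ∀ s y, m s y = 1 ↔ y ∈ acceptedPoints ε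
        (fun i (S : Monom (2 * k) d) => s (ι (i, S)) : PolySystem β d k) := by
  have hM : ⌊ε * numPolys β k⌋₊ ≤ numPolys β k := by
    rw [← Nat.cast_le (α := ℝ)]
    refine (Nat.floor_le (by positivity)).trans ?_
    exact mul_le_of_le_one_left (by positivity) hε
  have hMβ : numPolys β k ≤ ⌈β⌉₊ * (2 * k) := numPolys_le β k
  refine ⟨fun s y => if ∑ i : Fin (numPolys β k),
    (MLPoly.eval (fun S : Monom (2 * k) d => s (ι (i, S))) y).val ≤ ⌊ε * numPolys β k⌋₊ then 1 else 0, ?_, ?_⟩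
  · refine (Computable.threshold (b := fun (i : Fin (numPolys β k)) (x : Bits (I ⊕ Fin (2 * k))) =>
      MLPoly.eval (fun S : Monom (2 * k) d => x (.inl (ι (i, S)))) fun j => x (.inr j))
      (fun i => computable_eval (fun S => (Sum.inl (ι (i, S)) : I ⊕ Fin (2 * k))) Sum.inr) ⌊ε * numPolys β k⌋₊).mono ?_
    rw [programLength]
    have := hM.trans hMβ
    gcongr
  · intro s y
    have h10 : ∀ P : Prop, ∀ _ : Decidable P, (if P then (1 : ZMod 2) else 0) = 1 ↔ P := by
      intro P _
      split_ifs with h <;> simp [h]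
    rw [h10, Nat.le_floor_iff (by positivity)]
    rfl

end Systems

/-! ### Polynomial bounds -/

section PolyBounded

theorem IsPolyBounded.mono {f g : ℕ → ℕ} (hg : IsPolyBounded g) (h : ∀ n, f n ≤ g n) :
    IsPolyBounded f := by
  obtain ⟨p, hp⟩ := hg
  exact ⟨p, fun n => (h n).trans (hp n)⟩

theorem IsPolyBounded.const (c : ℕ) : IsPolyBounded fun _ => c :=
  ⟨Polynomial.C c, fun _ => by simp⟩

theorem IsPolyBounded.id : IsPolyBounded fun n => n := ⟨Polynomial.X, fun n => by simp⟩

theorem IsPolyBounded.eval (p : Polynomial ℕ) : IsPolyBounded fun n => p.eval n :=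
  ⟨p, fun _ => le_rfl⟩

theorem IsPolyBounded.add {f g : ℕ → ℕ} (hf : IsPolyBounded f) (hg : IsPolyBounded g) :
    IsPolyBounded fun n => f n + g n := by
  obtain ⟨p, hp⟩ := hf
  obtain ⟨q, hq⟩ := hg
  exact ⟨p + q, fun n => by rw [Polynomial.eval_add]; exact Nat.add_le_add (hp n) (hq n)⟩

theorem IsPolyBounded.mul {f g : ℕ → ℕ} (hf : IsPolyBounded f) (hg : IsPolyBounded g) :
    IsPolyBounded fun n => f n * g n := by
  obtain ⟨p, hp⟩ := hf
  obtain ⟨q, hq⟩ := hg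
  exact ⟨p * q, fun n => by rw [Polynomial.eval_mul]; exact Nat.mul_le_mul (hp n) (hq n)⟩

theorem IsPolyBounded.pow {f : ℕ → ℕ} (hf : IsPolyBounded f) (e : ℕ) :
    IsPolyBounded fun n => f n ^ e := by
  obtain ⟨p, hp⟩ := hf
  exact ⟨p ^ e, fun n => by rw [Polynomial.eval_pow]; exact Nat.pow_le_pow_left (hp n) e⟩

theorem isPolyBounded_programLength (β : ℝ) (d : ℕ) : IsPolyBounded (programLength β d) := by
  have hb : IsPolyBounded fun k => ⌈β⌉₊ * (2 * k) := (IsPolyBounded.const _).mul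
    ((IsPolyBounded.const _).mul .id)
  have hc := IsPolyBounded.const
  exact ((hb.add (hc 1)).mul ((hb.mul ((((((((hc 2).mul .id).add (hc 1)).pow d).mul
    (hc (2 * d + 4))).add (hc 3)).add (hc 5)).add ((hc 3).mul (hb.add (hc 1))))).add (hc 5))).add (hc 3)

theorem isPolyBounded_card_systemWire (β : ℝ) (d : ℕ) :
    IsPolyBounded fun k => Fintype.card (SystemWire β d k) := by
  have hc := IsPolyBounded.const
  have h : IsPolyBounded fun k => 2 * (⌈β⌉₊ * (2 * k) * (2 * k + 1) ^ d) :=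
    (hc 2).mul (((hc _).mul ((hc 2).mul .id)).mul ((((hc 2).mul .id).add (hc 1)).pow d))
  refine h.mono fun k => ?_
  rw [Fintype.card_sum, Fintype.card_prod, Fintype.card_fin, ← two_mul]
  gcongr
  · exact numPolys_le β k
  · exact card_monom_le _ _

end PolyBounded

/-! ### From counterfeiters to generator finders -/

section Reduction

/-- The input is |ψ⟩ with a translated basis, the circuit is unitary, and verification is a
contraction on each register. -/
theorem normSq_copy_le {S : Type} [Fintype S] [DecidableEq S] {n a : ℕ}
    {V : QState (Fin n) →ₗ[ℂ] QState (Fin n)} (hV : ∀ ψ, normSq (V ψ) ≤ normSq ψ)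
    (C : Circuit (CopyWire S n a)) (s : Bits S) (ψ : QState (Fin n)) :
    normSq (onFirst V (onSecond V (Circuit.run C (copyInput s ψ)))) ≤ normSq ψ := by
  rw [onFirst_eq_lift, onSecond_eq_lift]
  refine (normSq_lift_le (firstReg_injective S n a) hV _).trans
    ((normSq_lift_le (secondReg_injective S n a) hV _).trans (le_of_eq ?_))
  have hrun : ∀ φ, normSq (Circuit.run C φ) = normSq φ := fun φ => by
    rw [← Circuit.lin_apply]
    exact normSq_of_herm (fun ψ φ => by
      rw [Circuit.lin_apply, Circuit.lin_apply, Circuit.herm_run]) φ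
  rw [hrun, ← addSerial_alone, ← normSq_alone (firstReg_injective S n a) ψ]
  exact Fintype.sum_equiv (Equiv.addRight (Function.extend Sum.inl s 0)) _ _ fun x => rfl

variable {ε β : ℝ} {d : ℕ}

/-- The probability that a counterfeiter succeeds on an instance. -/
def Counterfeiter.successOn (C : Counterfeiter (explicitScheme ε β d)) (k : ℕ)
    (o : Instance β d k) : ℝ :=
  normSq (onFirst (verOp (acceptedPoints ε o.2.1) (acceptedPoints ε o.2.2))
    (onSecond (verOp (acceptedPoints ε o.2.1) (acceptedPoints ε o.2.2))
      (Circuit.run (W := CopyWire (SystemWire β d k) (2 * k) (C.ancillas k)) (C.circuit k)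
        (copyInput (encodeSystems o.2.1 o.2.2) (subspaceState o.1)))))

theorem Counterfeiter.success_eq (C : Counterfeiter (explicitScheme ε β d)) (k : ℕ) :
    C.success k = expect (randomInstance ε β d k) (C.successOn k) := rfl

theorem Counterfeiter.successOn_le_one (C : Counterfeiter (explicitScheme ε β d)) (k : ℕ)
    (o : Instance β d k) : C.successOn k o ≤ 1 := by
  refine (normSq_copy_le (fun ψ => normSq_verOp_le _ _ ψ) _ _ _).trans ?_
  rw [normSq_subspaceState]

/-- The probability that a generator finder succeeds on an instance. -/
def GeneratorFinder.successOn (F : GeneratorFinder β d) (k : ℕ) (o : Instance β d k) : ℝ :=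
  ∑ x, {x | Submodule.span (ZMod 2) (Set.range (outputVectors x)) = o.1}.indicator
      (fun x => ‖Circuit.run (F.circuit k) (finderInput (encodeSystems o.2.1 o.2.2)) x‖ ^ 2) x

theorem GeneratorFinder.success_eq (F : GeneratorFinder β d) (ε : ℝ) (k : ℕ) :
    F.success ε k = expect (randomInstance ε β d k) (F.successOn k) := rfl

theorem GeneratorFinder.successOn_nonneg (F : GeneratorFinder β d) (k : ℕ) (o : Instance β d k) :
    0 ≤ F.successOn k o :=
  Finset.sum_nonneg fun _ _ => Set.indicator_nonneg (fun _ _ => by positivity) _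

/-- The two systems of an instance determine the hidden subspace and its orthogonal complement. -/
def Instance.Exact (ε : ℝ) {k : ℕ} (o : Instance β d k) : Prop :=
  Module.finrank (ZMod 2) o.1 = k ∧ acceptedPoints ε o.2.1 = (o.1 : Set (Vec (2 * k))) ∧
    acceptedPoints ε o.2.2 = (perp o.1 : Set (Vec (2 * k)))

/-- The number of ancillas of the generator finder. -/
def finderAncillas (β : ℝ) (d k a P : ℕ) : ℕ :=
  Fintype.card (WorkWire (SystemWire β d k) (2 * k) a (4 * P) (4 * k * P)) +
    (2 * programLength β d k + 4 * (Fintype.card (SystemWire β d k) + 2 * (2 * k) + a) + 10)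

/-- A bound for the number of gates of the generator finder. -/
def finderLength (β : ℝ) (d k a l P : ℕ) : ℕ :=
  (4 * P + 1) * (36 * programLength β d k + 152 * (2 * k) + 336) + 2 * k * ((4 * k * P + 1) *
    (14 * l + 72 * programLength β d k + 154 * Fintype.card (SystemWire β d k) + 300 * (2 * k) +
      144 * a + 372))

/-- The round numbers 4P and 4kP depend only on P and k, not on the success probability on the
instance, and the tests read the serial number from its wires. One circuit therefore serves all
exact instances. -/
theorem exists_finderCircuit_of_copyCircuit (hε₀ : 0 ≤ ε) (hε : ε ≤ 1) {k a : ℕ}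
    (C : Circuit (CopyWire (SystemWire β d k) (2 * k) a)) (P : ℕ) :
    ∃ F : Circuit (FinderWire β d k (finderAncillas β d k a P)),
      F.length ≤ finderLength β d k a C.length P ∧
      (1 ≤ k → 1 ≤ P → 16 * P ≤ 2 ^ k → ∀ o : Instance β d k, o.Exact ε →
        1 ≤ 4 * P * normSq (onFirst (verOp (acceptedPoints ε o.2.1) (acceptedPoints ε o.2.2))
          (onSecond (verOp (acceptedPoints ε o.2.1) (acceptedPoints ε o.2.2))
            (Circuit.run C (copyInput (encodeSystems o.2.1 o.2.2) (subspaceState o.1))))) →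
        (2 * P / 2 ^ k : ℝ) ≤
          ∑ x, {x | Submodule.span (ZMod 2) (Set.range (outputVectors x)) = o.1}.indicator
            (fun x => ‖Circuit.run F (finderInput (encodeSystems o.2.1 o.2.2)) x‖ ^ 2) x) := by
  obtain ⟨m₁, h₁, hm₁⟩ := exists_computable_acceptedPoints hε₀ hε
    (fun i => Sum.inl i : Fin (numPolys β k) × Monom (2 * k) d → SystemWire β d k)
  obtain ⟨m₂, h₂, hm₂⟩ := exists_computable_acceptedPoints hε₀ hε
    (fun i => Sum.inr i : Fin (numPolys β k) × Monom (2 * k) d → SystemWire β d k)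
  obtain ⟨R, hR, hR'⟩ := exists_searchOp h₁ h₂ C (4 * P) (4 * k * P)
  obtain ⟨F, hFl, hF⟩ := exists_finderCircuit hR
    (b := finderAncillas β d k a P) rfl
  refine ⟨F, hFl, fun hk hP hPk o ho hq => ?_⟩
  obtain ⟨hdim, hZ, hW⟩ := ho
  have hides : Hides m₁ m₂ (encodeSystems o.2.1 o.2.2) o.1 := by
    constructor
    · intro y
      rw [hm₁]
      change y ∈ acceptedPoints ε o.2.1 ↔ _
      rw [hZ]
      rfl
    · intro y
      rw [hm₂]
      change y ∈ acceptedPoints ε o.2.2 ↔ _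
      rw [hW]
      rfl
  have hcard : (Nat.card o.1 : ℝ) = 2 ^ k := by
    have := Module.natCard_eq_pow_finrank (K := ZMod 2) (V := o.1)
    rw [hdim, Nat.card_zmod] at this
    rw [this]
    push_cast
    rfl
  rw [hF _ ⟨o.1, hides⟩]
  have h := hR' _ o.1 hides _ rfl
  rw [hdim, hcard] at h
  rw [hZ, hW] at hq
  refine (finder_success_le hk hP hPk hq ?_).trans h
  refine (normSq_copy_le (fun ψ => normSq_verOp_le _ _ ψ) _ _ _).trans ?_
  rw [normSq_subspaceState]

theorem isPolyBounded_finder {a l P : ℕ → ℕ} (ha : IsPolyBounded a) (hl : IsPolyBounded l)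
    (hP : IsPolyBounded P) : IsPolyBounded fun k =>
      finderAncillas β d k (a k) (P k) + finderLength β d k (a k) (l k) (P k) := by
  have hc := IsPolyBounded.const
  have hk := IsPolyBounded.id
  have hS := isPolyBounded_card_systemWire β d
  have hm := isPolyBounded_programLength β d
  have hT := ((hc 4).mul hP).add (hc 1)
  have hT' := (((hc 4).mul hk).mul hP).add (hc 1)
  refine IsPolyBounded.add ?_ ?_
  · have hW : IsPolyBounded fun k => 2 * k + (4 * P k + 1 +
        2 * k * (Fintype.card (SystemWire β d k) + (a k + (4 * k * P k + 1)))) :=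
      ((hc 2).mul hk).add (hT.add (((hc 2).mul hk).mul (hS.add (ha.add hT'))))
    refine ((hW.add ((((hc 2).mul hm).add ((hc 4).mul ((hS.add ((hc 2).mul
      ((hc 2).mul hk))).add ha))).add (hc 10)))).mono fun k => ?_
    rw [finderAncillas]
    simp only [WorkWire, Fintype.card_sum, Fintype.card_prod, Fintype.card_fin, le_refl]
  · exact (hT.mul ((((hc 36).mul hm).add ((hc 152).mul ((hc 2).mul hk))).add (hc 336))).add
      (((hc 2).mul hk).mul (hT'.mul (((((((hc 14).mul hl).add ((hc 72).mul hm)).add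
        ((hc 154).mul hS)).add ((hc 300).mul ((hc 2).mul hk))).add ((hc 144).mul ha)).add (hc 372))))

theorem exists_finder (hε₀ : 0 ≤ ε) (hε : ε ≤ 1) (C : Counterfeiter (explicitScheme ε β d))
    (p : Polynomial ℕ) :
    ∃ F : GeneratorFinder β d, ∀ k, 1 ≤ k → 1 ≤ p.eval k → 16 * p.eval k ≤ 2 ^ k →
      ∀ o : Instance β d k, o.Exact ε → 1 ≤ 4 * (p.eval k : ℕ) * C.successOn k o →
        (2 * (p.eval k : ℕ) / 2 ^ k : ℝ) ≤ F.successOn k o := by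
  choose F hFl hF using fun k => exists_finderCircuit_of_copyCircuit (β := β) (d := d) hε₀ hε
    (show Circuit (CopyWire (SystemWire β d k) (2 * k) (C.ancillas k)) from C.circuit k) (p.eval k)
  refine ⟨⟨_, F, ?_⟩, hF⟩
  refine (isPolyBounded_finder (β := β) (d := d) (C.polySize.mono fun n => Nat.le_add_right _ _)
    (C.polySize.mono fun n => Nat.le_add_left _ _) (IsPolyBounded.eval p)).mono fun k => ?_
  exact Nat.add_le_add_left (hFl k) _

end Reduction

/-! ### Expectations -/

section Expect

variable {α γ : Type} [Fintype α] [Fintype γ]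

theorem expect_le_of_support {μ : PMF α} {f g : α → ℝ} (h : ∀ a ∈ μ.support, f a ≤ g a) :
    expect μ f ≤ expect μ g := by
  refine Finset.sum_le_sum fun a _ => ?_
  by_cases ha : μ a = 0
  · simp [ha]
  · exact mul_le_mul_of_nonneg_left (h a ha) ENNReal.toReal_nonneg

theorem expect_const (μ : PMF α) (c : ℝ) : expect μ (fun _ => c) = c := by
  have h1 : ∑ a, (μ a).toReal = 1 := by
    rw [← ENNReal.toReal_sum fun a _ => μ.apply_ne_top a,
      ← tsum_fintype (L := .unconditional α), μ.tsum_coe, ENNReal.toReal_one]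
  rw [expect, ← Finset.sum_mul, h1, one_mul]

theorem expect_add (μ : PMF α) (f g : α → ℝ) :
    expect μ (fun a => f a + g a) = expect μ f + expect μ g := by
  simp only [expect, mul_add, Finset.sum_add_distrib]

theorem expect_mul_left (μ : PMF α) (c : ℝ) (f : α → ℝ) :
    expect μ (fun a => c * f a) = c * expect μ f := by
  simp only [expect, Finset.mul_sum]
  exact Finset.sum_congr rfl fun a _ => by ring

theorem expect_sum {ι : Type} (μ : PMF α) (s : Finset ι) (f : ι → α → ℝ) :
    expect μ (fun a => ∑ i ∈ s, f i a) = ∑ i ∈ s, expect μ (f i) := by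
  simp only [expect, Finset.mul_sum]
  exact Finset.sum_comm

theorem expect_nonneg {μ : PMF α} {f : α → ℝ} (h : ∀ a, 0 ≤ f a) : 0 ≤ expect μ f :=
  Finset.sum_nonneg fun a _ => mul_nonneg ENNReal.toReal_nonneg (h a)

theorem expect_bind (μ : PMF α) (ν : α → PMF γ) (f : γ → ℝ) :
    expect (μ.bind ν) f = expect μ fun a => expect (ν a) f := by
  have h : ∀ b, ((μ.bind ν) b).toReal = ∑ a, (μ a).toReal * (ν a b).toReal := by
    intro b
    rw [PMF.bind_apply, tsum_fintype, ENNReal.toReal_sum fun a _ =>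
      ENNReal.mul_ne_top (μ.apply_ne_top a) ((ν a).apply_ne_top b)]
    exact Finset.sum_congr rfl fun a _ => ENNReal.toReal_mul
  simp only [expect, h, Finset.sum_mul, Finset.mul_sum]
  rw [Finset.sum_comm]
  exact Finset.sum_congr rfl fun a _ => Finset.sum_congr rfl fun b _ => by ring

theorem expect_map (μ : PMF α) (g : α → γ) (f : γ → ℝ) :
    expect (μ.map g) f = expect μ fun a => f (g a) := by
  classical
  have hp : ∀ b, expect (PMF.pure b) f = f b := by
    intro b
    rw [expect, Finset.sum_eq_single b]
    · simp
    · intro c _ hc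
      simp [PMF.pure_apply, hc]
    · simp
  rw [← PMF.bind_pure_comp, expect_bind]
  simp only [Function.comp_apply, hp]

theorem expect_uniformOfFinset (s : Finset α) (hs : s.Nonempty) (f : α → ℝ) :
    expect (PMF.uniformOfFinset s hs) f = (∑ a ∈ s, f a) / s.card := by
  classical
  rw [expect, ← Finset.sum_subset (Finset.subset_univ s), Finset.sum_div]
  · refine Finset.sum_congr rfl fun a ha => ?_
    rw [PMF.uniformOfFinset_apply_of_mem hs ha, ENNReal.toReal_inv, ENNReal.toReal_natCast]
    ring
  · intro a _ ha
    rw [PMF.uniformOfFinset_apply_of_notMem hs ha]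
    simp

/-- Independence: the sum over tuples of a product is the product of the sums. -/
theorem expect_productPMF {ι : Type} [Fintype ι] [DecidableEq ι] (μ : ι → PMF α)
    (g : ι → α → ℝ) :
    expect (productPMF μ) (fun f => ∏ i, g i (f i)) = ∏ i, expect (μ i) (g i) := by
  simp only [expect, Fintype.prod_sum]
  refine Finset.sum_congr rfl fun f _ => ?_
  rw [productPMF, PMF.ofFintype_apply, ENNReal.toReal_prod, Finset.prod_mul_distrib]

theorem mem_support_productPMF {ι : Type} [Fintype ι] [DecidableEq ι] {μ : ι → PMF α} {f : ι → α}
    (h : f ∈ (productPMF μ).support) (i : ι) : f i ∈ (μ i).support := by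
  rw [PMF.mem_support_iff, productPMF, PMF.ofFintype_apply] at h
  exact Finset.prod_ne_zero_iff.1 h i (Finset.mem_univ i)

end Expect

/-! ### Random polynomials at a point outside of the subspace -/

section RandomPoly

variable {n d : ℕ}

theorem perp_perp (A : Subspc n) : perp (perp A) = A := by
  symm
  refine Submodule.eq_of_le_of_finrank_eq (fun x hx y hy => ?_) ?_
  · rw [dotProduct_comm]
    exact hy x hx
  · have h1 := finrank_perp A
    have h2 := finrank_perp (perp A)
    omega

theorem MLPoly.eval_add (p q : MLPoly n d) (v : Vec n) : (p + q).eval v = p.eval v + q.eval v := by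
  simp only [MLPoly.eval, Pi.add_apply, add_mul, Finset.sum_add_distrib]

/-- The linear form with coefficients `y`. -/
def linearForm (hd : 1 ≤ d) (y : Vec n) : MLPoly n d :=
  ∑ i, Pi.single ⟨{i}, by simpa using hd⟩ (y i)

theorem eval_linearForm (hd : 1 ≤ d) (y v : Vec n) : (linearForm hd y).eval v = v ⬝ᵥ y := by
  simp only [MLPoly.eval, linearForm, Finset.sum_apply, Finset.sum_mul]
  rw [Finset.sum_comm]
  refine Finset.sum_congr rfl fun i _ => ?_
  rw [Finset.sum_eq_single ⟨{i}, by simpa using hd⟩]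
  · simp [mul_comm]
  · intro S _ hS
    rw [Pi.single_eq_of_ne hS, zero_mul]
  · simp

theorem mem_vanishing {A : Subspc n} {p : MLPoly n d} :
    p ∈ vanishing d A ↔ ∀ v ∈ A, p.eval v = 0 := by
  simp [vanishing]

/-- Some y in the orthogonal complement has product one with w. Adding the linear form y is an
involution on the polynomials vanishing on A that flips the value at w, so this value is a fair bit.
Degree one suffices. -/
theorem expect_randomVanishing (hd : 1 ≤ d) {A : Subspc n} {w : Vec n} (hw : w ∉ A)
    (f : ZMod 2 → ℝ) :
    expect (randomVanishing d A) (fun p => f (p.eval w)) = (f 0 + f 1) / 2 := by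
  obtain ⟨y, hy, hwy⟩ : ∃ y ∈ perp A, w ⬝ᵥ y = 1 := by
    by_contra hcon
    push Not at hcon
    refine hw ?_
    rw [← perp_perp A]
    intro y hy
    rw [dotProduct_comm]
    rcases zmod_two_cases (w ⬝ᵥ y) with h | h
    · exact h
    · exact absurd h (hcon y hy)
  have hℓ : linearForm hd y ∈ vanishing d A := by
    rw [mem_vanishing]
    intro v hv
    rw [eval_linearForm]
    exact hy v hv
  have hadd : ∀ p ∈ vanishing d A, p + linearForm hd y ∈ vanishing d A := by
    intro p hp
    rw [mem_vanishing] at *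
    intro v hv
    rw [MLPoly.eval_add, hp v hv, hℓ v hv, add_zero]
  have hinv : ∀ p : MLPoly n d, p + linearForm hd y + linearForm hd y = p := by
    intro p
    funext S
    simp only [Pi.add_apply, add_assoc, zmod_two_add_self, add_zero]
  have hsum : ∑ p ∈ vanishing d A, f (p.eval w) =
      ∑ p ∈ vanishing d A, f (p.eval w + 1) := by
    refine Finset.sum_nbij' (fun p => p + linearForm hd y) (fun p => p + linearForm hd y)
      hadd hadd (fun p _ => hinv p) (fun p _ => hinv p) fun p _ => ?_
    rw [MLPoly.eval_add, eval_linearForm, hwy, add_assoc, zmod_two_add_self, add_zero]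
  have htwo : ∑ p ∈ vanishing d A, f (p.eval w) + ∑ p ∈ vanishing d A, f (p.eval w) =
      (vanishing d A).card * (f 0 + f 1) := by
    conv_lhs => enter [2]; rw [hsum]
    rw [← Finset.sum_add_distrib, ← nsmul_eq_mul, ← Finset.sum_const]
    refine Finset.sum_congr rfl fun p _ => ?_
    have h2 : (1 + 1 : ZMod 2) = 0 := by decide
    rcases zmod_two_cases (p.eval w) with h | h
    · rw [h, zero_add]
    · rw [h, h2, add_comm]
  have hpos : (0 : ℝ) < (vanishing d A).card := by
    exact_mod_cast Finset.card_pos.2 (vanishing_nonempty d A)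
  rw [randomVanishing, expect_uniformOfFinset, div_eq_div_iff hpos.ne' two_ne_zero]
  linarith

theorem exists_linearEquiv_apply_eq {w w' : Vec n} (hw : w ≠ 0) (hw' : w' ≠ 0) :
    ∃ g : Vec n ≃ₗ[ZMod 2] Vec n, g w = w' := by
  obtain ⟨g, hg⟩ := Submodule.exists_linearEquiv_restrict_eq
    ((LinearEquiv.toSpanNonzeroSingleton (ZMod 2) (Vec n) w hw).symm.trans
      (LinearEquiv.toSpanNonzeroSingleton (ZMod 2) (Vec n) w' hw'))
  refine ⟨g, ?_⟩
  have := hg (LinearEquiv.toSpanNonzeroSingleton (ZMod 2) (Vec n) w hw 1)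
  rw [LinearEquiv.trans_apply, LinearEquiv.symm_apply_apply] at this
  simpa using this.symm

-- Invertible linear maps act transitively on nonzero vectors and permute the subspaces of a given
-- dimension.
open Classical in
theorem expect_randomSubspace_mem_eq {r : ℕ} (h : r ≤ n) {w w' : Vec n} (hw : w ≠ 0) (hw' : w' ≠ 0) :
    expect (randomSubspace h) (fun B => if w ∈ B then 1 else 0) =
      expect (randomSubspace h) (fun B => if w' ∈ B then 1 else 0) := by
  obtain ⟨g, hg⟩ := exists_linearEquiv_apply_eq hw hw'
  rw [randomSubspace, expect_uniformOfFinset, expect_uniformOfFinset]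
  congr 1
  refine Finset.sum_nbij' (fun B => B.map (g : Vec n →ₗ[ZMod 2] Vec n))
    (fun B => B.map (g.symm : Vec n →ₗ[ZMod 2] Vec n)) ?_ ?_ ?_ ?_ ?_
  · intro B hB
    simp only [subspacesOfDim, Finset.mem_filter, Finset.mem_univ, true_and] at hB ⊢
    rw [← hB]
    exact LinearEquiv.finrank_map_eq g B
  · intro B hB
    simp only [subspacesOfDim, Finset.mem_filter, Finset.mem_univ, true_and] at hB ⊢
    rw [← hB]
    exact LinearEquiv.finrank_map_eq g.symm B
  · intro B _
    ext x
    simp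
  · intro B _
    ext x
    simp
  · intro B _
    have : w' ∈ B.map (g : Vec n →ₗ[ZMod 2] Vec n) ↔ w ∈ B := by
      rw [← hg]
      simp
    simp only [this]

open Classical in
/-- A random subspace contains a given nonzero vector with a probability that is at most the
density of the subspace. -/
theorem expect_randomSubspace_mem_le {r : ℕ} (h : r ≤ n) {w : Vec n} (hw : w ≠ 0) :
    expect (randomSubspace h) (fun B => if w ∈ B then 1 else 0) ≤ 2 ^ r / 2 ^ n := by
  set x := expect (randomSubspace h) (fun B => if w ∈ B then 1 else 0)
  have hx0 : 0 ≤ x := expect_nonneg fun B => by split_ifs <;> norm_num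
  -- Double counting: a subspace of dimension r has 2^r - 1 nonzero vectors, and every nonzero
  -- vector has the same probability x of being contained.
  have hsum : ∑ v ∈ Finset.univ.erase (0 : Vec n),
      expect (randomSubspace h) (fun B => if v ∈ B then 1 else 0) = 2 ^ r - 1 := by
    rw [← expect_sum, ← expect_const (randomSubspace h) (2 ^ r - 1)]
    refine le_antisymm (expect_le_of_support fun B hB => le_of_eq ?_)
      (expect_le_of_support fun B hB => ge_of_eq ?_) <;>
    · rw [randomSubspace, PMF.mem_support_uniformOfFinset_iff, subspacesOfDim,
        Finset.mem_filter] at hB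
      have hcard : (Finset.univ.filter fun v : Vec n => v ∈ B).card = 2 ^ r := by
        have := Module.card_eq_pow_finrank (K := ZMod 2) (V := B)
        rw [hB.2, ZMod.card, Fintype.card_subtype] at this
        exact this
      have h0 : (∑ v : Vec n, if v ∈ B then (1 : ℝ) else 0) = 2 ^ r := by
        rw [← Finset.sum_filter, Finset.sum_const, hcard]
        simp
      rw [← h0, ← Finset.sum_erase_add _ _ (Finset.mem_univ (0 : Vec n)), if_pos B.zero_mem]
      ring
  rw [Finset.sum_congr rfl fun v hv =>
    expect_randomSubspace_mem_eq h (Finset.ne_of_mem_erase hv) hw, Finset.sum_const,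
    Finset.card_erase_of_mem (Finset.mem_univ _), Finset.card_univ] at hsum
  have hcard : Fintype.card (Vec n) = 2 ^ n := by simp
  rw [hcard, nsmul_eq_mul, Nat.cast_sub (Nat.one_le_two_pow)] at hsum
  push_cast at hsum
  have hrn : (2 : ℝ) ^ r ≤ 2 ^ n := pow_le_pow_right₀ one_le_two h
  have hx1 : x ≤ 1 := by
    rw [← expect_const (randomSubspace h) 1]
    exact expect_le_of_support fun B _ => by split_ifs <;> norm_num
  -- From (2^n - 1)x = 2^r - 1 and x ≤ 1 it follows that 2^n x ≤ 2^r.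
  rw [le_div_iff₀ (by positivity)]
  nlinarith

/-- The moment generating function of the value of a decoy at a point outside of the subspace. -/
theorem expect_randomDecoy_le (hd : 1 ≤ d) {A : Subspc n} {w : Vec n} (hw : w ∉ A) {e : ℝ}
    (he0 : 0 ≤ e) (he1 : e ≤ 1) :
    expect (randomDecoy d A) (fun p => if p.eval w = 0 then 1 else e) ≤
      (1 + e) / 2 * (1 + 2 ^ Module.finrank (ZMod 2) A / 2 ^ n) := by
  classical
  have hw0 : w ≠ 0 := by
    rintro rfl
    exact hw A.zero_mem
  have hr : Module.finrank (ZMod 2) A ≤ n := (Submodule.finrank_le A).trans_eq (by simp)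
  rw [randomDecoy, expect_bind]
  -- If the decoy subspace misses w, the value is a fair bit; otherwise only the trivial bound 1 =
  -- (1+e)/2 + (1-e)/2 is available.
  have hB : ∀ B : Subspc n, expect (randomVanishing d B)
      (fun p => if p.eval w = 0 then 1 else e) ≤
        (1 + e) / 2 + (1 - e) / 2 * if w ∈ B then 1 else 0 := by
    intro B
    by_cases hB : w ∈ B
    · rw [if_pos hB, ← expect_const (randomVanishing d B) ((1 + e) / 2 + (1 - e) / 2 * 1)]
      refine expect_le_of_support fun p _ => ?_
      split_ifs <;> linarith
    · rw [if_neg hB, expect_randomVanishing hd hB (fun b => if b = 0 then 1 else e)]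
      simp
  refine (expect_le_of_support fun B _ => hB B).trans ?_
  rw [expect_add, expect_const, expect_mul_left]
  have h := expect_randomSubspace_mem_le hr hw0
  have hpos : (0 : ℝ) ≤ 2 ^ Module.finrank (ZMod 2) A / 2 ^ n := by positivity
  nlinarith

end RandomPoly

/-! ### Noisy systems -/

section Noisy

variable {n d m : ℕ} {ε : ℝ} {A : Subspc n}

/-- All points of the subspace are accepted. -/
theorem subset_acceptedPoints (hε₀ : 0 ≤ ε) {p : Fin m → MLPoly n d}
    (hp : p ∈ (noisySystem d A m ε).support) : (A : Set (Vec n)) ⊆ acceptedPoints ε p := by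
  intro v hv
  rw [noisySystem, PMF.mem_support_bind_iff] at hp
  obtain ⟨D, hD, hp⟩ := hp
  rw [PMF.mem_support_uniformOfFinset_iff, Finset.mem_powersetCard] at hD
  have hi : ∀ i, i ∉ D → (p i).eval v = 0 := by
    intro i hi
    have := mem_support_productPMF hp i
    rw [if_neg hi, randomVanishing, PMF.mem_support_uniformOfFinset_iff, mem_vanishing] at this
    exact this v hv
  have hsum : ∑ i, ((p i).eval v).val ≤ D.card := by
    rw [← Finset.sum_subset (Finset.subset_univ D) fun i _ h => by rw [hi i h, ZMod.val_zero]]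
    refine (Finset.sum_le_card_nsmul D _ 1 fun i _ => ?_).trans_eq (by simp)
    have := ZMod.val_lt ((p i).eval v)
    omega
  have hle : ∑ i, ((p i).eval v).val ≤ ⌊ε * m⌋₊ :=
    hsum.trans (hD.2.trans_le (min_le_left _ _))
  exact (Nat.le_floor_iff (by positivity)).1 hle

/-- Chernoff: acceptance of w is bounded by the exponential of t times (εm minus the count), whose
expectation factorises over the positions once the decoy set is fixed. The correction factor covers
the decoys, so genuine polynomials and decoys obey the same bound and the choice of decoy set does
not matter. -/
theorem expect_accepted_le (hd : 1 ≤ d) {w : Vec n} (hw : w ∉ A) {t : ℝ} (ht : 0 ≤ t) :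
    expect (noisySystem d A m ε) ((acceptedPoints (m := m) ε ⁻¹' {Z | w ∈ Z}).indicator 1) ≤
      (Real.exp (t * ε) * ((1 + Real.exp (-t)) / 2) *
        (1 + 2 ^ Module.finrank (ZMod 2) A / 2 ^ n)) ^ m := by
  set e := Real.exp (-t) with he
  have he0 : 0 ≤ e := (Real.exp_pos _).le
  have he1 : e ≤ 1 := Real.exp_le_one_iff.2 (by linarith)
  have hbound : ∀ p : Fin m → MLPoly n d,
      (acceptedPoints (m := m) ε ⁻¹' {Z | w ∈ Z}).indicator (1 : (Fin m → MLPoly n d) → ℝ) p ≤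
        Real.exp (t * ε) ^ m * ∏ i, if (p i).eval w = 0 then 1 else e := by
    intro p
    have hprod : Real.exp (t * ε) ^ m * ∏ i, (if (p i).eval w = 0 then 1 else e) =
        Real.exp (t * (ε * m - ((∑ i, ((p i).eval w).val : ℕ) : ℝ))) := by
      have : ∀ i, (if (p i).eval w = 0 then 1 else e) =
          Real.exp (-t * (((p i).eval w).val : ℕ)) := by
        intro i
        rcases zmod_two_cases ((p i).eval w) with h | h
        · simp [h]
        · rw [h, if_neg one_ne_zero, ZMod.val_one]
          simp [he]
      simp only [this]
      rw [← Real.exp_sum, ← Real.exp_nat_mul, ← Real.exp_add, ← Finset.mul_sum]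
      congr 1
      push_cast
      ring
    rw [hprod]
    by_cases hp : w ∈ acceptedPoints ε p
    · rw [Set.indicator_of_mem (by exact hp)]
      refine Real.one_le_exp (mul_nonneg ht (sub_nonneg.2 ?_))
      exact hp
    · rw [Set.indicator_of_notMem (by exact hp)]
      exact (Real.exp_pos _).le
  refine (expect_le_of_support fun p _ => hbound p).trans ?_
  rw [expect_mul_left, mul_assoc, mul_pow]
  refine mul_le_mul_of_nonneg_left ?_ (by positivity)
  rw [noisySystem, expect_bind]
  rw [← expect_const (PMF.uniformOfFinset _ (decoySets_nonempty m (⌊ε * m⌋₊)))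
    (((1 + e) / 2 * (1 + 2 ^ Module.finrank (ZMod 2) A / 2 ^ n)) ^ m)]
  refine expect_le_of_support fun D _ => ?_
  rw [expect_productPMF _ fun (_ : Fin m) (q : MLPoly n d) => if q.eval w = 0 then (1 : ℝ) else e]
  refine (Finset.prod_le_prod (fun i _ => expect_nonneg fun q => ?_) fun i _ => ?_).trans_eq
    (Finset.prod_const _) |>.trans_eq (by rw [Finset.card_univ, Fintype.card_fin])
  · split_ifs <;> linarith
  · split_ifs
    · exact expect_randomDecoy_le hd hw he0 he1
    · rw [expect_randomVanishing hd hw (fun b => if b = 0 then 1 else e)]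
      simp only [if_true, one_ne_zero, if_false]
      exact le_mul_of_one_le_right (by linarith) (le_add_of_nonneg_right (by positivity))

/-- The left side is exp(-4γ²) cosh(2γ), and cosh(2γ) is at most exp(2γ²). -/
theorem exp_mul_le {γ : ℝ} :
    Real.exp (4 * γ * (1 / 2 - γ)) * ((1 + Real.exp (-(4 * γ))) / 2) ≤
      Real.exp (-2 * γ ^ 2) := by
  have h := Real.cosh_le_exp_half_sq (2 * γ)
  rw [Real.cosh_eq] at h
  have h1 : Real.exp (4 * γ * (1 / 2 - γ)) * ((1 + Real.exp (-(4 * γ))) / 2) =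
      Real.exp (-4 * γ ^ 2) * ((Real.exp (2 * γ) + Real.exp (-(2 * γ))) / 2) := by
    rw [← mul_div_assoc, ← mul_div_assoc, mul_add, mul_add, ← Real.exp_add, ← Real.exp_add,
      mul_one, ← Real.exp_add]
    ring_nf
  rw [h1]
  refine (mul_le_mul_of_nonneg_left h (Real.exp_pos _).le).trans_eq ?_
  rw [← Real.exp_add]
  ring_nf

/-- The probability that a noisy system does not determine the subspace. -/
theorem expect_not_exact_le (hd : 1 ≤ d) (hε₀ : 0 ≤ ε) (hε : ε < 1 / 2)
    (hm : 3 * n ≤ (1 - 2 * ε) ^ 2 * m) :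
    expect (noisySystem d A m ε)
      ((acceptedPoints (m := m) ε ⁻¹' {Z | Z ≠ (A : Set (Vec n))}).indicator 1) ≤
      2 ^ n * (Real.exp (-(3 / 2) * n) * Real.exp (2 ^ Module.finrank (ZMod 2) A / 2 ^ n * m)) := by
  classical
  set δ : ℝ := 2 ^ Module.finrank (ZMod 2) A / 2 ^ n with hδ
  have hδ0 : 0 ≤ δ := by positivity
  have hw : ∀ w ∉ A, expect (noisySystem d A m ε)
      ((acceptedPoints (m := m) ε ⁻¹' {Z | w ∈ Z}).indicator 1) ≤
        Real.exp (-(3 / 2) * n) * Real.exp (δ * m) := by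
    intro w hw
    -- The parameter t = 4γ with γ = 1/2 - ε puts the bound in the form of `exp_mul_le`.
    refine (expect_accepted_le hd hw (t := 4 * (1 / 2 - ε)) (by linarith)).trans ?_
    have h := exp_mul_le (γ := 1 / 2 - ε)
    rw [show (1 / 2 : ℝ) - (1 / 2 - ε) = ε by ring] at h
    have h1 : 1 + δ ≤ Real.exp δ := by
      rw [add_comm]
      exact Real.add_one_le_exp δ
    calc _ ≤ (Real.exp (-2 * (1 / 2 - ε) ^ 2) * Real.exp δ) ^ m := by gcongr
      _ = Real.exp (-2 * (1 / 2 - ε) ^ 2 * m) * Real.exp (δ * m) := by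
          rw [mul_pow, ← Real.exp_nat_mul, ← Real.exp_nat_mul, mul_comm (m : ℝ), mul_comm (m : ℝ)]
      _ ≤ _ := by
          -- Here 2(1/2 - ε)²m is half of (1 - 2ε)²m, hence at least 3n/2.
          refine mul_le_mul_of_nonneg_right (Real.exp_le_exp.2 ?_) (Real.exp_pos _).le
          linarith
  have hind : ∀ p ∈ (noisySystem d A m ε).support,
      (acceptedPoints (m := m) ε ⁻¹' {Z | Z ≠ (A : Set (Vec n))}).indicator
        (1 : (Fin m → MLPoly n d) → ℝ) p ≤
      ∑ w ∈ Finset.univ.filter (fun w : Vec n => w ∉ A),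
        (acceptedPoints (m := m) ε ⁻¹' {Z | w ∈ Z}).indicator 1 p := by
    intro p hp
    have hnn : ∀ w ∈ Finset.univ.filter (fun w : Vec n => w ∉ A),
        0 ≤ (acceptedPoints (m := m) ε ⁻¹' {Z | w ∈ Z}).indicator
          (1 : (Fin m → MLPoly n d) → ℝ) p := fun w _ =>
      Set.indicator_nonneg (fun _ _ => by simp) _
    by_cases hne : acceptedPoints ε p = (A : Set (Vec n))
    · rw [Set.indicator_of_notMem (by exact fun h => h hne)]
      exact Finset.sum_nonneg hnn
    · rw [Set.indicator_of_mem (by exact hne)]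
      -- Points of A are always accepted, so a system can only fail by accepting a point outside.
      obtain ⟨w, hwp, hwA⟩ : ∃ w ∈ acceptedPoints ε p, w ∉ A := by
        by_contra hcon
        push Not at hcon
        exact hne (Set.Subset.antisymm hcon (subset_acceptedPoints hε₀ hp))
      refine le_trans (le_of_eq ?_) (Finset.single_le_sum hnn
        (Finset.mem_filter.2 ⟨Finset.mem_univ w, hwA⟩))
      rw [Set.indicator_of_mem (by exact hwp)]
  refine (expect_le_of_support hind).trans ?_
  rw [expect_sum]
  refine (Finset.sum_le_card_nsmul _ _ _ fun w hwA => hw w (Finset.mem_filter.1 hwA).2).trans ?_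
  rw [nsmul_eq_mul]
  refine mul_le_mul_of_nonneg_right ?_ (by positivity)
  have h := Finset.card_filter_le (Finset.univ : Finset (Vec n)) (fun w => w ∉ A)
  have hcard : Fintype.card (Vec n) = 2 ^ n := by simp
  rw [Finset.card_univ, hcard] at h
  exact_mod_cast h

end Noisy

/-! ### Random instances -/

section RandomInstance

variable {ε β : ℝ} {d k : ℕ}

theorem mem_support_randomInstance {o : Instance β d k}
    (ho : o ∈ (randomInstance ε β d k).support) :
    Module.finrank (ZMod 2) o.1 = k ∧ o.2.1 ∈ (noisySystem d o.1 (numPolys β k) ε).support ∧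
      o.2.2 ∈ (noisySystem d (perp o.1) (numPolys β k) ε).support := by
  rw [randomInstance, PMF.mem_support_bind_iff] at ho
  obtain ⟨A, hA, ho⟩ := ho
  rw [PMF.mem_support_bind_iff] at ho
  obtain ⟨p, hp, ho⟩ := ho
  rw [PMF.mem_support_map_iff] at ho
  obtain ⟨q, hq, rfl⟩ := ho
  rw [randomSubspace, PMF.mem_support_uniformOfFinset_iff, subspacesOfDim, Finset.mem_filter] at hA
  exact ⟨hA.2, hp, hq⟩

/-- Valid banknotes are accepted with certainty. -/
theorem explicitScheme_hasCompletenessError (hε₀ : 0 ≤ ε) {η : ℝ} (hη : 0 ≤ η) :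
    (explicitScheme ε β d).HasCompletenessError η := by
  intro k o ho
  obtain ⟨-, hp, hq⟩ := mem_support_randomInstance ho
  have h : (explicitScheme ε β d).ver k ((explicitScheme ε β d).serial k o)
      ((explicitScheme ε β d).money k o) = (explicitScheme ε β d).money k o :=
    verOp_subspaceState o.1 (subset_acceptedPoints hε₀ hp) (subset_acceptedPoints hε₀ hq)
  rw [h, (explicitScheme ε β d).normSq_money]
  linarith

theorem le_numPolys (hε : ε < 1 / 2) (hβ : 3 / (1 - 2 * ε) ^ 2 ≤ β) (k : ℕ) :
    3 * ((2 * k : ℕ) : ℝ) ≤ (1 - 2 * ε) ^ 2 * numPolys β k := by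
  have hpos : (0 : ℝ) < (1 - 2 * ε) ^ 2 := by
    have : 0 < 1 - 2 * ε := by linarith
    positivity
  rw [div_le_iff₀ hpos] at hβ
  have h1 : β * ((2 * k : ℕ) : ℝ) ≤ numPolys β k := Nat.le_ceil _
  calc 3 * ((2 * k : ℕ) : ℝ) ≤ β * (1 - 2 * ε) ^ 2 * ((2 * k : ℕ) : ℝ) := by gcongr
    _ = (1 - 2 * ε) ^ 2 * (β * ((2 * k : ℕ) : ℝ)) := by ring
    _ ≤ _ := by gcongr

/-- The systems of a random instance determine the hidden subspace with high probability. -/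
theorem expect_not_instance_exact_le (hε₀ : 0 ≤ ε) (hε : ε < 1 / 2)
    (hβ : 3 / (1 - 2 * ε) ^ 2 ≤ β) (hd : 1 ≤ d) (hk : numPolys β k ≤ 2 ^ k) :
    expect (randomInstance ε β d k) ({o | ¬ o.Exact ε}.indicator 1) ≤ 6 / 4 ^ k := by
  have hbound : ∀ A : Subspc (2 * k), Module.finrank (ZMod 2) A = k →
      expect (noisySystem d A (numPolys β k) ε) ((acceptedPoints (m := numPolys β k) ε ⁻¹'
        {Z | Z ≠ (A : Set (Vec (2 * k)))}).indicator 1) ≤ 3 / 4 ^ k := by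
    intro A hA
    refine (expect_not_exact_le hd hε₀ hε (le_numPolys hε hβ k)).trans ?_
    rw [hA]
    -- The total correction for decoys is exp(m / 2^k), which stays below e since m is at most 2^k.
    have h1 : (2 ^ k / 2 ^ (2 * k) * (numPolys β k : ℝ) : ℝ) ≤ 1 := by
      have hk' : (numPolys β k : ℝ) ≤ 2 ^ k := by exact_mod_cast hk
      rw [two_mul, pow_add, div_mul_eq_mul_div, div_le_one (by positivity)]
      gcongr
    have he := Real.exp_one_gt_d9
    have h2 : Real.exp (-(3 / 2) * ((2 * k : ℕ) : ℝ)) ≤ 1 / 16 ^ k := by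
      have h3 : Real.exp (-(3 / 2) * ((2 * k : ℕ) : ℝ)) = 1 / (Real.exp 1 ^ 3) ^ k := by
        rw [one_div, ← pow_mul, ← Real.exp_nat_mul, ← Real.exp_neg]
        congr 1
        push_cast
        ring
      rw [h3]
      -- Of 16^k, one factor 4^k absorbs the union bound over 2^(2k) points and the other remains as
      -- the decay.
      have h4 : (16 : ℝ) ≤ Real.exp 1 ^ 3 := by
        calc (16 : ℝ) ≤ 2.7 ^ 3 := by norm_num
          _ ≤ Real.exp 1 ^ 3 := by
            gcongr
            linarith
      gcongr
    have h5 : Real.exp (2 ^ k / 2 ^ (2 * k) * (numPolys β k : ℝ)) ≤ 3 :=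
      (Real.exp_le_exp.2 h1).trans (Real.exp_one_lt_d9.le.trans (by norm_num))
    have h6 : (16 : ℝ) ^ k = 4 ^ k * 4 ^ k := by
      rw [← mul_pow]
      norm_num
    calc _ ≤ (2 : ℝ) ^ (2 * k) * (1 / 16 ^ k * 3) := by gcongr
      _ = 3 / 4 ^ k := by
        rw [pow_mul, h6]
        norm_num
        field_simp
  rw [randomInstance, expect_bind, ← expect_const (randomSubspace (n := 2 * k) (r := k) (by omega))
    (6 / 4 ^ k)]
  refine expect_le_of_support fun A hA => ?_
  rw [randomSubspace, PMF.mem_support_uniformOfFinset_iff, subspacesOfDim, Finset.mem_filter] at hA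
  have hA' : Module.finrank (ZMod 2) (perp A) = k := by
    have := finrank_perp A
    omega
  rw [expect_bind]
  simp only [expect_map]
  have hle : ∀ (p q : PolySystem β d k),
      {o : Instance β d k | ¬ o.Exact ε}.indicator (1 : Instance β d k → ℝ) (A, p, q) ≤
      (acceptedPoints ε ⁻¹' {Z | Z ≠ (A : Set (Vec (2 * k)))}).indicator 1 p +
        (acceptedPoints ε ⁻¹' {Z | Z ≠ (perp A : Set (Vec (2 * k)))}).indicator 1 q := by
    intro p q
    have hnn : ∀ (s : Set (PolySystem β d k)) (p : PolySystem β d k),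
        0 ≤ s.indicator (1 : PolySystem β d k → ℝ) p := fun s p =>
      Set.indicator_nonneg (fun _ _ => by simp) _
    by_cases h : Instance.Exact (β := β) (d := d) ε (A, p, q)
    · rw [Set.indicator_of_notMem (by exact fun h' => h' h)]
      exact add_nonneg (hnn _ _) (hnn _ _)
    · rw [Set.indicator_of_mem (by exact h)]
      by_cases hp : acceptedPoints ε p = (A : Set (Vec (2 * k)))
      · have hq : acceptedPoints ε q ≠ (perp A : Set (Vec (2 * k))) :=
          fun hq => h ⟨hA.2, hp, hq⟩
        rw [Set.indicator_of_mem (s := acceptedPoints ε ⁻¹' _) (a := q) (by exact hq)]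
        simpa using hnn _ p
      · rw [Set.indicator_of_mem (s := acceptedPoints ε ⁻¹' _) (a := p) (by exact hp)]
        simpa using hnn _ q
  refine (expect_le_of_support fun p _ => (expect_le_of_support fun q _ => hle p q).trans_eq
    (by rw [expect_add, expect_const])).trans ?_
  rw [expect_add, expect_const]
  refine (add_le_add (hbound A hA.2) (hbound (perp A) hA')).trans_eq ?_
  ring

end RandomInstance

/-! ### Growth of polynomials -/

section Growth

theorem IsPolyBounded.exists_pow {f : ℕ → ℕ} (hf : IsPolyBounded f) :
    ∃ J, ∀ᶠ n in atTop, f n ≤ n ^ J := by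
  obtain ⟨p, hp⟩ := hf
  have h : ∃ c D : ℕ, ∀ n, 1 ≤ n → p.eval n ≤ c * n ^ D := by
    clear hp
    induction p using Polynomial.induction_on' with
    | add p q hp hq =>
      obtain ⟨c, D, h⟩ := hp
      obtain ⟨c', D', h'⟩ := hq
      refine ⟨c + c', D + D', fun n hn => ?_⟩
      rw [Polynomial.eval_add, add_mul]
      refine Nat.add_le_add ((h n hn).trans ?_) ((h' n hn).trans ?_)
      · exact Nat.mul_le_mul_left _ (Nat.pow_le_pow_right hn (by omega))
      · exact Nat.mul_le_mul_left _ (Nat.pow_le_pow_right hn (by omega))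
    | monomial D c => exact ⟨c, D, fun n _ => by rw [Polynomial.eval_monomial]⟩
  obtain ⟨c, D, h⟩ := h
  -- The coefficient is absorbed by c further powers: c ≤ 2^c ≤ n^c for n ≥ 2.
  refine ⟨c + D, ?_⟩
  filter_upwards [eventually_ge_atTop 2] with n hn
  refine (hp n).trans ((h n (by omega)).trans ?_)
  rw [pow_add]
  exact Nat.mul_le_mul_right _ (Nat.lt_two_pow_self.le.trans (Nat.pow_le_pow_left hn c))

theorem IsPolyBounded.eventually_le_two_pow {f : ℕ → ℕ} (hf : IsPolyBounded f) :
    ∀ᶠ n in atTop, f n ≤ 2 ^ n := by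
  obtain ⟨J, hJ⟩ := hf.exists_pow
  have h := (tendsto_pow_const_div_const_pow_of_one_lt J (one_lt_two (α := ℝ))).eventually_le_const
    zero_lt_one
  filter_upwards [hJ, h] with n h1 h2
  rw [div_le_one (by positivity)] at h2
  exact h1.trans (by exact_mod_cast h2)

end Growth

/-! ### The security of the mini-scheme -/

section Security

variable {ε β : ℝ} {d : ℕ}

/-- A counterfeiter whose success probability is at least the reciprocal of a polynomial gives a
generator finder. -/
theorem exists_finder_of_counterfeiter (hε₀ : 0 ≤ ε) (hε : ε < 1 / 2)
    (hβ : 3 / (1 - 2 * ε) ^ 2 ≤ β) (hd : 1 ≤ d) (C : Counterfeiter (explicitScheme ε β d))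
    (p : Polynomial ℕ) :
    ∃ F : GeneratorFinder β d, ∃ c : ℝ, 0 < c ∧
      ∀ᶠ k : ℕ in atTop, 1 ≤ ((p.eval k : ℕ) : ℝ) * C.success k →
        c * (2 : ℝ) ^ (-((2 * k : ℕ) : ℝ) / 2) ≤ F.success ε k := by
  obtain ⟨F, hF⟩ := exists_finder hε₀ (by linarith) C p
  refine ⟨F, 1, one_pos, ?_⟩
  have h16 : IsPolyBounded fun k => 16 * p.eval k := (IsPolyBounded.const 16).mul (.eval p)
  have hm : IsPolyBounded (numPolys β) := ((IsPolyBounded.const _).mul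
    ((IsPolyBounded.const 2).mul .id)).mono (numPolys_le β)
  filter_upwards [h16.eventually_le_two_pow, hm.eventually_le_two_pow, eventually_ge_atTop 1]
    with k hk16 hkm hk1 hC
  have hF' := hF k hk1
  set P := p.eval k
  have hP : 1 ≤ P := by
    by_contra hcon
    have : P = 0 := by omega
    rw [this] at hC
    norm_num at hC
  replace hF' := hF' hP hk16
  have hP' : (0 : ℝ) < P := by exact_mod_cast hP
  have hrpow : (2 : ℝ) ^ (-((2 * k : ℕ) : ℝ) / 2) = 1 / 2 ^ k := by
    rw [show -((2 * k : ℕ) : ℝ) / 2 = -(k : ℝ) by push_cast; ring, Real.rpow_neg two_pos.le,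
      Real.rpow_natCast, one_div]
  rw [hrpow, one_mul]
  set μ := randomInstance ε β d k
  -- The good instances: exact, and with success of the counterfeiter at least a quarter of the
  -- average 1/P.
  let G : Set (Instance β d k) := {o | o.Exact ε ∧ 1 ≤ 4 * P * C.successOn k o}
  have hnn : ∀ (s : Set (Instance β d k)) o, 0 ≤ s.indicator (1 : Instance β d k → ℝ) o :=
    fun s o => Set.indicator_nonneg (fun _ _ => by simp) _
  -- Off the good set, instances with small success contribute at most 1/(4P), and the inexact ones
  -- at most 6/4^k ≤ 1/(4P). A weight of at least 1/(2P) is left for the good ones.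
  have hCle : C.success k ≤ expect μ (G.indicator 1) + 1 / (4 * P) + 1 / (4 * P) := by
    have h1 : ∀ o, C.successOn k o ≤ G.indicator 1 o + 1 / (4 * P) +
        {o : Instance β d k | ¬ o.Exact ε}.indicator 1 o := by
      intro o
      have hinv : (0 : ℝ) ≤ 1 / (4 * P) := by positivity
      by_cases ho : o.Exact ε
      · by_cases hq : 1 ≤ 4 * P * C.successOn k o
        · have := C.successOn_le_one k o
          rw [Set.indicator_of_mem (s := G) (by exact ⟨ho, hq⟩)]
          have := hnn {o : Instance β d k | ¬ o.Exact ε} o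
          simp only [Pi.one_apply]
          linarith
        · have h2 : C.successOn k o ≤ 1 / (4 * P) := by
            rw [le_div_iff₀ (by positivity)]
            linarith
          have := hnn {o : Instance β d k | ¬ o.Exact ε} o
          have := hnn G o
          linarith
      · have := C.successOn_le_one k o
        rw [Set.indicator_of_mem (s := {o : Instance β d k | ¬ o.Exact ε}) (by exact ho)]
        have := hnn G o
        simp only [Pi.one_apply]
        linarith
    have h2 := expect_not_instance_exact_le hε₀ hε hβ hd hkm
    have h3 : (6 / 4 ^ k : ℝ) ≤ 1 / (4 * P) := by
      rw [div_le_div_iff₀ (by positivity) (by positivity)]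
      have h16' : (16 * P : ℝ) ≤ 2 ^ k := by exact_mod_cast hk16
      have h2k : (2 : ℝ) ≤ 2 ^ k := le_self_pow₀ one_le_two (by omega)
      have h4 : (4 : ℝ) ^ k = 2 ^ k * 2 ^ k := by
        rw [← mul_pow]
        norm_num
      rw [h4]
      nlinarith
    rw [C.success_eq]
    refine (expect_le_of_support fun o _ => h1 o).trans ?_
    rw [expect_add, expect_add, expect_const]
    linarith
  have hG : 1 / (2 * P) ≤ expect μ (G.indicator 1) := by
    have h1 : (1 : ℝ) / P ≤ C.success k := by
      rw [div_le_iff₀ hP']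
      linarith
    have h2 : (1 : ℝ) / P - 1 / (4 * P) - 1 / (4 * P) = 1 / (2 * P) := by
      field_simp
      norm_num
    linarith
  have hFle : ∀ o ∈ μ.support, (2 * P / 2 ^ k : ℝ) * G.indicator 1 o ≤ F.successOn k o := by
    intro o _
    by_cases ho : o ∈ G
    · rw [Set.indicator_of_mem ho, Pi.one_apply, mul_one]
      exact hF' o ho.1 ho.2
    · rw [Set.indicator_of_notMem ho, mul_zero]
      exact F.successOn_nonneg k o
  rw [F.success_eq]
  refine le_trans ?_ (expect_le_of_support hFle)
  rw [expect_mul_left]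
  -- Success 2P/2^k on instances of weight 1/(2P).
  calc (1 / 2 ^ k : ℝ) = 2 * P / 2 ^ k * (1 / (2 * P)) := by field_simp
    _ ≤ _ := by gcongr

/-- The success probability of a single counterfeiting circuit. -/
def copySuccess (ε : ℝ) {β : ℝ} {d k a : ℕ}
    (C : Circuit (CopyWire (SystemWire β d k) (2 * k) a)) : ℝ :=
  expect (randomInstance ε β d k) fun o =>
    normSq (onFirst (verOp (acceptedPoints ε o.2.1) (acceptedPoints ε o.2.2))
      (onSecond (verOp (acceptedPoints ε o.2.1) (acceptedPoints ε o.2.2))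
        (Circuit.run C (copyInput (encodeSystems o.2.1 o.2.2) (subspaceState o.1)))))

/-- Some circuit of size at most `k ^ j` succeeds with probability more than `k ^ (-j)`. -/
def Breakable (ε β : ℝ) (d j k : ℕ) : Prop :=
  ∃ (a : ℕ) (C : Circuit (CopyWire (SystemWire β d k) (2 * k) a)),
    a + C.length ≤ k ^ j ∧ 1 / (k : ℝ) ^ j < copySuccess ε C

/-- A success probability cannot exceed one. This gives the maximum that defines the security
exponent a starting point. -/
theorem not_breakable_zero (k : ℕ) : ¬ Breakable ε β d 0 k := by
  rintro ⟨a, C, -, h⟩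
  refine absurd h (not_lt.2 ?_)
  rw [pow_zero, div_one, ← expect_const (randomInstance ε β d k) 1]
  refine expect_le_of_support fun o _ => ?_
  refine (normSq_copy_le (fun ψ => normSq_verOp_le _ _ ψ) _ _ _).trans ?_
  rw [normSq_subspaceState]

/-- Counterfeiters are nonuniform, so breaking circuits for infinitely many k can be chosen
independently and glued into one family of size at most k^j. Its success exceeds k^(-j) infinitely
often, and the reduction with the polynomial X^j contradicts the conjecture. -/
theorem eventually_not_breakable (hε₀ : 0 ≤ ε) (hε : ε < 1 / 2)
    (hβ : 3 / (1 - 2 * ε) ^ 2 ≤ β) (hd : 1 ≤ d) (hconj : GeneratorConjecture ε β d) (j : ℕ) :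
    ∀ᶠ k in atTop, ¬ Breakable ε β d j k := by
  by_contra hcon
  rw [not_eventually] at hcon
  simp only [not_not] at hcon
  have h : ∀ k, ∃ (a : ℕ) (C : Circuit (CopyWire (SystemWire β d k) (2 * k) a)),
      a + C.length ≤ k ^ j ∧ (Breakable ε β d j k → 1 / (k : ℝ) ^ j < copySuccess ε C) := by
    intro k
    by_cases hk : Breakable ε β d j k
    · obtain ⟨a, C, h1, h2⟩ := hk
      exact ⟨a, C, h1, fun _ => h2⟩
    -- The empty circuit fills the values of k at which there is no breaking circuit.
    · exact ⟨0, [], by simp, fun h => absurd h hk⟩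
  choose a C hsize hsucc using h
  let C' : Counterfeiter (explicitScheme ε β d) :=
    ⟨a, C, (((IsPolyBounded.id).pow j).mono hsize)⟩
  obtain ⟨F, c, hc, hF⟩ := exists_finder_of_counterfeiter hε₀ hε hβ hd C' (Polynomial.X ^ j)
  refine hconj ⟨F, c, hc, ?_⟩
  refine (hcon.and_eventually (hF.and (eventually_ge_atTop 1))).mono fun k hk => ?_
  obtain ⟨hb, hF, hk1⟩ := hk
  refine hF ?_
  have hk1' : (1 : ℝ) ≤ k := by exact_mod_cast hk1
  have hpos : (0 : ℝ) < (k : ℝ) ^ j := by positivity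
  have hs : 1 / (k : ℝ) ^ j < C'.success k := hsucc k hb
  rw [div_lt_iff₀ hpos] at hs
  simp only [Polynomial.eval_pow, Polynomial.eval_X, Nat.cast_pow]
  linarith

open Classical in
/-- The largest exponent, up to `k`, for which the mini-scheme is not breakable. -/
def securityExponent (ε β : ℝ) (d k : ℕ) : ℕ :=
  Nat.findGreatest (fun j => ¬ Breakable ε β d j k) k

theorem not_breakable_securityExponent (k : ℕ) :
    ¬ Breakable ε β d (securityExponent ε β d k) k := by
  classical
  exact Nat.findGreatest_spec (P := fun j => ¬ Breakable ε β d j k) (Nat.zero_le k)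
    (not_breakable_zero k)

theorem eventually_le_securityExponent (hε₀ : 0 ≤ ε) (hε : ε < 1 / 2)
    (hβ : 3 / (1 - 2 * ε) ^ 2 ≤ β) (hd : 1 ≤ d) (hconj : GeneratorConjecture ε β d) (j : ℕ) :
    ∀ᶠ k in atTop, j ≤ securityExponent ε β d k := by
  classical
  filter_upwards [eventually_not_breakable hε₀ hε hβ hd hconj j, eventually_ge_atTop j]
    with k hk hjk
  exact Nat.le_findGreatest hjk hk

/-- The bound k to minus the security exponent is negligible because the exponent tends to infinity.
A counterfeiter of size at most k^J obeys it as soon as the exponent has passed J, since otherwise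
its circuit would break the scheme at that exponent. -/
theorem explicitScheme_secure (hε₀ : 0 ≤ ε) (hε : ε < 1 / 2)
    (hβ : 3 / (1 - 2 * ε) ^ 2 ≤ β) (hd : 1 ≤ d) (hconj : GeneratorConjecture ε β d) :
    (explicitScheme ε β d).Secure := by
  have hev := eventually_le_securityExponent hε₀ hε hβ hd hconj
  refine ⟨explicitScheme_hasCompletenessError hε₀ (by norm_num),
    fun k => 1 / (k : ℝ) ^ securityExponent ε β d k, ?_, ?_⟩
  · intro z
    refine squeeze_zero' (Eventually.of_forall fun k => by positivity) ?_
      (tendsto_one_div_atTop_nhds_zero_nat (𝕜 := ℝ))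
    -- An exponent of at least z + 1 leaves k^z times the bound at most 1/k.
    filter_upwards [hev (z + 1), eventually_ge_atTop 1] with k hk hk1
    have hk1' : (1 : ℝ) ≤ k := by exact_mod_cast hk1
    have hkpos : (0 : ℝ) < k := by linarith
    rw [mul_one_div, div_le_div_iff₀ (by positivity) hkpos, one_mul, ← pow_succ]
    exact pow_le_pow_right₀ hk1' hk
  · intro C
    obtain ⟨J, hJ⟩ := C.polySize.exists_pow
    filter_upwards [hJ, hev J, eventually_ge_atTop 1] with k hkJ hk hk1
    by_contra hcon
    push Not at hcon
    exact not_breakable_securityExponent (ε := ε) (β := β) (d := d) k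
      ⟨C.ancillas k, C.circuit k, hkJ.trans (Nat.pow_le_pow_right hk1 hk), hcon⟩

end Security

end HiddenSubspace

end

theorem theorem6p5 (ε β : ℝ) (d : ℕ) (hε₀ : 0 ≤ ε) (hε : ε < 1 / 2)
    (hβ : 3 / (1 - 2 * ε) ^ 2 ≤ β) (hd : 4 ≤ d) :
    (HiddenSubspace.GeneratorConjecture ε β d →
      (HiddenSubspace.explicitScheme ε β d).Secure) ∧
    (∀ (C : HiddenSubspace.Counterfeiter (HiddenSubspace.explicitScheme ε β d))
      (p : Polynomial ℕ),
      ∃ F : HiddenSubspace.GeneratorFinder β d, ∃ c : ℝ, 0 < c ∧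
        ∀ᶠ k : ℕ in Filter.atTop, 1 ≤ ((p.eval k : ℕ) : ℝ) * C.success k →
          c * (2 : ℝ) ^ (-((2 * k : ℕ) : ℝ) / 2) ≤ F.success ε k) :=
  ⟨HiddenSubspace.explicitScheme_secure hε₀ hε hβ (by omega),
    HiddenSubspace.exists_finder_of_counterfeiter hε₀ hε hβ (by omega)⟩
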